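/- **Notation.** Let $\tau$ range over the upper half-plane, $q^x=e^{2\pi i x\tau}$, $\zeta_n=e^{2\pi i/n}$, let $\eta(\tau)=q^{1/24}\prod_{n\ge1}(1-q^n)$ be the Dedekind eta function, and let $C$ be the Cartan matrix of $A_3$. Let $M\subset M^*$ be the root lattice of $A_3$ and its dual, the weight lattice; $M^*$ is identified with $\mathbb Z^3$ by the basis of fundamental weights, so that $M=C\mathbb Z^3$. For $\beta\in\mathbb Z^3$ the level $4$ $A_3$ theta function is $$\theta^\beta(\tau)=\sum_{m\in\mathbb Z^3}q^{\frac42\,{}^t(m+\frac14C^{-1}\beta)\,C\,(m+\frac14C^{-1}\beta)},$$ which depends only on the class of $\beta$ in $M^*/4M$. For positive integers $a,d$ with $ad=4$ and $0\le b<d$ put $$\Theta^{d,b}(\tau)=\frac{\eta(\tau)^4}{\eta\left(\frac{a\tau+b}{d}\right)}.$$ Consider the weight vectors $\lambda_0=(0,0,0)$; $\lambda_1^k=k(1,0,0)$ for $1\le k\le8$; $\lambda_2^k=k(0,1,0)$ for $k=1,2,3$; $\lambda_3^k=k(1,1,0)$ for $k=1,3,5,7$; $\lambda_4^k=k(1,0,1)$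 for $k=1,2$; $\lambda_5=(1,1,1)$; $\lambda_6=(2,1,0)$; $\lambda_7=(4,1,0)$; $\lambda_8=(1,4,1)$. Write $x_{j,k}=\theta^{\lambda_j^k}(\tau)$, and $x_j=\theta^{\lambda_j}(\tau)$ for $j=0,5,6,7,8$. Define $$(\tilde\Theta^{1,0})^3=P_{1,0},\qquad(\tilde\Theta^{2,0})^3=P_{2,0},\qquad(\tilde\Theta^{2,1})^3=\zeta_{16}^{-1}P_{2,1},$$ $$(\tilde\Theta^{4,b})^3=(-1)^b\zeta_{32}^{15b}\left(P_{4,0}+\zeta_4^{b}P_{4,1}+\zeta_4^{2b}P_{4,2}+\zeta_4^{3b}P_{4,3}\right),\quad b=0,1,2,3,$$ (the left-hand sides being mere names for these functions of $\tau$), where $P_{1,0}=x_{0}^3+8x_{4,2}^3-x_{1,8}^3+x_{0}^2x_{1,8}+24x_{0}x_{4,2}^2-x_{0}x_{1,8}^2 -24x_{4,2}x_{2,2}^2-8x_{0}x_{1,4}^2-12x_{0}x_{2,2}^2+12x_{1,8}x_{2,2}^2$, $P_{2,0}=x_{0}^2x_{1,2}-12x_{0}^2x_{1,6}-12x_{4,2}^2x_{1,2}-6x_{7}x_{2,3}^2-10x_{2,1}^2x_{2,3}+2x_{2,3}^2x_{2,1}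 +20x_{7}x_{2,1}x_{2,3}+36x_{7}x_{4,2}x_{8}+13x_{0}x_{2,3}x_{4,1}-x_{0}x_{4,2}x_{1,6}+12x_{0}x_{2,1}x_{8}-37x_{1,8}x_{7}x_{4,1} +x_{1,8}x_{2,1}x_{8}+x_{1,8}x_{2,3}x_{8}-8x_{7}^3$, $P_{2,1}=-8x_{2,1}x_{7}^2+64x_{0}^2x_{1,2}-16x_{7}x_{2,3}^2-14x_{2,1}^2x_{2,3}-82x_{2,3}^2x_{2,1}+80x_{1,8}x_{2,3}x_{4,1} +24x_{7}x_{2,1}x_{2,3}-63x_{0}x_{2,1}x_{4,1}+8x_{7}x_{4,2}x_{8}-x_{0}x_{2,3}x_{4,1}+16x_{1,8}x_{2,1}x_{4,1}+x_{1,8}x_{2,1}x_{8} -16x_{1,8}x_{7}x_{8}-x_{1,8}x_{2,3}x_{8}+8x_{1,8}x_{4,1}x_{7}$, $P_{4,0}=-10x_{3,1}x_{0}x_{7}+x_{2,1}x_{4,1}x_{1,1}+34x_{7}x_{8}x_{1,1}+2x_{2,1}x_{8}x_{1,1}+10x_{7}x_{1,5}x_{4,2}+x_{2,3}x_{8}x_{1,1}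 +58x_{6}x_{5}x_{3,3}-47x_{5}x_{3,7}x_{1,8}+3x_{2,2}x_{1,3}x_{2,1}+3x_{2,2}x_{1,3}x_{2,3}+24x_{6}x_{1,2}x_{1,5}-32x_{6}x_{3,5}x_{7} +43x_{6}x_{3,5}x_{2,1}+13x_{6}x_{3,5}x_{2,3}+4x_{6}x_{1,7}x_{7}-44x_{1,4}x_{3,7}x_{2,1}+9x_{5}x_{3,7}x_{0}+56x_{5}x_{1,7}x_{8} $, $P_{4,1}=62x_{1,7}x_{0}x_{2,3}-172x_{1,2}x_{3,1}x_{0}+x_{2,3}x_{1,5}x_{4,1}-319x_{2,3}x_{8}x_{1,5}+252x_{1,6}x_{1,8}x_{1,5}+79x_{1,6}x_{4,2}x_{1,5} +71x_{5}x_{1,8}x_{3,3}+6x_{5}x_{0}x_{1,1}+103x_{1,2}x_{1,1}x_{4,1}+x_{1,2}x_{1,8}x_{1,5}+204x_{1,4}x_{3,3}x_{2,3}+261x_{2,2}x_{3,3}x_{2,3} +66x_{3,5}x_{0}x_{2,1}-143x_{3,5}x_{1,8}x_{7}+3x_{3,5}x_{1,8}x_{2,3}+103x_{1,6}x_{3,3}x_{8}-122x_{1,4}x_{3,3}x_{7}-212x_{1,7}x_{4,2}x_{2,3}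 -62x_{1,7}x_{1,8}x_{2,1}+126x_{6}x_{1,3}x_{7}+134x_{6}x_{1,7}x_{1,6}-314x_{6}x_{1,3}x_{2,3}$, $P_{4,2}=-62x_{5}x_{1,1}x_{8}+x_{1,2}x_{8}x_{1,5}-15x_{1,7}x_{7}x_{8}+3x_{3,5}x_{2,3}x_{8}+3x_{2,2}x_{2,3}x_{1,5}+2x_{3,7}x_{1,8}x_{2,1} -11x_{3,7}x_{0}x_{7}+41x_{2,2}x_{3,1}x_{2,1}+106x_{2,2}x_{3,1}x_{7}+68x_{2,2}x_{3,1}x_{2,3}-24x_{3,1}x_{1,2}x_{4,1}-23x_{3,1}x_{1,6}x_{4,1} +4x_{1,4}x_{1,2}x_{1,1}+12x_{1,4}x_{1,2}x_{3,3}-8x_{2,2}x_{1,2}x_{1,1}+x_{1,7}x_{1,6}x_{1,8}+x_{1,7}x_{1,2}x_{0}+8x_{5}x_{6}x_{3,5} -23x_{1,3}x_{2,2}x_{5}-10x_{3,7}x_{2,2}x_{5}+54x_{3,7}x_{1,2}x_{6}$, $P_{4,3}=-14x_{1,7}x_{1,6}x_{4,1}-16x_{3,5}x_{1,4}x_{2,1}+58x_{3,5}x_{1,2}x_{4,1}+44x_{1,7}x_{2,2}x_{2,1}-5x_{3,5}x_{2,2}x_{2,1}+3x_{3,7}x_{2,3}x_{8}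 -63x_{3,7}x_{2,1}x_{4,1}+62x_{1,6}x_{6}x_{3,3}+19x_{1,4}x_{5}x_{1,1}+19x_{2,2}x_{5}x_{1,1}+2x_{3,7}x_{1,2}x_{0}-26x_{3,1}x_{6}x_{7} +14x_{6}x_{2,1}x_{1,5}+4x_{6}x_{7}x_{1,5}+9x_{3,5}x_{5}x_{0}-24x_{1,7}x_{5}x_{0}+2x_{1,3}x_{1,2}x_{0}+x_{1,3}x_{1,2}x_{1,8} +x_{1,3}x_{1,6}x_{0}+44x_{1,7}x_{1,2}x_{4,1}-6x_{5}x_{6}x_{3,7}$. **Theorem.** 1. The group generated by the Weyl group of $A_3$ and $\beta\mapsto-\beta$ has exactly 22 orbits on $M^*/4M$, and the 22 vectors $\lambda_j^k$ above represent each orbit exactly once. The function $\theta^\beta$ depends only on the orbit of $\beta$. 2. $\left(\Theta^{d,b}(\tau)\right)^3=(\tilde\Theta^{d,b}(\tau))^3$ for all $\tau$ in the upper half-plane and all $(d,b)$ with $d\mid 4$, $0\le b<d$. 3. For all $\tau$ in the upper half-plane, with the principal branch of the power, $$(\tilde\Theta^{1,0}(-1/\tau))^3=(-i\tau)^{9/2}\,2^3\,(\tilde\Theta^{4,0}(\tau))^3,\qquad(\tilde\Theta^{2,0}(-1/\tau))^3=(-i\tau)^{9/2}(\tilde\Theta^{2,0}(\tau))^3,$$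 $$(\tilde\Theta^{2,1}(-1/\tau))^3=(-i\tau)^{9/2}\,2\sqrt2\,(\tilde\Theta^{4,2}(\tau))^3,\qquad(\tilde\Theta^{4,1}(-1/\tau))^3=(-i\tau)^{9/2}\,\zeta_4\,(\tilde\Theta^{4,3}(\tau))^3,$$ and the cubes $(\Theta^{d,b})^3$ of the eta quotients satisfy the same four relations. 4. $m=3$ is the least positive integer $m$ such that for all $ad=4$, $0\le b<d$, the power $\left(\Theta^{d,b}(\tau)\right)^m$ is of the form $$\sum_{(\beta_1,\dots,\beta_m)\in(M^*/4M)^m}n_{\beta}\,\zeta_{24}^{k_1(\beta)}\zeta_{32}^{k_2(\beta)}\,\theta^{\beta_1}(\tau)\cdots\theta^{\beta_m}(\tau)$$ with integers $n_\beta,k_1(\beta),k_2(\beta)$ (depending on $d,b$ and on $\beta=(\beta_1,\dots,\beta_m)$). -/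

import Mathlib

open Matrix

noncomputable section

namespace BlowUp

/-- Weight vectors of `A₃`, i.e. elements of the dual lattice `M*`, written in the basis of
fundamental weights. -/
abbrev Weight : Type := Fin 3 → ℤ

/-- The Cartan matrix of `A₃`. -/
abbrev C : Matrix (Fin 3) (Fin 3) ℤ := CartanMatrix.A 3

/-- The Cartan matrix of `A₃` with real entries. -/
def CR : Matrix (Fin 3) (Fin 3) ℝ := C.map (fun n : ℤ => (n : ℝ))

/-- The sublattice `4M` of `M*`, where `M` is the root lattice: the `i`-th simple root is the
`i`-th column of `C` in the basis of fundamental weights. -/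
def fourM : Submodule ℤ Weight := LinearMap.range (Matrix.mulVecLin ((4 : ℤ) • C))

/-- The finite group `M* / 4M`. -/
abbrev WeightMod : Type := Weight ⧸ fourM

/-- The vector `m + (1/4) C⁻¹ β`. -/
def shiftVec (β m : Weight) : Fin 3 → ℝ :=
  (fun i => (m i : ℝ)) + (1 / 4 : ℝ) • (CR⁻¹ *ᵥ (fun i => (β i : ℝ)))

/-- The exponent `(4/2) ᵗ(m + C⁻¹β/4) C (m + C⁻¹β/4)`. -/
def thetaExp (β m : Weight) : ℝ :=
  (4 / 2 : ℝ) * (shiftVec β m ⬝ᵥ (CR *ᵥ shiftVec β m))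

/-- The level `4` `A₃` theta function with weight vector `β`, as a series in `q = exp (2πiτ)`. -/
def theta (β : Weight) (τ : ℂ) : ℂ :=
  ∑' m : Weight, Complex.exp (2 * Real.pi * Complex.I * τ * (thetaExp β m : ℂ))

theorem CR_isUnit_det : IsUnit CR.det := by
  have h : CR = !![2, -1, 0; -1, 2, -1; 0, -1, 2] := by
    ext i j
    fin_cases i <;> fin_cases j <;> simp [CR, C, CartanMatrix.A]
  rw [h, Matrix.det_fin_three]
  simp only [isUnit_iff_ne_zero, of_apply, cons_val]
  norm_num

theorem shiftVec_add (β k m : Weight) :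
    shiftVec (β + Matrix.mulVecLin ((4 : ℤ) • C) k) m = shiftVec β (m + k) := by
  have h : (fun i => (((β + Matrix.mulVecLin ((4 : ℤ) • C) k) i : ℤ) : ℝ))
      = (fun i => (β i : ℝ)) + (4 : ℝ) • (CR *ᵥ (fun i => (k i : ℝ))) := by
    ext i
    simp [CR, Matrix.mulVec, dotProduct, Finset.mul_sum]
  rw [shiftVec, shiftVec, h, Matrix.mulVec_add, Matrix.mulVec_smul, Matrix.mulVec_mulVec,
    Matrix.nonsing_inv_mul _ CR_isUnit_det, Matrix.one_mulVec]
  ext i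
  simp
  ring

theorem theta_add (β k : Weight) (τ : ℂ) :
    theta (β + Matrix.mulVecLin ((4 : ℤ) • C) k) τ = theta β τ := by
  unfold theta thetaExp
  simp only [shiftVec_add]
  exact (Equiv.addRight k).tsum_eq
    (fun m : Weight => Complex.exp (2 * Real.pi * Complex.I * τ *
      (((4 / 2 : ℝ) * (shiftVec β m ⬝ᵥ (CR *ᵥ shiftVec β m)) : ℝ) : ℂ)))

theorem theta_congr (β γ : Weight) (h : β - γ ∈ fourM) (τ : ℂ) : theta β τ = theta γ τ := by
  obtain ⟨k, hk⟩ := h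
  rw [← theta_add γ k τ, hk, add_sub_cancel]

/-- The theta function of a class in `M* / 4M`. -/
def thetaMod (x : WeightMod) (τ : ℂ) : ℂ :=
  Quotient.liftOn' x (fun β => theta β τ) (fun β γ h =>
    theta_congr β γ ((Submodule.quotientRel_def fourM).1 h) τ)

theorem C_diag (i : Fin 3) : (LinearMap.proj i : Weight →ₗ[ℤ] ℤ) (C.col i) = 2 := by
  fin_cases i <;> simp [C, CartanMatrix.A]

/-- The `i`-th simple reflection `β ↦ β - βᵢ αᵢ` on the weight lattice. -/
def simpleReflection (i : Fin 3) : Weight ≃ₗ[ℤ] Weight := Module.reflection (C_diag i)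

/-- The Weyl group of `A₃`, acting on the weight lattice. -/
def weylGroup : Subgroup (Weight ≃ₗ[ℤ] Weight) := Subgroup.closure (Set.range simpleReflection)

/-- The orbit of the class of `β` in `M* / 4M` under the Weyl group and the sign change
`β ↦ -β`. -/
def orbit (β : Weight) : Set WeightMod :=
  {x | ∃ w ∈ weylGroup, x = fourM.mkQ (w β) ∨ x = fourM.mkQ (-(w β))}

/-- The chosen weight vectors: `lam j k` is `λ_j^k`; `λ_0, λ_5, λ_6, λ_7, λ_8`, which carry no
upper index, are `lam j 1`. -/
def lam (j k : ℕ) : Weight :=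
  (k : ℤ) •
    match j with
    | 0 => ![0, 0, 0]
    | 1 => ![1, 0, 0]
    | 2 => ![0, 1, 0]
    | 3 => ![1, 1, 0]
    | 4 => ![1, 0, 1]
    | 5 => ![1, 1, 1]
    | 6 => ![2, 1, 0]
    | 7 => ![4, 1, 0]
    | _ => ![1, 4, 1]

/-- The indices `(j, k)` of the weight vectors `λ_j^k` in use. -/
def lamIndex : Finset (ℕ × ℕ) :=
  {(0, 1), (1, 1), (1, 2), (1, 3), (1, 4), (1, 5), (1, 6), (1, 7), (1, 8), (2, 1), (2, 2), (2, 3),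
    (3, 1), (3, 3), (3, 5), (3, 7), (4, 1), (4, 2), (5, 1), (6, 1), (7, 1), (8, 1)}

/-- `ζ_n = exp (2πi/n)`. -/
def zeta (n : ℕ) : ℂ := Complex.exp (2 * Real.pi * Complex.I / n)

/-- `Θ^{d,b}`, defined by `1 / η((aτ+b)/d) = Θ^{d,b}(τ) / η(τ)^4`, where `ad = 4`. -/
def Theta (a d b : ℕ) (τ : ℂ) : ℂ :=
  ModularForm.eta τ ^ 4 / ModularForm.eta ((a * τ + b) / d)

/-! In the following cubic polynomials the variable `t j k` stands for the theta function with
weight vector `lam j k`. -/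

def poly10 (t : ℕ → ℕ → ℂ) : ℂ :=
  t 0 1 ^ 3 + 8 * t 4 2 ^ 3 - t 1 8 ^ 3 + t 0 1 ^ 2 * t 1 8 + 24 * t 0 1 * t 4 2 ^ 2
    - t 0 1 * t 1 8 ^ 2 - 24 * t 4 2 * t 2 2 ^ 2 - 8 * t 0 1 * t 1 4 ^ 2
    - 12 * t 0 1 * t 2 2 ^ 2 + 12 * t 1 8 * t 2 2 ^ 2

def poly20 (t : ℕ → ℕ → ℂ) : ℂ :=
  t 0 1 ^ 2 * t 1 2 - 12 * t 0 1 ^ 2 * t 1 6 - 12 * t 4 2 ^ 2 * t 1 2 - 6 * t 7 1 * t 2 3 ^ 2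
    - 10 * t 2 1 ^ 2 * t 2 3 + 2 * t 2 3 ^ 2 * t 2 1 + 20 * t 7 1 * t 2 1 * t 2 3
    + 36 * t 7 1 * t 4 2 * t 8 1 + 13 * t 0 1 * t 2 3 * t 4 1 - t 0 1 * t 4 2 * t 1 6
    + 12 * t 0 1 * t 2 1 * t 8 1 - 37 * t 1 8 * t 7 1 * t 4 1 + t 1 8 * t 2 1 * t 8 1
    + t 1 8 * t 2 3 * t 8 1 - 8 * t 7 1 ^ 3

def poly21 (t : ℕ → ℕ → ℂ) : ℂ :=
  -8 * t 2 1 * t 7 1 ^ 2 + 64 * t 0 1 ^ 2 * t 1 2 - 16 * t 7 1 * t 2 3 ^ 2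
    - 14 * t 2 1 ^ 2 * t 2 3 - 82 * t 2 3 ^ 2 * t 2 1 + 80 * t 1 8 * t 2 3 * t 4 1
    + 24 * t 7 1 * t 2 1 * t 2 3 - 63 * t 0 1 * t 2 1 * t 4 1 + 8 * t 7 1 * t 4 2 * t 8 1
    - t 0 1 * t 2 3 * t 4 1 + 16 * t 1 8 * t 2 1 * t 4 1 + t 1 8 * t 2 1 * t 8 1
    - 16 * t 1 8 * t 7 1 * t 8 1 - t 1 8 * t 2 3 * t 8 1 + 8 * t 1 8 * t 4 1 * t 7 1

def poly40 (t : ℕ → ℕ → ℂ) : ℂ :=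
  -10 * t 3 1 * t 0 1 * t 7 1 + t 2 1 * t 4 1 * t 1 1 + 34 * t 7 1 * t 8 1 * t 1 1
    + 2 * t 2 1 * t 8 1 * t 1 1 + 10 * t 7 1 * t 1 5 * t 4 2 + t 2 3 * t 8 1 * t 1 1
    + 58 * t 6 1 * t 5 1 * t 3 3 - 47 * t 5 1 * t 3 7 * t 1 8 + 3 * t 2 2 * t 1 3 * t 2 1
    + 3 * t 2 2 * t 1 3 * t 2 3 + 24 * t 6 1 * t 1 2 * t 1 5 - 32 * t 6 1 * t 3 5 * t 7 1
    + 43 * t 6 1 * t 3 5 * t 2 1 + 13 * t 6 1 * t 3 5 * t 2 3 + 4 * t 6 1 * t 1 7 * t 7 1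
    - 44 * t 1 4 * t 3 7 * t 2 1 + 9 * t 5 1 * t 3 7 * t 0 1 + 56 * t 5 1 * t 1 7 * t 8 1

def poly41 (t : ℕ → ℕ → ℂ) : ℂ :=
  62 * t 1 7 * t 0 1 * t 2 3 - 172 * t 1 2 * t 3 1 * t 0 1 + t 2 3 * t 1 5 * t 4 1
    - 319 * t 2 3 * t 8 1 * t 1 5 + 252 * t 1 6 * t 1 8 * t 1 5 + 79 * t 1 6 * t 4 2 * t 1 5
    + 71 * t 5 1 * t 1 8 * t 3 3 + 6 * t 5 1 * t 0 1 * t 1 1 + 103 * t 1 2 * t 1 1 * t 4 1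
    + t 1 2 * t 1 8 * t 1 5 + 204 * t 1 4 * t 3 3 * t 2 3 + 261 * t 2 2 * t 3 3 * t 2 3
    + 66 * t 3 5 * t 0 1 * t 2 1 - 143 * t 3 5 * t 1 8 * t 7 1 + 3 * t 3 5 * t 1 8 * t 2 3
    + 103 * t 1 6 * t 3 3 * t 8 1 - 122 * t 1 4 * t 3 3 * t 7 1 - 212 * t 1 7 * t 4 2 * t 2 3
    - 62 * t 1 7 * t 1 8 * t 2 1 + 126 * t 6 1 * t 1 3 * t 7 1 + 134 * t 6 1 * t 1 7 * t 1 6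
    - 314 * t 6 1 * t 1 3 * t 2 3

def poly42 (t : ℕ → ℕ → ℂ) : ℂ :=
  -62 * t 5 1 * t 1 1 * t 8 1 + t 1 2 * t 8 1 * t 1 5 - 15 * t 1 7 * t 7 1 * t 8 1
    + 3 * t 3 5 * t 2 3 * t 8 1 + 3 * t 2 2 * t 2 3 * t 1 5 + 2 * t 3 7 * t 1 8 * t 2 1
    - 11 * t 3 7 * t 0 1 * t 7 1 + 41 * t 2 2 * t 3 1 * t 2 1 + 106 * t 2 2 * t 3 1 * t 7 1
    + 68 * t 2 2 * t 3 1 * t 2 3 - 24 * t 3 1 * t 1 2 * t 4 1 - 23 * t 3 1 * t 1 6 * t 4 1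
    + 4 * t 1 4 * t 1 2 * t 1 1 + 12 * t 1 4 * t 1 2 * t 3 3 - 8 * t 2 2 * t 1 2 * t 1 1
    + t 1 7 * t 1 6 * t 1 8 + t 1 7 * t 1 2 * t 0 1 + 8 * t 5 1 * t 6 1 * t 3 5
    - 23 * t 1 3 * t 2 2 * t 5 1 - 10 * t 3 7 * t 2 2 * t 5 1 + 54 * t 3 7 * t 1 2 * t 6 1

def poly43 (t : ℕ → ℕ → ℂ) : ℂ :=
  -14 * t 1 7 * t 1 6 * t 4 1 - 16 * t 3 5 * t 1 4 * t 2 1 + 58 * t 3 5 * t 1 2 * t 4 1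
    + 44 * t 1 7 * t 2 2 * t 2 1 - 5 * t 3 5 * t 2 2 * t 2 1 + 3 * t 3 7 * t 2 3 * t 8 1
    - 63 * t 3 7 * t 2 1 * t 4 1 + 62 * t 1 6 * t 6 1 * t 3 3 + 19 * t 1 4 * t 5 1 * t 1 1
    + 19 * t 2 2 * t 5 1 * t 1 1 + 2 * t 3 7 * t 1 2 * t 0 1 - 26 * t 3 1 * t 6 1 * t 7 1
    + 14 * t 6 1 * t 2 1 * t 1 5 + 4 * t 6 1 * t 7 1 * t 1 5 + 9 * t 3 5 * t 5 1 * t 0 1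
    - 24 * t 1 7 * t 5 1 * t 0 1 + 2 * t 1 3 * t 1 2 * t 0 1 + t 1 3 * t 1 2 * t 1 8
    + t 1 3 * t 1 6 * t 0 1 + 44 * t 1 7 * t 1 2 * t 4 1 - 6 * t 5 1 * t 6 1 * t 3 7

/-- The cubic expressions `(Θ~^{d,b})³` in the theta functions, for `d = 1, 2, 4` and
`0 ≤ b < d`. -/
def tildeThetaCube (d b : ℕ) (τ : ℂ) : ℂ :=
  let t : ℕ → ℕ → ℂ := fun j k => theta (lam j k) τ
  match d, b with
  | 1, _ => poly10 t
  | 2, 0 => poly20 t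
  | 2, _ => (zeta 16)⁻¹ * poly21 t
  | 4, b => (-1) ^ b * zeta 32 ^ (15 * b) *
      (poly40 t + zeta 4 ^ b * poly41 t + zeta 4 ^ (2 * b) * poly42 t
        + zeta 4 ^ (3 * b) * poly43 t)
  | _, _ => 0

/-- For every `ad = 4` and `0 ≤ b < d`, the `m`-th power of `Θ^{d,b}` is a linear combination of
products of `m` level `4` `A₃` theta functions, with coefficients of the form
`n ζ_24^k₁ ζ_32^k₂`, where `n`, `k₁`, `k₂` are integers depending on `d`, `b` and on the product
in question. -/
def PowerExpressible (m : ℕ) : Prop :=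
  ∀ a d b : ℕ, a * d = 4 → b < d →
    ∃ (n : (Fin m → WeightMod) →₀ ℤ) (k₁ k₂ : (Fin m → WeightMod) → ℤ),
      ∀ τ : ℂ, 0 < τ.im →
        Theta a d b τ ^ m =
          n.sum fun β c => (c : ℂ) * zeta 24 ^ k₁ β * zeta 32 ^ k₂ β * ∏ i, thetaMod (β i) τ

end BlowUp

end

/-! The root lattice A₃ is D₃, the triples in ℤ³ with even coordinate sum. Detecting evenness by
averaging the trivial and the sign character writes each level 4 theta function as half the sum of
two products of three one-variable theta series (`theta_eq`). Weyl reflections become signed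
permutations of the coordinates, so invariance reduces to evenness of these series. Only nine
nonzero one-variable constants occur, and the rotation (n, m) ↦ (n + m, n - m) yields quartic
Riemann relations between them (`thetaRelations`).

Modulo these relations `poly10`, `poly20`, `poly21` and the sums `poly40 + poly42`, `poly41 +
poly43` take short closed forms. On the other side η³ is half the product of the three Jacobi theta
constants (`eta_cube`): the quotient of the two is a level one modular form of weight 0 with limit 1
at infinity. Hence the cube of an eta quotient is `thetaProd τ ^ 4` divided by `thetaProd` at
(aτ+b)/d, and part 2 becomes an identity between the nine constants. For d = 4 only b = 0 needs this
argument: the four polynomials are eigenfunctions of τ ↦ τ + 1, and the roots of unity in the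
definition are what translation by b produces. Part 3 follows from the behaviour of `thetaProd`
under inversion and translation.

For part 1, `key` is an orbit invariant built in the shape of `theta_eq` and takes distinct values
on the 22 vectors; conversely, applying the 24 Weyl elements and signs to these vectors reaches all
256 classes.

For minimality, compare eigenvalues under τ ↦ τ + 4. The m-th power of Θ^{4,0} has eigenvalue
ζ₈^{5m}, while a product of m theta functions has ζ₈ raised to a sum of m numbers congruent to 0, 3
or 4 mod 8. For m = 1, 2 these never agree, and averaging over eight translates forces the power to
vanish, which it does not. -/

noncomputable section

namespace BlowUp

/-! ### One-variable theta series with a sign character -/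

/-- The one-variable theta series `∑ sⁿ exp (2πi t (n + x)²)` with sign character `s`. -/
def th (s : ℤˣ) (x t : ℂ) : ℂ :=
  ∑' n : ℤ, ((s ^ n : ℤˣ) : ℂ) * Complex.exp (2 * Real.pi * Complex.I * t * (n + x) ^ 2)

theorem units_cast_sq (s : ℤˣ) : (s : ℂ) * (s : ℂ) = 1 := by
  rcases Int.units_eq_one_or s with rfl | rfl <;> simp

@[simp]
theorem units_inv_eq (s : ℤˣ) : s⁻¹ = s := by
  rcases Int.units_eq_one_or s with rfl | rfl <;> rfl

theorem norm_units_cast (s : ℤˣ) : ‖(s : ℂ)‖ = 1 := by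
  rcases Int.units_eq_one_or s with rfl | rfl <;> simp

/-- Expanding the square gives access to summability and to the functional equation of
`jacobiTheta₂`. -/
theorem exp_sq_eq_jacobiTheta₂_term (n : ℤ) (x t : ℂ) :
    Complex.exp (2 * Real.pi * Complex.I * t * (n + x) ^ 2) =
      Complex.exp (2 * Real.pi * Complex.I * t * x ^ 2) * jacobiTheta₂_term n (2 * x * t) (2 * t) := by
  rw [jacobiTheta₂_term, ← Complex.exp_add]
  congr 1
  ring

theorem summable_norm_th (s : ℤˣ) (x : ℂ) {t : ℂ} (ht : 0 < t.im) :
    Summable fun n : ℤ =>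
      ‖((s ^ n : ℤˣ) : ℂ) * Complex.exp (2 * Real.pi * Complex.I * t * (n + x) ^ 2)‖ := by
  have h : 0 < (2 * t).im := by simpa using ht
  have := ((summable_jacobiTheta₂_term_iff (2 * x * t) (2 * t)).2 h).norm.mul_left
    ‖Complex.exp (2 * Real.pi * Complex.I * t * x ^ 2)‖
  refine this.congr fun n => ?_
  rw [norm_mul, norm_units_cast, one_mul, exp_sq_eq_jacobiTheta₂_term, norm_mul]

theorem summable_th (s : ℤˣ) (x : ℂ) {t : ℂ} (ht : 0 < t.im) :
    Summable fun n : ℤ =>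
      ((s ^ n : ℤˣ) : ℂ) * Complex.exp (2 * Real.pi * Complex.I * t * (n + x) ^ 2) :=
  (summable_norm_th s x ht).of_norm

theorem th_neg (s : ℤˣ) (x t : ℂ) : th s (-x) t = th s x t := by
  unfold th
  rw [← (Equiv.neg ℤ).tsum_eq]
  refine tsum_congr fun n => ?_
  have h : s ^ (-n) = s ^ n := by rw [_root_.zpow_neg, units_inv_eq]
  rw [Equiv.neg_apply, h]
  congr 2
  push_cast
  ring

theorem th_add_one (s : ℤˣ) (x t : ℂ) : th s (x + 1) t = s * th s x t := by
  unfold th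
  rw [← tsum_mul_left, ← (Equiv.subRight (1 : ℤ)).tsum_eq]
  refine tsum_congr fun n => ?_
  have h : s ^ (n - 1) = s * s ^ n := by
    rw [_root_.zpow_sub, zpow_one, units_inv_eq, mul_comm]
  rw [Equiv.subRight_apply, h, ← mul_assoc]
  congr 1
  · push_cast
    ring
  · congr 1
    push_cast
    ring

/-- In c(n + x)² the term cn² is an integer and disappears, 2cnx = jn/2 becomes the sign (-1)^{jn},
and cx² is a constant phase. -/
theorem th_shift (s : ℤˣ) (x t : ℂ) (c j : ℤ) (h : 4 * x * c = j) :
    th s x (t + c) =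
      Complex.exp (2 * Real.pi * Complex.I * (c * x ^ 2)) * th (s * (-1) ^ j) x t := by
  unfold th
  rw [← tsum_mul_left]
  refine tsum_congr fun n => ?_
  have h1 : (((-1 : ℤˣ) ^ j) ^ n : ℤˣ) = (-1) ^ (j * n) := (_root_.zpow_mul _ _ _).symm
  have h2 : ((((-1 : ℤˣ) ^ (j * n) : ℤˣ) : ℤ) : ℂ)
      = Complex.exp (2 * Real.pi * Complex.I * (c * (2 * n * x))) := by
    have : (2 * Real.pi * Complex.I * (c * (2 * n * x)) : ℂ)
        = (j * n : ℤ) * (Real.pi * Complex.I) := by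
      push_cast
      linear_combination (Real.pi * Complex.I * n) * h
    rw [this, Complex.exp_int_mul, Complex.exp_pi_mul_I]
    rcases Int.even_or_odd (j * n) with h | h <;> simp [h.neg_one_zpow]
  have h3 : Complex.exp (2 * Real.pi * Complex.I * (t + c) * (n + x) ^ 2)
      = Complex.exp (2 * Real.pi * Complex.I * t * (n + x) ^ 2) *
        (Complex.exp (2 * Real.pi * Complex.I * (c * (2 * n * x))) *
        Complex.exp (2 * Real.pi * Complex.I * (c * x ^ 2))) := by
    rw [← Complex.exp_add, ← Complex.exp_add]
    rw [← Complex.exp_periodic.int_mul (c * n ^ 2) (_ + (_ + _))]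
    congr 1
    push_cast
    ring
  rw [mul_zpow, h1, h3, ← h2]
  push_cast
  ring

theorem tsum_eq_add_of_isCompl {β γ δ : Type*} {f : β → ℂ} (hf : Summable f) {g : γ → β} {h : δ → β}
    (hg : Function.Injective g) (hh : Function.Injective h)
    (hc : IsCompl (Set.range g) (Set.range h)) :
    ∑' b, f b = ∑' c, f (g c) + ∑' d, f (h d) := by
  have h1 : HasSum (f ∘ ((↑) : Set.range g → β)) (∑' c, f (g c)) :=
    hg.hasSum_range_iff.2 (hf.comp_injective hg).hasSum
  have h2 : HasSum (f ∘ ((↑) : Set.range h → β)) (∑' d, f (h d)) :=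
    hh.hasSum_range_iff.2 (hf.comp_injective hh).hasSum
  exact (h1.add_isCompl hc h2).tsum_eq

theorem units_zpow_two_mul (s : ℤˣ) (n : ℤ) : s ^ (2 * n) = 1 := by
  rw [_root_.zpow_mul, zpow_two, Int.units_mul_self, _root_.one_zpow]

/-- Splitting of the series according to the parity of the summation index. -/
theorem th_split (s : ℤˣ) (x : ℂ) {t : ℂ} (ht : 0 < t.im) :
    th s x t = th 1 (x / 2) (4 * t) + s * th 1 ((x + 1) / 2) (4 * t) := by
  have hc : IsCompl (Set.range fun n : ℤ => 2 * n) (Set.range fun n : ℤ => 2 * n + 1) := by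
    constructor
    · rw [Set.disjoint_left]
      rintro _ ⟨m, rfl⟩ ⟨n, hn⟩
      simp only at hn
      omega
    · rw [codisjoint_iff_le_sup]
      intro n _
      rcases Int.even_or_odd' n with ⟨k, h | h⟩
      exacts [Or.inl ⟨k, h.symm⟩, Or.inr ⟨k, h.symm⟩]
  unfold th
  rw [tsum_eq_add_of_isCompl (summable_th s x ht) (fun m n h => by simpa using h)
    (fun m n h => by simpa using h) hc, ← tsum_mul_left]
  congr 1
  · refine tsum_congr fun n => ?_
    rw [units_zpow_two_mul, _root_.one_zpow]
    congr 2
    push_cast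
    ring
  · refine tsum_congr fun n => ?_
    rw [_root_.zpow_add, units_zpow_two_mul, _root_.one_zpow, zpow_one, one_mul]
    simp only [Units.val_one, Int.cast_one, one_mul]
    congr 2
    push_cast
    ring

/-- The rotation reaches the pairs of equal parity; moving the first entry by one gives the pairs of
opposite parity. -/
theorem isCompl_range_rotation : IsCompl
    (Set.range fun p : ℤ × ℤ => (p.1 + p.2, p.1 - p.2))
    (Set.range fun p : ℤ × ℤ => (p.1 + p.2 + 1, p.1 - p.2)) := by
  constructor
  · rw [Set.disjoint_left]
    rintro _ ⟨⟨m, n⟩, rfl⟩ ⟨⟨k, l⟩, h⟩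
    simp only [Prod.mk.injEq] at h
    omega
  · rw [codisjoint_iff_le_sup]
    rintro ⟨m, n⟩ _
    rcases Int.even_or_odd' (m + n) with ⟨k, h | h⟩
    · exact Or.inl ⟨(k, m - k), by simp only [Prod.mk.injEq]; omega⟩
    · exact Or.inr ⟨(k, m - 1 - k), by simp only [Prod.mk.injEq]; omega⟩

/-- The product of two theta series, by the rotation `(n, m) ↦ (n + m, n - m)`. -/
theorem th_mul (s r : ℤˣ) (x y : ℂ) {t : ℂ} (ht : 0 < t.im) :
    th s x t * th r y t =
      th (s * r) ((x + y) / 2) (2 * t) * th (s * r) ((x - y) / 2) (2 * t) +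
      s * (th (s * r) ((x + y + 1) / 2) (2 * t) * th (s * r) ((x - y + 1) / 2) (2 * t)) := by
  have h2 : 0 < (2 * t).im := by simpa using ht
  have hs := summable_mul_of_summable_norm (summable_norm_th s x ht) (summable_norm_th r y ht)
  -- Signs are their own inverses, so r^{-l} = r^l and both rotated factors carry the same character
  -- sr.
  have hchar : ∀ k l : ℤ, s ^ (k + l) * r ^ (k - l) = (s * r) ^ k * (s * r) ^ l := by
    intro k l
    rw [_root_.zpow_add, _root_.zpow_sub, mul_zpow, mul_zpow, ← _root_.inv_zpow, units_inv_eq]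
    exact mul_mul_mul_comm _ _ _ _
  unfold th
  rw [tsum_mul_tsum_of_summable_norm (summable_norm_th s x ht) (summable_norm_th r y ht),
    tsum_mul_tsum_of_summable_norm (summable_norm_th _ _ h2) (summable_norm_th _ _ h2),
    tsum_mul_tsum_of_summable_norm (summable_norm_th _ _ h2) (summable_norm_th _ _ h2),
    tsum_eq_add_of_isCompl hs _ _ isCompl_range_rotation, ← tsum_mul_left]
  · congr 1
    · refine tsum_congr fun p => ?_
      have h1 := congrArg (fun u : ℤˣ => ((u : ℤ) : ℂ)) (hchar p.1 p.2)
      have h3 : Complex.exp (2 * Real.pi * Complex.I * t * ((p.1 + p.2 : ℤ) + x) ^ 2) *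
          Complex.exp (2 * Real.pi * Complex.I * t * ((p.1 - p.2 : ℤ) + y) ^ 2) =
          Complex.exp (2 * Real.pi * Complex.I * (2 * t) * (p.1 + (x + y) / 2) ^ 2) *
          Complex.exp (2 * Real.pi * Complex.I * (2 * t) * (p.2 + (x - y) / 2) ^ 2) := by
        rw [← Complex.exp_add, ← Complex.exp_add]
        congr 1
        push_cast
        ring
      simp only [Units.val_mul, Int.cast_mul] at h1
      rw [mul_mul_mul_comm, h3, h1, mul_mul_mul_comm]
    · refine tsum_congr fun p => ?_
      have h1 := congrArg (fun u : ℤˣ => ((u : ℤ) : ℂ)) (hchar p.1 p.2)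
      have h3 : Complex.exp (2 * Real.pi * Complex.I * t * ((p.1 + p.2 + 1 : ℤ) + x) ^ 2) *
          Complex.exp (2 * Real.pi * Complex.I * t * ((p.1 - p.2 : ℤ) + y) ^ 2) =
          Complex.exp (2 * Real.pi * Complex.I * (2 * t) * (p.1 + (x + y + 1) / 2) ^ 2) *
          Complex.exp (2 * Real.pi * Complex.I * (2 * t) * (p.2 + (x - y + 1) / 2) ^ 2) := by
        rw [← Complex.exp_add, ← Complex.exp_add]
        congr 1
        push_cast
        ring
      have h4 : s ^ (p.1 + p.2 + 1) = s * s ^ (p.1 + p.2) := by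
        rw [_root_.zpow_add, zpow_one, mul_comm]
      simp only [Units.val_mul, Int.cast_mul] at h1
      rw [mul_mul_mul_comm, h3, h4]
      simp only [Units.val_mul, Int.cast_mul]
      generalize Complex.exp (_ * (_ : ℂ) ^ 2) = u
      generalize Complex.exp (_ * (_ : ℂ) ^ 2) = v
      linear_combination s * u * v * h1
  · rintro ⟨a, b⟩ ⟨c, d⟩ h
    simp only [Prod.mk.injEq] at h ⊢
    omega
  · rintro ⟨a, b⟩ ⟨c, d⟩ h
    simp only [Prod.mk.injEq] at h ⊢
    omega

/-! ### Theta constants of level 8, and A₃ as the lattice D₃ -/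

/-- The one-variable theta constants of level `8`: `∑ sⁿ q^((8n+j)²/32)`. -/
def thA (s : ℤˣ) (j : ℤ) (τ : ℂ) : ℂ := th s (j / 8) (2 * τ)

theorem thA_neg (s : ℤˣ) (j : ℤ) (τ : ℂ) : thA s (-j) τ = thA s j τ := by
  rw [thA, thA, ← th_neg]
  congr 1
  push_cast
  ring

theorem thA_add_eight (s : ℤˣ) (j : ℤ) (τ : ℂ) : thA s (j + 8) τ = s * thA s j τ := by
  rw [thA, thA, ← th_add_one]
  congr 1
  push_cast
  ring

/-- Coordinates of a weight with respect to the orthonormal basis of `D₃ = A₃`, doubled. -/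
def coordX (β : Weight) : ℤ := β 0 + 2 * β 1 + β 2

/-- The second orthogonal coordinate of a weight vector, doubled. -/
def coordY (β : Weight) : ℤ := β 0 + β 2

/-- The third orthogonal coordinate of a weight vector, doubled. -/
def coordZ (β : Weight) : ℤ := β 2 - β 0

theorem CR_eq : CR = !![2, -1, 0; -1, 2, -1; 0, -1, 2] := by
  ext i j
  fin_cases i <;> fin_cases j <;> simp [CR, C, CartanMatrix.A]

theorem CR_inv_eq : CR⁻¹ = !![3/4, 1/2, 1/4; 1/2, 1, 1/2; 1/4, 1/2, 3/4] := by
  refine Matrix.inv_eq_right_inv ?_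
  rw [CR_eq]
  ext i j
  fin_cases i <;> fin_cases j <;> simp [Matrix.mul_apply, Fin.sum_univ_three] <;> norm_num

/-- The form of A₃ is diagonal in the coordinates m₁, m₀ + m₂ - m₁, m₂ - m₀; the shift C⁻¹β/4
contributes one eighth of the doubled coordinates of β. -/
theorem thetaExp_eq (β m : Weight) :
    thetaExp β m = 2 * (((m 1 : ℝ) + coordX β / 8) ^ 2 +
      ((m 0 + m 2 - m 1 : ℝ) + coordY β / 8) ^ 2 + ((m 2 - m 0 : ℝ) + coordZ β / 8) ^ 2) := by
  rw [thetaExp, shiftVec, CR_inv_eq, CR_eq, coordX, coordY, coordZ]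
  simp [Matrix.mulVec, dotProduct, Fin.sum_univ_three]
  ring

theorem tsum_weight (f : ℤ × ℤ × ℤ → ℂ) :
    ∑' m : Weight, f (m 1, m 0 + m 2 - m 1, m 2 - m 0) =
      ∑' p : ℤ × ℤ × ℤ, (if Even (p.1 + p.2.1 + p.2.2) then f p else 0) := by
  have hinj : Function.Injective
      fun m : Weight => ((m 1, m 0 + m 2 - m 1, m 2 - m 0) : ℤ × ℤ × ℤ) := by
    intro m n h
    simp only [Prod.mk.injEq] at h
    ext i
    fin_cases i <;> simp <;> omega
  rw [← hinj.tsum_eq]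
  · refine tsum_congr fun m => ?_
    rw [if_pos]
    exact ⟨m 2, by ring⟩
  · intro p hp
    rw [Function.mem_support] at hp
    obtain ⟨k, hk⟩ : Even (p.1 + p.2.1 + p.2.2) := by
      by_contra h
      exact hp (if_neg h)
    -- The coordinate sum of the image of m is 2m₂, so half the sum recovers m₂ and the other
    -- entries follow.
    refine ⟨![k - p.2.2, p.1, k], ?_⟩
    ext <;> simp
    omega

/-- The `A₃` theta function as a combination of two products of one-variable theta series. -/
theorem theta_eq (β : Weight) {τ : ℂ} (hτ : 0 < τ.im) :
    theta β τ = (thA 1 (coordX β) τ * thA 1 (coordY β) τ * thA 1 (coordZ β) τ +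
      thA (-1) (coordX β) τ * thA (-1) (coordY β) τ * thA (-1) (coordZ β) τ) / 2 := by
  have h2 : 0 < (2 * τ).im := by simpa using hτ
  let g (s : ℤˣ) (j n : ℤ) : ℂ :=
    ((s ^ n : ℤˣ) : ℂ) * Complex.exp (2 * Real.pi * Complex.I * (2 * τ) * (n + (j : ℂ) / 8) ^ 2)
  have hg (s : ℤˣ) (j : ℤ) : Summable fun n => ‖g s j n‖ := summable_norm_th s _ h2
  have hprod (s : ℤˣ) (i j k : ℤ) : HasSum (fun p : ℤ × ℤ × ℤ => g s i p.1 * (g s j p.2.1 * g s k p.2.2))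
      (thA s i τ * thA s j τ * thA s k τ) := by
    have h1 := summable_mul_of_summable_norm (hg s j) (hg s k)
    have h1' := Summable.mul_norm (hg s j) (hg s k)
    have h3 := summable_mul_of_summable_norm (hg s i) h1'
    have h4 := h3.hasSum
    rwa [← tsum_mul_tsum_of_summable_norm (hg s i) h1',
      ← tsum_mul_tsum_of_summable_norm (hg s j) (hg s k), ← mul_assoc] at h4
  have hsum := ((hprod 1 (coordX β) (coordY β) (coordZ β)).add
    (hprod (-1) (coordX β) (coordY β) (coordZ β))).div_const 2
  rw [← hsum.tsum_eq]
  let f (p : ℤ × ℤ × ℤ) : ℂ := g 1 (coordX β) p.1 * (g 1 (coordY β) p.2.1 * g 1 (coordZ β) p.2.2)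
  trans ∑' m : Weight, f (m 1, m 0 + m 2 - m 1, m 2 - m 0)
  · refine tsum_congr fun m => ?_
    simp only [f, g, _root_.one_zpow, Units.val_one, Int.cast_one, one_mul]
    rw [← Complex.exp_add, ← Complex.exp_add, thetaExp_eq]
    congr 1
    push_cast
    ring
  · rw [tsum_weight f]
    refine tsum_congr fun p => ?_
    -- The product of the three sign characters is the parity of the sum, and (1 + sign)/2 is the
    -- indicator of D₃.
    have h : ((-1 : ℤˣ) ^ p.1 : ℤˣ) * ((-1) ^ p.2.1 * (-1) ^ p.2.2)
        = (-1) ^ (p.1 + p.2.1 + p.2.2) := by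
      rw [_root_.zpow_add, _root_.zpow_add, mul_assoc]
    have h' := congrArg (fun u : ℤˣ => ((u : ℤ) : ℂ)) h
    simp only [Units.val_mul, Int.cast_mul] at h'
    simp only [f, g, _root_.one_zpow, Units.val_one, Int.cast_one, one_mul]
    generalize Complex.exp _ = u, Complex.exp _ = v, Complex.exp _ = w
    split_ifs with he
    · rw [he.neg_one_zpow] at h'
      simp only [Units.val_one, Int.cast_one] at h'
      linear_combination - (u * v * w / 2) * h'
    · rw [(Int.not_even_iff_odd.1 he).neg_one_zpow] at h'
      simp only [Units.val_neg, Units.val_one, Int.cast_neg, Int.cast_one] at h'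
      linear_combination - (u * v * w / 2) * h'

theorem simpleReflection_apply (i : Fin 3) (β : Weight) (j : Fin 3) :
    simpleReflection i β j = β j - β i * C j i := by
  simp only [simpleReflection, Module.reflection_apply, LinearMap.proj_apply, Pi.sub_apply,
    Pi.smul_apply, smul_eq_mul]
  rfl

/-- In D₃ coordinates the simple reflections are two transpositions and one transposition with sign
changes, so every symmetric expression in even functions of the coordinates is invariant. -/
theorem coord_simpleReflection_zero (β : Weight) :
    coordX (simpleReflection 0 β) = coordX β ∧ coordY (simpleReflection 0 β) = coordZ β ∧
      coordZ (simpleReflection 0 β) = coordY β := by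
  simp only [coordX, coordY, coordZ, simpleReflection_apply]
  refine ⟨?_, ?_, ?_⟩ <;> simp [C, CartanMatrix.A] <;> ring

theorem coord_simpleReflection_one (β : Weight) :
    coordX (simpleReflection 1 β) = coordY β ∧ coordY (simpleReflection 1 β) = coordX β ∧
      coordZ (simpleReflection 1 β) = coordZ β := by
  simp only [coordX, coordY, coordZ, simpleReflection_apply]
  refine ⟨?_, ?_, ?_⟩ <;> simp [C, CartanMatrix.A] <;> ring

theorem coord_simpleReflection_two (β : Weight) :
    coordX (simpleReflection 2 β) = coordX β ∧ coordY (simpleReflection 2 β) = -coordZ β ∧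
      coordZ (simpleReflection 2 β) = -coordY β := by
  simp only [coordX, coordY, coordZ, simpleReflection_apply]
  refine ⟨?_, ?_, ?_⟩ <;> simp [C, CartanMatrix.A] <;> ring

theorem coord_neg (β : Weight) :
    coordX (-β) = -coordX β ∧ coordY (-β) = -coordY β ∧ coordZ (-β) = -coordZ β := by
  simp only [coordX, coordY, coordZ, Pi.neg_apply]
  refine ⟨?_, ?_, ?_⟩ <;> ring

/-- A sum of products of even functions of the coordinates is invariant under reflections. -/
theorem even_prod_simpleReflection {R : Type*} [CommRing R] {f g : ℤ → R}
    (hf : ∀ j, f (-j) = f j) (hg : ∀ j, g (-j) = g j) (i : Fin 3) (β : Weight) :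
    f (coordX (simpleReflection i β)) * f (coordY (simpleReflection i β)) *
        f (coordZ (simpleReflection i β)) +
      g (coordX (simpleReflection i β)) * g (coordY (simpleReflection i β)) *
        g (coordZ (simpleReflection i β)) =
    f (coordX β) * f (coordY β) * f (coordZ β) + g (coordX β) * g (coordY β) * g (coordZ β) := by
  fin_cases i
  · obtain ⟨h1, h2, h3⟩ := coord_simpleReflection_zero β
    simp only [Fin.zero_eta, h1, h2, h3]
    ring
  · obtain ⟨h1, h2, h3⟩ := coord_simpleReflection_one β
    simp only [Fin.mk_one, h1, h2, h3]
    ring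
  · obtain ⟨h1, h2, h3⟩ := coord_simpleReflection_two β
    simp only [Fin.reduceFinMk, h1, h2, h3, hf, hg]
    ring

theorem weylGroup_invariant {α : Type*} {Φ : Weight → α}
    (h : ∀ i β, Φ (simpleReflection i β) = Φ β) {w : Weight ≃ₗ[ℤ] Weight} (hw : w ∈ weylGroup)
    (β : Weight) : Φ (w β) = Φ β := by
  induction hw using Subgroup.closure_induction generalizing β with
  | mem x hx =>
    obtain ⟨i, rfl⟩ := hx
    exact h i β
  | one => rfl
  | mul x y _ _ hx hy => rw [LinearEquiv.mul_apply, hx, hy]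
  | inv x _ hx => rw [← hx, ← LinearEquiv.mul_apply, mul_inv_cancel, LinearEquiv.coe_one, id]

theorem theta_simpleReflection (i : Fin 3) (β : Weight) {τ : ℂ} (hτ : 0 < τ.im) :
    theta (simpleReflection i β) τ = theta β τ := by
  rw [theta_eq _ hτ, theta_eq _ hτ]
  congr 1
  exact even_prod_simpleReflection (f := (thA 1 · τ)) (g := (thA (-1) · τ))
    (fun j => thA_neg _ j τ) (fun j => thA_neg _ j τ) i β

theorem theta_neg (β : Weight) {τ : ℂ} (hτ : 0 < τ.im) : theta (-β) τ = theta β τ := by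
  obtain ⟨h1, h2, h3⟩ := coord_neg β
  rw [theta_eq _ hτ, theta_eq _ hτ, h1, h2, h3]
  simp only [thA_neg]

theorem thetaMod_mkQ (β : Weight) (τ : ℂ) : thetaMod (fourM.mkQ β) τ = theta β τ := rfl

theorem thetaMod_eq_of_mem_orbit (β : Weight) (x : WeightMod) (hx : x ∈ orbit β) (τ : ℂ)
    (hτ : 0 < τ.im) : thetaMod x τ = theta β τ := by
  obtain ⟨w, hw, rfl | rfl⟩ := hx
  · rw [thetaMod_mkQ, weylGroup_invariant (Φ := (theta · τ))
      (fun i β => theta_simpleReflection i β hτ) hw]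
  · rw [thetaMod_mkQ, theta_neg _ hτ, weylGroup_invariant (Φ := (theta · τ))
      (fun i β => theta_simpleReflection i β hτ) hw]

/-- Thirty-two times the exponent of the leading term of a theta function, modulo `32`. -/
def wt (β : Weight) : ℤ := coordX β ^ 2 + coordY β ^ 2 + coordZ β ^ 2

theorem zeta_ne_zero (n : ℕ) : zeta n ≠ 0 := Complex.exp_ne_zero _

theorem zeta_pow_self {n : ℕ} (hn : n ≠ 0) : zeta n ^ n = 1 := by
  rw [zeta, ← Complex.exp_nat_mul, mul_div_cancel₀ _ (Nat.cast_ne_zero.2 hn),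
    Complex.exp_two_pi_mul_I]

theorem zeta_zpow (n : ℕ) (k : ℤ) :
    zeta n ^ k = Complex.exp (2 * Real.pi * Complex.I * (k / n)) := by
  rw [zeta, ← Complex.exp_int_mul]
  congr 1
  ring

theorem zeta_zpow_congr {n : ℕ} (hn : n ≠ 0) {k l : ℤ} (h : k ≡ l [ZMOD n]) :
    zeta n ^ k = zeta n ^ l := by
  obtain ⟨m, hm⟩ := h.symm.dvd
  rw [show k = l + n * m by omega, zpow_add₀ (zeta_ne_zero n), _root_.zpow_mul, zpow_natCast,
    zeta_pow_self hn, _root_.one_zpow, mul_one]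

theorem theta_add_one_right (β : Weight) (τ : ℂ) :
    theta β (τ + 1) = zeta 32 ^ wt β * theta β τ := by
  unfold theta
  rw [← tsum_mul_left]
  refine tsum_congr fun m => ?_
  -- The cross term is 16 Σ nᵢcᵢ, where the nᵢ have even sum and the doubled coordinates cᵢ of β all
  -- have the same parity; hence Σ nᵢcᵢ is even.
  obtain ⟨k, hk⟩ : ∃ k : ℤ, 32 * thetaExp β m = wt β + 32 * k := by
    refine ⟨2 * (m 1) ^ 2 + 2 * (m 0 + m 2 - m 1) ^ 2 + 2 * (m 2 - m 0) ^ 2 +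
      (m 2 * β 0 + m 1 * β 1 + m 2 * β 2 - m 0 * β 2 + m 0 * β 0 - m 2 * β 0 + m 0 * β 2), ?_⟩
    rw [thetaExp_eq, wt]
    simp only [coordX, coordY, coordZ]
    push_cast
    ring
  rw [zeta_zpow, ← Complex.exp_add, ← Complex.exp_periodic.int_mul k (_ + _)]
  congr 1
  have hk' : (32 * (thetaExp β m : ℂ)) = wt β + 32 * k := by exact_mod_cast congrArg Complex.ofReal hk
  push_cast
  linear_combination (2 * Real.pi * Complex.I / 32) * hk'

/-! ### Riemann relations -/

/-- Riemann relations between the theta constants of level `8`. -/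
structure ThetaRelations (a b A2 B0 B2 A1 A3 B1 B3 : ℂ) : Prop where
  r1 : A2 ^ 4 = 1/2 * a ^ 3 * b + 1/2 * a * b ^ 3
  r2 : A2 ^ 2 * B2 ^ 2 = 1/2 * a * b * B0 ^ 2
  r3 : B0 ^ 4 = a ^ 4 - b ^ 4
  r4 : B2 ^ 4 = 1/2 * a ^ 3 * b - 1/2 * a * b ^ 3
  r5 : A2 ^ 2 * A1 * A3 = 1/2 * a * b * A1 ^ 2 + 1/2 * a * b * A3 ^ 2
  r6 : A2 ^ 2 * B1 * B3 = 1/2 * a * b * B1 ^ 2 - 1/2 * a * b * B3 ^ 2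
  r7 : A2 * B2 * A1 * B3 = -1/2 * b * B0 * A3 * B3 + 1/2 * b * B0 * A1 * B1
  r8 : A2 * B2 * A3 * B1 = 1/2 * b * B0 * A3 * B3 + 1/2 * b * B0 * A1 * B1
  r9 : B0 ^ 2 * A1 ^ 2 = a ^ 2 * B1 ^ 2 + b ^ 2 * B3 ^ 2
  r10 : B0 ^ 2 * A3 ^ 2 = a ^ 2 * B3 ^ 2 + b ^ 2 * B1 ^ 2
  r11 : B0 ^ 2 * B1 ^ 2 = a ^ 2 * A1 ^ 2 - b ^ 2 * A3 ^ 2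
  r12 : B0 ^ 2 * B3 ^ 2 = a ^ 2 * A3 ^ 2 - b ^ 2 * A1 ^ 2
  r13 : B2 ^ 2 * A1 * A3 = 1/2 * a * b * B1 ^ 2 + 1/2 * a * b * B3 ^ 2
  r14 : B2 ^ 2 * B1 * B3 = 1/2 * a * b * A1 ^ 2 - 1/2 * a * b * A3 ^ 2
  r15 : A2 * B0 * A1 * B1 = a * B2 * A1 * B1 + b * B2 * A3 * B3
  r16 : A2 * B0 * A3 * B3 = -a * B2 * A3 * B3 + b * B2 * A1 * B1
  r17 : B0 * B2 * A1 ^ 2 = a * A2 * B1 ^ 2 - b * A2 * B3 ^ 2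
  r18 : B0 * B2 * A3 ^ 2 = -a * A2 * B3 ^ 2 + b * A2 * B1 ^ 2
  r19 : B0 * B2 * B1 ^ 2 = a * A2 * A1 ^ 2 - b * A2 * A3 ^ 2
  r20 : B0 * B2 * B3 ^ 2 = -a * A2 * A3 ^ 2 + b * A2 * A1 ^ 2
  r21 : A2 ^ 2 * B0 ^ 2 = a ^ 2 * B2 ^ 2 + b ^ 2 * B2 ^ 2
  r22 : B0 ^ 2 * B2 ^ 2 = a ^ 2 * A2 ^ 2 - b ^ 2 * A2 ^ 2
  r23 : A2 ^ 2 * B3 ^ 2 = -a ^ 2 * B1 * B3 - b ^ 2 * B1 * B3 + A2 ^ 2 * B1 ^ 2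
  r24 : A2 * B2 * A1 * B1 = 1/2 * a * B0 * A1 * B3 + 1/2 * a * B0 * A3 * B1
  r25 : A2 * B2 * A3 * B3 = 1/2 * a * B0 * A3 * B1 - 1/2 * a * B0 * A1 * B3
  r26 : B2 ^ 2 * A1 ^ 2 = -b ^ 2 * B1 * B3 + A2 ^ 2 * B1 ^ 2
  r27 : B2 ^ 2 * A3 ^ 2 = -a ^ 2 * B1 * B3 + A2 ^ 2 * B1 ^ 2
  r28 : B2 ^ 2 * B1 ^ 2 = -b ^ 2 * A1 * A3 + A2 ^ 2 * A1 ^ 2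
  r29 : B2 ^ 2 * B3 ^ 2 = a ^ 2 * A1 * A3 - A2 ^ 2 * A1 ^ 2
  r30 : A2 * B0 * A1 * B3 = a * B2 * A3 * B1 - b * B2 * A1 * B3
  r31 : A2 * B0 * A3 * B1 = a * B2 * A1 * B3 + b * B2 * A3 * B1
  r32 : B0 * B2 * A1 * A3 = a * A2 * B1 * B3 + b * A2 * B1 * B3
  r33 : B0 * B2 * B1 * B3 = a * A2 * A1 * A3 - b * A2 * A1 * A3

/-- The product formula in terms of the theta constants of level `16` at `2τ`. -/
def thF (s : ℤˣ) (l : ℤ) (τ : ℂ) : ℂ := th s (l / 16) (4 * τ)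

theorem thF_neg (s : ℤˣ) (l : ℤ) (τ : ℂ) : thF s (-l) τ = thF s l τ := by
  rw [thF, thF, ← th_neg]
  congr 1
  push_cast
  ring

theorem thF_add_sixteen (s : ℤˣ) (l : ℤ) (τ : ℂ) : thF s (l + 16) τ = s * thF s l τ := by
  rw [thF, thF, ← th_add_one]
  congr 1
  push_cast
  ring

theorem thF_sixteen_sub (s : ℤˣ) (k l : ℤ) (τ : ℂ) (h : k + l = 16) :
    thF s k τ = s * thF s l τ := by
  rw [show k = -l + 16 by omega, thF_add_sixteen, thF_neg]

theorem thA_mul (s r : ℤˣ) (j k : ℤ) {τ : ℂ} (hτ : 0 < τ.im) :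
    thA s j τ * thA r k τ = thF (s * r) (j + k) τ * thF (s * r) (j - k) τ +
      s * (thF (s * r) (j + k + 8) τ * thF (s * r) (j - k + 8) τ) := by
  have h2 : 0 < (2 * τ).im := by simpa using hτ
  have h4 : 2 * (2 * τ) = 4 * τ := by ring
  simp only [thA, thF, th_mul s r _ _ h2, h4]
  push_cast
  ring_nf

/-- The index 4 is fixed by j ↦ 8 - j, under which the series with sign character changes sign. -/
theorem thA_neg_one_four (τ : ℂ) : thA (-1) 4 τ = 0 := by
  have h := thA_add_eight (-1) (-4) τ
  rw [thA_neg, show (-4 + 8 : ℤ) = 4 by norm_num] at h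
  push_cast at h
  linear_combination h / 2

set_option linter.unusedSimpArgs false in
theorem thetaRelations {τ : ℂ} (hτ : 0 < τ.im) :
    ThetaRelations (thA 1 0 τ) (thA 1 4 τ) (thA 1 2 τ) (thA (-1) 0 τ) (thA (-1) 2 τ)
      (thA 1 1 τ) (thA 1 3 τ) (thA (-1) 1 τ) (thA (-1) 3 τ) := by
  have hA2A2 := thA_mul 1 1 2 2 hτ
  have haa := thA_mul 1 1 0 0 hτ
  have hab := thA_mul 1 1 0 4 hτ
  have hbb := thA_mul 1 1 4 4 hτ
  have hB2B2 := thA_mul (-1) (-1) 2 2 hτ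
  have hB0B0 := thA_mul (-1) (-1) 0 0 hτ
  have hA1A3 := thA_mul 1 1 1 3 hτ
  have hA1A1 := thA_mul 1 1 1 1 hτ
  have hA3A3 := thA_mul 1 1 3 3 hτ
  have hB1B3 := thA_mul (-1) (-1) 1 3 hτ
  have hB1B1 := thA_mul (-1) (-1) 1 1 hτ
  have hB3B3 := thA_mul (-1) (-1) 3 3 hτ
  have hA1B3 := thA_mul 1 (-1) 1 3 hτ
  have hA2B2 := thA_mul 1 (-1) 2 2 hτ
  have hA3B3 := thA_mul 1 (-1) 3 3 hτ
  have hbB0 := thA_mul 1 (-1) 4 0 hτ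
  have hA1B1 := thA_mul 1 (-1) 1 1 hτ
  have hA3B1 := thA_mul 1 (-1) 3 1 hτ
  have hA2B0 := thA_mul 1 (-1) 2 0 hτ
  have haB2 := thA_mul 1 (-1) 0 2 hτ
  have hbB2 := thA_mul 1 (-1) 4 2 hτ
  have hB0B2 := thA_mul (-1) (-1) 0 2 hτ
  have haA2 := thA_mul 1 1 0 2 hτ
  have hbA2 := thA_mul 1 1 4 2 hτ
  have haB0 := thA_mul 1 (-1) 0 0 hτ
  have F9 := thF_sixteen_sub 1 9 7 τ (by norm_num)
  have F10 := thF_sixteen_sub 1 10 6 τ (by norm_num)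
  have F11 := thF_sixteen_sub 1 11 5 τ (by norm_num)
  have F12 := thF_sixteen_sub 1 12 4 τ (by norm_num)
  have F13 := thF_sixteen_sub 1 13 3 τ (by norm_num)
  have F14 := thF_sixteen_sub 1 14 2 τ (by norm_num)
  have F15 := thF_sixteen_sub 1 15 1 τ (by norm_num)
  have F16 := thF_sixteen_sub 1 16 0 τ (by norm_num)
  have H8 : thF (-1) 8 τ = 0 := by
    have h := thF_sixteen_sub (-1) 8 8 τ (by norm_num)
    push_cast at h
    linear_combination h / 2
  have H9 := thF_sixteen_sub (-1) 9 7 τ (by norm_num)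
  have H10 := thF_sixteen_sub (-1) 10 6 τ (by norm_num)
  have H11 := thF_sixteen_sub (-1) 11 5 τ (by norm_num)
  have H12 := thF_sixteen_sub (-1) 12 4 τ (by norm_num)
  have H13 := thF_sixteen_sub (-1) 13 3 τ (by norm_num)
  have H14 := thF_sixteen_sub (-1) 14 2 τ (by norm_num)
  have H15 := thF_sixteen_sub (-1) 15 1 τ (by norm_num)
  have H16 := thF_sixteen_sub (-1) 16 0 τ (by norm_num)
  simp only [mul_one, one_mul, thF_neg, Int.reduceAdd, Int.reduceSub, Int.reduceNeg,
    Units.val_one, Units.val_neg, Int.cast_one, Int.cast_neg, F9, F10, F11, F12, F13, F14, F15,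
    F16, H8, H9, H10, H11, H12, H13, H14, H15, H16, zero_mul, mul_zero, neg_mul, mul_neg, neg_neg,
    add_zero]
    at hA2A2 haa hab hbb hB2B2 hB0B0 hA1A3 hA1A1 hA3A3 hB1B3
  simp only [mul_one, one_mul, thF_neg, Int.reduceAdd, Int.reduceSub, Int.reduceNeg,
    Units.val_one, Units.val_neg, Int.cast_one, Int.cast_neg, F9, F10, F11, F12, F13, F14, F15,
    F16, H8, H9, H10, H11, H12, H13, H14, H15, H16, zero_mul, mul_zero, neg_mul, mul_neg, neg_neg,
    add_zero]
    at hB1B1 hB3B3 hA1B3 hA2B2 hA3B3 hbB0 hA1B1 hA3B1 hA2B0 haB2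
  simp only [mul_one, one_mul, thF_neg, Int.reduceAdd, Int.reduceSub, Int.reduceNeg,
    Units.val_one, Units.val_neg, Int.cast_one, Int.cast_neg, F9, F10, F11, F12, F13, F14, F15,
    F16, H8, H9, H10, H11, H12, H13, H14, H15, H16, zero_mul, mul_zero, neg_mul, mul_neg, neg_neg,
    add_zero]
    at hbB2 hB0B2 haA2 hbA2 haB0
  generalize thA 1 0 τ = a at *
  generalize thA 1 4 τ = b at *
  generalize thA 1 2 τ = A2 at *
  generalize thA (-1) 0 τ = B0 at *
  generalize thA (-1) 2 τ = B2 at *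
  generalize thA 1 1 τ = A1 at *
  generalize thA 1 3 τ = A3 at *
  generalize thA (-1) 1 τ = B1 at *
  generalize thA (-1) 3 τ = B3 at *
  generalize thF 1 0 τ = F0 at *
  generalize thF 1 1 τ = F1 at *
  generalize thF 1 2 τ = F2 at *
  generalize thF 1 3 τ = F3 at *
  generalize thF 1 4 τ = F4 at *
  generalize thF 1 5 τ = F5 at *
  generalize thF 1 6 τ = F6 at *
  generalize thF 1 7 τ = F7 at *
  generalize thF 1 8 τ = F8 at *
  generalize thF (-1) 0 τ = H0 at *
  generalize thF (-1) 1 τ = H1 at *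
  generalize thF (-1) 2 τ = H2 at *
  generalize thF (-1) 3 τ = H3 at *
  generalize thF (-1) 4 τ = H4 at *
  generalize thF (-1) 5 τ = H5 at *
  generalize thF (-1) 6 τ = H6 at *
  generalize thF (-1) 7 τ = H7 at *
  clear F9 F10 F11 F12 F13 F14 F15 F16 H8 H9 H10 H11 H12 H13 H14 H15 H16
  -- Each quartic monomial is paired into two products, and `thA_mul` turns each pair into a
  -- quadratic form in the level 16 constants, F for equal characters and H for opposite ones. After
  -- this substitution the two sides agree as polynomials.
  constructor
  · linear_combination 1 * (hA2A2 * (A2 * A2) + (F0 * F4 + F4 * F8) * hA2A2) + (-1/2) * (haa *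
      (a * b) + (F0 * F0 + F8 * F8) * hab) + (-1/2) * (hab * (b * b) + (2 * F4 * F4) * hbb)
  · linear_combination 1 * (hA2A2 * (B2 * B2) + (F0 * F4 + F4 * F8) * hB2B2) + (-1/2) * (hB0B0 *
      (a * b) + (F0 * F0 - F8 * F8) * hab)
  · linear_combination 1 * (hB0B0 * (B0 * B0) + (F0 * F0 - F8 * F8) * hB0B0) + (-1) * (haa * (a
      * a) + (F0 * F0 + F8 * F8) * haa) + 1 * (hbb * (b * b) + (2 * F0 * F8) * hbb)
  · linear_combination 1 * (hB2B2 * (B2 * B2) + (F0 * F4 - F4 * F8) * hB2B2) + (-1/2) * (haa *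
      (a * b) + (F0 * F0 + F8 * F8) * hab) + 1/2 * (hab * (b * b) + (2 * F4 * F4) * hbb)
  · linear_combination 1 * (hA1A3 * (A2 * A2) + (F2 * F4 + F4 * F6) * hA2A2) + (-1/2) * (hA1A1 *
      (a * b) + (F0 * F2 + F6 * F8) * hab) + (-1/2) * (hA3A3 * (a * b) + (F0 * F6 + F2 * F8) *
      hab)
  · linear_combination 1 * (hA2A2 * (B1 * B3) + (F0 * F4 + F4 * F8) * hB1B3) + (-1/2) * (hB1B1 *
      (a * b) + (F0 * F2 - F6 * F8) * hab) + 1/2 * (hB3B3 * (a * b) + (F0 * F6 - F2 * F8) * hab)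
  · linear_combination 1 * (hA1B3 * (A2 * B2) + (H2 * H4 - H4 * H6) * hA2B2) + 1/2 * (hA3B3 * (b
      * B0) + (H0 * H6) * hbB0) + (-1/2) * (hA1B1 * (b * B0) + (H0 * H2) * hbB0)
  · linear_combination 1 * (hA2B2 * (A3 * B1) + (H0 * H4) * hA3B1) + (-1/2) * (hA3B3 * (b * B0)
      + (H0 * H6) * hbB0) + (-1/2) * (hA1B1 * (b * B0) + (H0 * H2) * hbB0)
  · linear_combination 1 * (hA1A1 * (B0 * B0) + (F0 * F2 + F6 * F8) * hB0B0) + (-1) * (hB1B1 *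
      (a * a) + (F0 * F2 - F6 * F8) * haa) + (-1) * (hB3B3 * (b * b) + (F0 * F6 - F2 * F8) * hbb)
  · linear_combination 1 * (hA3A3 * (B0 * B0) + (F0 * F6 + F2 * F8) * hB0B0) + (-1) * (hB3B3 *
      (a * a) + (F0 * F6 - F2 * F8) * haa) + (-1) * (hB1B1 * (b * b) + (F0 * F2 - F6 * F8) * hbb)
  · linear_combination 1 * (hB0B0 * (B1 * B1) + (F0 * F0 - F8 * F8) * hB1B1) + (-1) * (hA1A1 *
      (a * a) + (F0 * F2 + F6 * F8) * haa) + 1 * (hA3A3 * (b * b) + (F0 * F6 + F2 * F8) * hbb)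
  · linear_combination 1 * (hB0B0 * (B3 * B3) + (F0 * F0 - F8 * F8) * hB3B3) + (-1) * (hA3A3 *
      (a * a) + (F0 * F6 + F2 * F8) * haa) + 1 * (hA1A1 * (b * b) + (F0 * F2 + F6 * F8) * hbb)
  · linear_combination 1 * (hA1A3 * (B2 * B2) + (F2 * F4 + F4 * F6) * hB2B2) + (-1/2) * (hB1B1 *
      (a * b) + (F0 * F2 - F6 * F8) * hab) + (-1/2) * (hB3B3 * (a * b) + (F0 * F6 - F2 * F8) *
      hab)
  · linear_combination 1 * (hB1B3 * (B2 * B2) + (F2 * F4 - F4 * F6) * hB2B2) + (-1/2) * (hA1A1 *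
      (a * b) + (F0 * F2 + F6 * F8) * hab) + 1/2 * (hA3A3 * (a * b) + (F0 * F6 + F2 * F8) * hab)
  · linear_combination 1 * (hA1B1 * (A2 * B0) + (H0 * H2) * hA2B0) + (-1) * (hA1B1 * (a * B2) +
      (H0 * H2) * haB2) + (-1) * (hA3B3 * (b * B2) + (H0 * H6) * hbB2)
  · linear_combination 1 * (hA2B0 * (A3 * B3) + (H2 * H2 + H6 * H6) * hA3B3) + 1 * (hA3B3 * (a *
      B2) + (H0 * H6) * haB2) + (-1) * (hA1B1 * (b * B2) + (H0 * H2) * hbB2)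
  · linear_combination 1 * (hA1A1 * (B0 * B2) + (F0 * F2 + F6 * F8) * hB0B2) + (-1) * (hB1B1 *
      (a * A2) + (F0 * F2 - F6 * F8) * haA2) + 1 * (hB3B3 * (b * A2) + (F0 * F6 - F2 * F8) * hbA2)
  · linear_combination 1 * (hA3A3 * (B0 * B2) + (F0 * F6 + F2 * F8) * hB0B2) + 1 * (hB3B3 * (a *
      A2) + (F0 * F6 - F2 * F8) * haA2) + (-1) * (hB1B1 * (b * A2) + (F0 * F2 - F6 * F8) * hbA2)
  · linear_combination 1 * (hB0B2 * (B1 * B1) + (F2 * F2 - F6 * F6) * hB1B1) + (-1) * (hA1A1 *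
      (a * A2) + (F0 * F2 + F6 * F8) * haA2) + 1 * (hA3A3 * (b * A2) + (F0 * F6 + F2 * F8) * hbA2)
  · linear_combination 1 * (hB0B2 * (B3 * B3) + (F2 * F2 - F6 * F6) * hB3B3) + 1 * (hA3A3 * (a *
      A2) + (F0 * F6 + F2 * F8) * haA2) + (-1) * (hA1A1 * (b * A2) + (F0 * F2 + F6 * F8) * hbA2)
  · linear_combination 1 * (hA2A2 * (B0 * B0) + (F0 * F4 + F4 * F8) * hB0B0) + (-1) * (hB2B2 *
      (a * a) + (F0 * F4 - F4 * F8) * haa) + (-1) * (hB2B2 * (b * b) + (F0 * F4 - F4 * F8) * hbb)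
  · linear_combination 1 * (hB0B0 * (B2 * B2) + (F0 * F0 - F8 * F8) * hB2B2) + (-1) * (hA2A2 *
      (a * a) + (F0 * F4 + F4 * F8) * haa) + 1 * (hA2A2 * (b * b) + (F0 * F4 + F4 * F8) * hbb)
  · linear_combination 1 * (hA2A2 * (B3 * B3) + (F0 * F4 + F4 * F8) * hB3B3) + 1 * (hB1B3 * (a *
      a) + (F2 * F4 - F4 * F6) * haa) + 1 * (hB1B3 * (b * b) + (F2 * F4 - F4 * F6) * hbb) + (-1) *
      (hA2A2 * (B1 * B1) + (F0 * F4 + F4 * F8) * hB1B1)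
  · linear_combination 1 * (hA1B1 * (A2 * B2) + (H0 * H2) * hA2B2) + (-1/2) * (hA1B3 * (a * B0)
      + (H2 * H4 - H4 * H6) * haB0) + (-1/2) * (hA3B1 * (a * B0) + (H2 * H4 + H4 * H6) * haB0)
  · linear_combination 1 * (hA2B2 * (A3 * B3) + (H0 * H4) * hA3B3) + (-1/2) * (hA3B1 * (a * B0)
      + (H2 * H4 + H4 * H6) * haB0) + 1/2 * (hA1B3 * (a * B0) + (H2 * H4 - H4 * H6) * haB0)
  · linear_combination 1 * (hA1A1 * (B2 * B2) + (F0 * F2 + F6 * F8) * hB2B2) + 1 * (hB1B3 * (b *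
      b) + (F2 * F4 - F4 * F6) * hbb) + (-1) * (hA2A2 * (B1 * B1) + (F0 * F4 + F4 * F8) * hB1B1)
  · linear_combination 1 * (hA3A3 * (B2 * B2) + (F0 * F6 + F2 * F8) * hB2B2) + 1 * (hB1B3 * (a *
      a) + (F2 * F4 - F4 * F6) * haa) + (-1) * (hA2A2 * (B1 * B1) + (F0 * F4 + F4 * F8) * hB1B1)
  · linear_combination 1 * (hB1B1 * (B2 * B2) + (F0 * F2 - F6 * F8) * hB2B2) + 1 * (hA1A3 * (b *
      b) + (F2 * F4 + F4 * F6) * hbb) + (-1) * (hA1A1 * (A2 * A2) + (F0 * F2 + F6 * F8) * hA2A2)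
  · linear_combination 1 * (hB2B2 * (B3 * B3) + (F0 * F4 - F4 * F8) * hB3B3) + (-1) * (hA1A3 *
      (a * a) + (F2 * F4 + F4 * F6) * haa) + 1 * (hA1A1 * (A2 * A2) + (F0 * F2 + F6 * F8) * hA2A2)
  · linear_combination 1 * (hA1B3 * (A2 * B0) + (H2 * H4 - H4 * H6) * hA2B0) + (-1) * (hA3B1 *
      (a * B2) + (H2 * H4 + H4 * H6) * haB2) + 1 * (hA1B3 * (b * B2) + (H2 * H4 - H4 * H6) * hbB2)
  · linear_combination 1 * (hA2B0 * (A3 * B1) + (H2 * H2 + H6 * H6) * hA3B1) + (-1) * (hA1B3 *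
      (a * B2) + (H2 * H4 - H4 * H6) * haB2) + (-1) * (hA3B1 * (b * B2) + (H2 * H4 + H4 * H6) *
      hbB2)
  · linear_combination 1 * (hA1A3 * (B0 * B2) + (F2 * F4 + F4 * F6) * hB0B2) + (-1) * (hB1B3 *
      (a * A2) + (F2 * F4 - F4 * F6) * haA2) + (-1) * (hB1B3 * (b * A2) + (F2 * F4 - F4 * F6) *
      hbA2)
  · linear_combination 1 * (hB0B2 * (B1 * B3) + (F2 * F2 - F6 * F6) * hB1B3) + (-1) * (hA1A3 *
      (a * A2) + (F2 * F4 + F4 * F6) * haA2) + 1 * (hA1A3 * (b * A2) + (F2 * F4 + F4 * F6) * hbA2)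

/-! ### Closed forms of the cubic polynomials -/

/-- The values of the `A₃` theta functions at the chosen weight vectors. -/
structure ThetaTable (t : ℕ → ℕ → ℂ) (a b A2 B0 B2 A1 A3 B1 B3 : ℂ) : Prop where
  x01 : t 0 1 = (a ^ 3 + B0 ^ 3) / 2
  x11 : t 1 1 = (A1 ^ 3 + B1 ^ 3) / 2
  x12 : t 1 2 = (A2 ^ 3 + B2 ^ 3) / 2
  x13 : t 1 3 = (A3 ^ 3 + B3 ^ 3) / 2
  x14 : t 1 4 = (b ^ 3) / 2
  x15 : t 1 5 = (A3 ^ 3 - B3 ^ 3) / 2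
  x16 : t 1 6 = (A2 ^ 3 - B2 ^ 3) / 2
  x17 : t 1 7 = (A1 ^ 3 - B1 ^ 3) / 2
  x18 : t 1 8 = (a ^ 3 - B0 ^ 3) / 2
  x21 : t 2 1 = (a ^ 2 * A2 + B0 ^ 2 * B2) / 2
  x22 : t 2 2 = (a ^ 2 * b) / 2
  x23 : t 2 3 = (a ^ 2 * A2 - B0 ^ 2 * B2) / 2
  x31 : t 3 1 = (A1 ^ 2 * A3 + B1 ^ 2 * B3) / 2
  x33 : t 3 3 = (A1 * A3 ^ 2 - B1 * B3 ^ 2) / 2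
  x35 : t 3 5 = (A1 * A3 ^ 2 + B1 * B3 ^ 2) / 2
  x37 : t 3 7 = (A1 ^ 2 * A3 - B1 ^ 2 * B3) / 2
  x41 : t 4 1 = (a * A2 ^ 2 + B0 * B2 ^ 2) / 2
  x42 : t 4 2 = (a * b ^ 2) / 2
  x51 : t 5 1 = (a * b * A2) / 2
  x61 : t 6 1 = (b * A2 ^ 2) / 2
  x71 : t 7 1 = (b ^ 2 * A2) / 2
  x81 : t 8 1 = (a * A2 ^ 2 - B0 * B2 ^ 2) / 2

theorem thA_congr (s : ℤˣ) (j k n : ℤ) (h : j = k + 8 * n) (τ : ℂ) :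
    thA s j τ = ((s ^ n : ℤˣ) : ℂ) * thA s k τ := by
  induction n generalizing j with
  | zero => simp [h]
  | succ i ih =>
    have h1 : ((s ^ ((i : ℤ) + 1) : ℤˣ) : ℂ) = s * ((s ^ (i : ℤ) : ℤˣ) : ℂ) := by
      rw [_root_.zpow_add, zpow_one, mul_comm]
      push_cast
      rfl
    rw [show j = (k + 8 * i) + 8 by rw [h]; ring, thA_add_eight, ih _ rfl, h1, mul_assoc]
  | pred i ih =>
    have h1 : ((s ^ (-(i : ℤ) - 1) : ℤˣ) : ℂ) = s * ((s ^ (-(i : ℤ)) : ℤˣ) : ℂ) := by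
      rw [_root_.zpow_sub, zpow_one, units_inv_eq, mul_comm]
      push_cast
      rfl
    have h2 := thA_add_eight s j τ
    rw [ih _ (by rw [h]; ring : j + 8 = k + 8 * -(i : ℤ))] at h2
    rw [h1, mul_assoc, h2, ← mul_assoc, units_cast_sq, one_mul]

/-- Evenness and (anti)periodicity under j ↦ j + 8 bring every coordinate to an index between 0 and
4. -/
theorem thetaTable {τ : ℂ} (hτ : 0 < τ.im) :
    ThetaTable (fun j k => theta (lam j k) τ) (thA 1 0 τ) (thA 1 4 τ) (thA 1 2 τ) (thA (-1) 0 τ)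
      (thA (-1) 2 τ) (thA 1 1 τ) (thA 1 3 τ) (thA (-1) 1 τ) (thA (-1) 3 τ) := by
  have A5 := thA_congr 1 5 (-3) 1 (by norm_num) τ
  have A6 := thA_congr 1 6 (-2) 1 (by norm_num) τ
  have A7 := thA_congr 1 7 (-1) 1 (by norm_num) τ
  have A8 := thA_congr 1 8 (0) 1 (by norm_num) τ
  have A9 := thA_congr 1 9 (1) 1 (by norm_num) τ
  have A10 := thA_congr 1 10 (2) 1 (by norm_num) τ
  have A15 := thA_congr 1 15 (-1) 2 (by norm_num) τ
  have A21 := thA_congr 1 21 (-3) 3 (by norm_num) τ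
  have B5 := thA_congr (-1) 5 (-3) 1 (by norm_num) τ
  have B6 := thA_congr (-1) 6 (-2) 1 (by norm_num) τ
  have B7 := thA_congr (-1) 7 (-1) 1 (by norm_num) τ
  have B8 := thA_congr (-1) 8 (0) 1 (by norm_num) τ
  have B9 := thA_congr (-1) 9 (1) 1 (by norm_num) τ
  have B10 := thA_congr (-1) 10 (2) 1 (by norm_num) τ
  have B15 := thA_congr (-1) 15 (-1) 2 (by norm_num) τ
  have B21 := thA_congr (-1) 21 (-3) 3 (by norm_num) τ
  constructor <;>
  · rw [theta_eq _ hτ]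
    simp [lam, coordX, coordY, coordZ, thA_neg, thA_neg_one_four, zpow_ofNat, A5, A6, A7, A8, A9,
      A10, A15, A21, B5, B6, B7, B8, B9, B10, B15, B21]
    try ring

/-- This is an identity in a, b, B0 alone; no Riemann relation enters. -/
theorem poly_10_eq {t : ℕ → ℕ → ℂ} {a b A2 B0 B2 A1 A3 B1 B3 : ℂ}
    (ht : ThetaTable t a b A2 B0 B2 A1 A3 B1 B3) :
    poly10 t = ((a ^ 2 - b ^ 2) * B0) ^ 3 := by
  simp only [poly10, ht.x01, ht.x14, ht.x18, ht.x22, ht.x42]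
  ring

/-- The single relation A2²B0² = (a² + b²)B2² suffices, here and for `poly21`. -/
theorem poly_20_eq {t : ℕ → ℕ → ℂ} {a b A2 B0 B2 A1 A3 B1 B3 : ℂ}
    (h : ThetaRelations a b A2 B0 B2 A1 A3 B1 B3) (ht : ThetaTable t a b A2 B0 B2 A1 A3 B1 B3) :
    poly20 t = ((a ^ 2 - b ^ 2) * A2) ^ 3 := by
  simp only [poly20, ht.x01, ht.x12, ht.x16, ht.x18, ht.x21, ht.x23, ht.x41, ht.x42, ht.x71,
    ht.x81]
  linear_combination
    (-1/8 * a * B0 ^ 3 * B2 - 11/8 * A2 * B0 ^ 4 + 1/8 * a ^ 3 * A2 * B0 + 9/2 * a * b ^ 2 * A2 *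
      B0 - 13/8 * a ^ 4 * B2 + 3/2 * a ^ 2 * b ^ 2 * B2) * h.r21

theorem poly_21_eq {t : ℕ → ℕ → ℂ} {a b A2 B0 B2 A1 A3 B1 B3 : ℂ}
    (h : ThetaRelations a b A2 B0 B2 A1 A3 B1 B3) (ht : ThetaTable t a b A2 B0 B2 A1 A3 B1 B3) :
    poly21 t = ((a ^ 2 - b ^ 2) * B2) ^ 3 := by
  simp only [poly21, ht.x01, ht.x12, ht.x18, ht.x21, ht.x23, ht.x41, ht.x42, ht.x71, ht.x81]
  linear_combination
    (8 * A2 * B0 ^ 4 - b ^ 4 * B2 + a * b ^ 2 * A2 * B0 + 4 * a ^ 2 * b ^ 2 * B2 - 4 * a ^ 3 * A2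
      * B0 - 7 * a ^ 4 * B2) * h.r21

/-- The full sum of the four polynomials is ((a + b) A2 (A1 + A3))³. Under τ ↦ τ + 2 the parts of
(A1 + A3)³ even and odd in A3 have opposite eigenvalues, up to a common factor; the even part
belongs to `poly40 + poly42`, the odd one to `poly41 + poly43`. The coefficients below certify that
the difference lies in the ideal of the Riemann relations. -/
theorem poly_40_42_eq {t : ℕ → ℕ → ℂ} {a b A2 B0 B2 A1 A3 B1 B3 : ℂ}
    (h : ThetaRelations a b A2 B0 B2 A1 A3 B1 B3) (ht : ThetaTable t a b A2 B0 B2 A1 A3 B1 B3) :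
    poly40 t + poly42 t = (a + b) ^ 3 * A2 ^ 3 * (A1 ^ 3 + 3 * A1 * A3 ^ 2) := by
  simp only [poly40, poly42, ht.x01, ht.x11, ht.x12, ht.x13, ht.x14, ht.x15, ht.x16, ht.x17,
    ht.x18, ht.x21, ht.x22, ht.x23, ht.x31, ht.x33, ht.x35, ht.x37, ht.x41, ht.x42, ht.x51,
    ht.x61, ht.x71, ht.x81]
  linear_combination
    (-1/2 * a * B2 * A1 ^ 2 * B3 - 21/8 * b * A2 * A3 ^ 3 - 1/8 * B0 * B2 * A3 * B3 ^ 2 - 55/8 * b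
      * A2 * B1 ^ 2 * B3 - 47/8 * a * A2 * B1 ^ 2 * B3 - 3 * b * A2 * B3 ^ 3 - b * B2 * A1 * B1 *
      B3 + 27/8 * A2 * B0 * A3 * B1 ^ 2) * h.r1 + (-1/8 * a * B2 * B3 ^ 3 - 99/2 * b * B2 * B1 ^ 2
      * B3 - 23/4 * A2 * B0 * B1 ^ 2 * B3 + 1/4 * b * A2 * A1 * B1 * B3 + 305/8 * a * B2 * B1 ^ 2
      * B3 - 1/8 * B0 * B2 * A1 * B1 * B3 - 1/8 * B0 * B2 * A3 * B3 ^ 2 - 3/8 * b * B2 * A3 ^ 3 -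
      1/8 * A2 * B0 * A3 ^ 3 + 1/8 * a * B2 * A3 ^ 3 + 27/4 * b * B2 * A1 ^ 2 * A3 + 13 * B0 * B2
      * B1 ^ 2 * B3 - 151/8 * A2 * B0 * A1 ^ 2 * A3 - 5/8 * b * A2 * A3 ^ 2 * B3) * h.r2 + (1/4 *
      a * B2 * A1 * A3 * B1 + 1/4 * B0 * B2 * B1 ^ 2 * B3 - 3/4 * A2 * B0 * A1 * B1 * B3 - 43/16 *
      b * B2 * A3 * B3 ^ 2 - 1/2 * b * B2 * A1 * B1 * B3 + 1/2 * a * B2 * A3 * B1 ^ 2) * h.r3 +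
      (A2 * B0 * A1 ^ 2 * B3 + 7/8 * a * A2 * A3 * B3 ^ 2 + 7/8 * a * A2 * A3 * B1 ^ 2 - 1/8 * a *
      B2 * A3 * B1 ^ 2 + 69/8 * A2 * B0 * A3 * B3 ^ 2 - 1/4 * A2 * B0 * A3 * B1 ^ 2) * h.r4 +
      (-1/2 * a ^ 2 * A2 * B0 * B3 - 59/4 * a * b * A2 * B0 * B3 + a * A2 * B2 ^ 2 * A1 - 1/4 * a
      * A2 ^ 3 * A1 + 55/8 * b * A2 ^ 3 * A1 + 3/8 * b * B0 ^ 2 * B2 * A3 + 43/8 * A2 * B0 ^ 3 *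
      A3) * h.r5 + (99/2 * b * B0 ^ 2 * B2 * B3 - 23/8 * a ^ 2 * B0 * B2 * A3 + 1/8 * b * A2 * B2
      ^ 2 * A1 + 415/16 * a ^ 2 * b * A2 * B3 + 27/2 * a ^ 3 * A2 * B3 - 43/8 * a ^ 3 * B2 * A3 +
      69/8 * a ^ 2 * A2 * B0 * A3 + 39/8 * a * b ^ 2 * B2 * A3 - 11/2 * b ^ 3 * A2 * B3 + 49/16 *
      a * b * A2 * B0 * A3) * h.r6 + (-1/4 * b * B0 ^ 2 * B2 * B3 + 43/8 * B0 ^ 3 * B2 * A3 - 3/8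
      * b * A2 ^ 2 * B2 * B1 - 1/4 * A2 * B0 * B2 ^ 2 * A1 - 13 * a ^ 2 * A2 * B0 * A3 - 105/16 *
      a * b ^ 2 * A2 * B3 - 179/8 * a * A2 ^ 3 * B1) * h.r7 + (-165/8 * a * b ^ 2 * A2 * A3 - 45/8
      * b * A2 ^ 2 * B2 * B1 - 45/8 * B0 ^ 3 * B2 * A3 + 1/4 * b * B0 ^ 2 * B2 * B3 - 3/4 * a * B2
      ^ 3 * B1 + 1/4 * a * B2 ^ 3 * A1 + 13 * a * b * A2 * B0 * A3 - 225/16 * a ^ 2 * b * A2 * B3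
      + 105/16 * a * b ^ 2 * A2 * B3) * h.r8 + (-1/4 * B0 ^ 3 * B2 * A3 - 1/4 * a * A2 ^ 3 * B1 +
      11/4 * a ^ 2 * b * B2 * A3 - 43/16 * b ^ 3 * B2 * A3 - 25/8 * b * A2 ^ 2 * B2 * A1 + 1/8 * a
      ^ 3 * A2 * B3 + 21/16 * a * b ^ 2 * B2 * A3) * h.r9 + (-1/2 * b * B2 ^ 3 * B1 + 49/8 * A2 *
      B0 * B2 ^ 2 * B1 - 11/2 * b * B0 ^ 2 * B2 * B3 - 1/16 * a * A2 * B2 ^ 2 * A1 + 3/8 * B0 * B2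
      ^ 3 * A1 - 7/8 * a * A2 ^ 2 * B2 * A1 - 47/8 * a * A2 ^ 3 * B1 + 99/16 * a * b ^ 2 * A2 * B3
      + 13/2 * a ^ 2 * b * A2 * B3 - 43/8 * A2 ^ 3 * B0 * A1) * h.r10 + (1/4 * a * A2 ^ 2 * B2 *
      B1 + 1/4 * a * A2 ^ 3 * A1 - 41/4 * a * b * A2 * B0 * B3 - 1/4 * A2 ^ 2 * B0 * B2 * A1 + 1/4
      * a * A2 * B2 ^ 2 * B1 + 1/4 * A2 * B0 * B2 ^ 2 * A1 + 33/8 * b * B2 ^ 3 * A1) * h.r11 +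
      (-99/4 * a * b ^ 2 * B2 * B3 + 45/8 * a * A2 ^ 2 * B2 * B1 + 1/8 * a * A2 * B2 ^ 2 * A1 -
      1/4 * A2 ^ 2 * B0 * B2 * A1 - 3/8 * b * A2 * B2 ^ 2 * A1 + 5/16 * b * B0 ^ 2 * B2 * A3 + 1/2
      * a * B2 ^ 3 * A1 + 1/4 * B0 * B2 ^ 3 * B1) * h.r12 + (2 * a * B2 ^ 3 * B1 + 83/8 * a * B0 ^
      2 * B2 * B3 - 1/4 * B0 * B2 ^ 3 * A1 - 7/8 * a ^ 3 * A2 * A3 + 7/8 * a * b ^ 2 * A2 * A3 -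
      21/8 * b ^ 3 * B2 * A3 - 5/8 * a * b ^ 2 * B2 * A3 + 39/8 * a * b * A2 * B0 * A3 - 357/16 *
      a ^ 2 * b * A2 * B3 + 179/8 * A2 ^ 3 * B0 * A1) * h.r13 + (-163/4 * a * A2 ^ 2 * B2 * B1 -
      1/8 * b ^ 2 * A2 * B0 * B3 + 35/16 * a ^ 2 * b * A2 * A3 + 59/4 * a * b * A2 * B0 * B3 +
      163/4 * b * A2 ^ 2 * B2 * B1 + 1/8 * a * A2 * B0 ^ 2 * A3 - 13 * A2 ^ 2 * B0 * B2 * B1 - 3/2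
      * A2 * B0 * B2 ^ 2 * A1) * h.r14 + (59/4 * a * b * A2 ^ 2 * A1 + 1/16 * a * b ^ 2 * B0 * B3
      - 1/8 * b * B0 * B2 ^ 2 * A1 + 1/4 * a * A2 ^ 2 * B0 * A1) * h.r15 + (-99/4 * a ^ 2 * b ^ 2
      * A3 - 283/8 * a * b * A2 ^ 2 * A1 + 405/8 * b ^ 2 * A2 ^ 2 * A1 + 1/8 * A2 * B2 ^ 3 * B3 -
      3/8 * b * B0 * B2 ^ 2 * B1 + B0 ^ 2 * B2 ^ 2 * B1 + 69/8 * a * b * A2 ^ 2 * B1) * h.r16 +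
      (-3 * A2 * B2 ^ 3 * B3 - 13/2 * a * b * A2 ^ 2 * B1 - 355/16 * a ^ 3 * b * B3 - 25/8 * b ^ 2
      * A2 * B2 * A1 - 49/8 * a ^ 2 * b * B0 * A3 + 37/8 * a * A2 ^ 2 * B0 * A1 + 9/4 * a * b ^ 2
      * B0 * A3 + 1/8 * a ^ 4 * B3) * h.r17 + (-87/8 * A2 * B0 ^ 2 * B2 * B1 + 23/8 * b * A2 * B0
      * B2 * A1 - 1/8 * A2 ^ 4 * B3 - 1/2 * b ^ 2 * A2 * B2 * A1 - 1/16 * a ^ 2 * A2 ^ 2 * B1 -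
      33/8 * a * b * A2 * B2 * A1) * h.r18 + (-1/4 * a ^ 3 * B0 * B3 - 1/4 * a ^ 2 * A2 * B2 * B1
      - 1/4 * a ^ 4 * A3 + 10 * a ^ 2 * b * B0 * B3 - 1/16 * a * b ^ 3 * A3 - 169/32 * a ^ 3 * b *
      A3 - 1/2 * a * b * B2 ^ 2 * A1 + 45/8 * A2 ^ 4 * A3 + 1/4 * a * B0 ^ 3 * A3 - 1/4 * a * A2 *
      B0 * B2 * B1 + 35/8 * A2 * B0 ^ 2 * B2 * A1) * h.r19 + (-5 * a * b * A2 ^ 2 * A1 - 45/16 * a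
      ^ 2 * A2 ^ 2 * A1 + 45/8 * a ^ 2 * A2 * B2 * B1 + 165/8 * a * b * A2 * B2 * B1 + 11/8 * a ^
      3 * b * A3 - 1/16 * a * b * B0 ^ 2 * A3 + 1/8 * a * b * B2 ^ 2 * A1 - 3/8 * b ^ 2 * B2 ^ 2 *
      A1 + 1/8 * A2 ^ 4 * A3 + 19/8 * b * B0 ^ 3 * A3) * h.r20 + (-1/2 * b * B2 * B1 * B3 ^ 2 -
      3/8 * B0 * B2 * A1 * B3 ^ 2 - 1/2 * a * B2 * A1 * A3 ^ 2) * h.r21 + (1/4 * B0 * B2 * A1 ^ 3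
      + 1/4 * B0 * B2 * A1 * A3 ^ 2 - 23/8 * b * A2 * A1 * A3 ^ 2 - 43/8 * A2 * B0 * A1 * A3 * B3
      - 3/16 * a * A2 * A1 * A3 ^ 2 - 1/4 * B0 * B2 * B1 ^ 3 - 37/8 * A2 * B0 * A1 * B1 ^ 2) *
      h.r22 + (1/8 * A2 * B0 * B2 ^ 2 * B3) * h.r23 + (-45/8 * a * A2 ^ 2 * B2 * B3 - 123/16 * a ^
      2 * b * B2 * B1 - 1/8 * b ^ 2 * A2 * B0 * B1 + 405/8 * b ^ 3 * A2 * A1 - 1/4 * a * B2 ^ 3 *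
      A3 - 357/16 * a ^ 2 * b * B2 * A1 + 1/4 * a ^ 3 * B2 * A1 + 3/2 * B0 * B2 ^ 3 * B3 + b * A2
      ^ 3 * B3 + 19 * a * A2 ^ 3 * B3) * h.r24 + (1/2 * a * B0 ^ 2 * B2 * B1 + 1/8 * A2 ^ 3 * B0 *
      A3 + 5/8 * b * A2 ^ 2 * B2 * A3 + 1/2 * B0 * B2 ^ 3 * B3 + 357/16 * a ^ 2 * b * B2 * A1 -
      183/16 * a * b ^ 2 * A2 * B1 + 1/2 * a ^ 2 * b * A2 * B1) * h.r25 + (-2 * b * B2 ^ 3 * B3 +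
      1/8 * B0 * B2 ^ 3 * A3 - 1/2 * a * b ^ 2 * B2 * A1 + 357/16 * a ^ 2 * b * A2 * B1 + 1/2 * b
      ^ 3 * B2 * A1 + 3/4 * b ^ 2 * A2 * B0 * A1 + 25/8 * a ^ 2 * b * B2 * A1 - 1/4 * b ^ 2 * B0 *
      B2 * B1) * h.r26 + (-1/8 * B0 * B2 ^ 3 * A3 + 87/8 * b * B0 ^ 2 * B2 * B1 + 1/4 * a * A2 *
      B0 ^ 2 * A1 - 1/4 * B0 ^ 3 * B2 * A1 + 1/4 * a ^ 2 * B0 * B2 * B1 - 1/4 * a * b ^ 2 * A2 *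
      B1 + 27/8 * b * A2 ^ 2 * B2 * A3) * h.r27 + (59/4 * a * b * A2 * B0 * B1 - 1/2 * a * A2 ^ 2
      * B2 * B3 + 123/16 * a ^ 2 * b * A2 * A1 - 1/8 * B0 * B2 ^ 3 * B3 + 1/8 * a * B2 ^ 3 * A3 -
      25/8 * b * B0 ^ 2 * B2 * A1 + 1/4 * A2 * B0 * B2 ^ 2 * A3) * h.r28 + (-a * A2 * B2 ^ 2 * A3
      - 35/16 * a * b ^ 2 * A2 * A1 + 1/8 * B0 * B2 ^ 3 * B3 - 73/8 * A2 * B0 * B2 ^ 2 * A3) *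
      h.r29 + (2 * B2 ^ 4 * A1 - 1/8 * a * B0 * B2 ^ 2 * B3 - 1/4 * a ^ 4 * A1 + 99/4 * a * b ^ 3
      * A1 + 17/8 * a * b * A2 * B2 * B3 - 1/4 * a ^ 3 * B0 * B1 + 5/8 * A2 * B0 ^ 2 * B2 * B3 +
      1/8 * A2 * B2 ^ 3 * B1 + 1/8 * a * B0 * B2 ^ 2 * A3 - 1/16 * a * A2 ^ 2 * B0 * A3 + 3/4 * B0
      ^ 4 * B1 + 33/8 * a ^ 2 * A2 ^ 2 * B3 + 113/16 * a * b * A2 ^ 2 * B3 - 1/8 * a ^ 3 * B0 * A1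
      - 21/16 * a ^ 2 * b ^ 2 * B1 - 1/2 * a ^ 4 * B1) * h.r30 + (83/8 * B0 ^ 2 * B2 ^ 2 * A3 +
      1/8 * b * B0 * B2 ^ 2 * B3 + 1/4 * a * b ^ 3 * A1 - 1/16 * a * b ^ 2 * B0 * B1 - 45/8 * A2 ^
      3 * B2 * B1 + 1/16 * a ^ 2 * A2 * B2 * B3 + 95/16 * a * A2 ^ 2 * B0 * A3 + 1/2 * a ^ 2 * b ^
      2 * B1 + 29/16 * a * b ^ 3 * B1 + 7/8 * a ^ 2 * A2 ^ 2 * B3 - 27/8 * A2 ^ 4 * B1) * h.r31 +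
      (-1/4 * a * B0 ^ 3 * B1 - 1/8 * b * B0 ^ 3 * B1 + 303/16 * a ^ 2 * A2 ^ 2 * B3 + 1/4 * a ^ 3
      * B0 * A1 - 19/2 * a ^ 2 * A2 * B2 * A3) * h.r32 + (39/8 * a * A2 ^ 2 * B0 * B3 - 181/4 * b
      * A2 ^ 2 * B0 * B3 - 283/8 * a * b * A2 * B2 * B3 - 21/8 * b ^ 2 * A2 ^ 2 * A3 - 115/32 * a
      ^ 3 * b * A1 - 1/16 * a * b * B0 ^ 2 * A1 + 1/8 * B0 ^ 2 * B2 ^ 2 * B3 + 13/2 * a * b * B0 ^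
      2 * B1 - 1/4 * b * B0 ^ 3 * A1 - A2 * B0 ^ 2 * B2 * A3) * h.r33

theorem poly_41_43_eq {t : ℕ → ℕ → ℂ} {a b A2 B0 B2 A1 A3 B1 B3 : ℂ}
    (h : ThetaRelations a b A2 B0 B2 A1 A3 B1 B3) (ht : ThetaTable t a b A2 B0 B2 A1 A3 B1 B3) :
    poly41 t + poly43 t = (a + b) ^ 3 * A2 ^ 3 * (3 * A1 ^ 2 * A3 + A3 ^ 3) := by
  simp only [poly41, poly43, ht.x01, ht.x11, ht.x12, ht.x13, ht.x14, ht.x15, ht.x16, ht.x17,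
    ht.x18, ht.x21, ht.x22, ht.x23, ht.x31, ht.x33, ht.x35, ht.x37, ht.x41, ht.x42, ht.x51,
    ht.x61, ht.x71, ht.x81]
  linear_combination
    (-16 * b * B2 * A1 ^ 2 * B1 + 291/8 * B0 * B2 * A3 * B1 * B3 - 31/4 * b * A2 * B1 * B3 ^ 2 -
      107/8 * b * A2 * B1 ^ 3) * h.r1 + (509/8 * b * B2 * B1 * B3 ^ 2 + 161/8 * A2 * B0 * B1 * B3
      ^ 2 + 329/8 * a * B2 * B1 * B3 ^ 2 + 73/8 * A2 * B0 * B1 ^ 3 - 201/4 * a * B2 * B1 ^ 3 +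
      91/4 * b * B2 * B1 ^ 3 - 149/2 * b * A2 * A3 * B1 * B3 + 61/2 * B0 * B2 * A1 ^ 3 + 35/8 * b
      * A2 * A1 * B1 ^ 2 + 161/8 * B0 * B2 * A3 * B1 * B3 + 111/8 * b * A2 * A1 * B3 ^ 2 - 111/8 *
      a * A2 * A1 * B1 ^ 2 - 85 * a * A2 * A1 * A3 * B3 + 73/8 * a * A2 * A3 ^ 2 * B1 + 133/8 * A2
      * B0 * A1 ^ 3 + 1625/8 * a * B2 * A1 * A3 ^ 2 + 161/8 * a * B2 * A1 ^ 3 - 67/4 * b * B2 * A1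
      ^ 3 + 309/8 * A2 * B0 * A1 * A3 ^ 2 - 7/8 * b * A2 * A1 ^ 2 * B1 + 45/4 * B0 * B2 * A1 ^ 2 *
      B1 + 45/4 * B0 * B2 * A1 * A3 * B3) * h.r2 + (47/2 * b * B2 * A1 * A3 * B3 + 31/2 * a * B2 *
      A1 ^ 2 * B1 + 69/8 * b * A2 * A1 * B1 ^ 2 + 69/8 * B0 * B2 * B1 * B3 ^ 2) * h.r3 + (-99/8 *
      A2 * B0 * A1 * A3 * B3 + 161/8 * B0 * B2 * A1 ^ 3 - 315/8 * b * A2 * A1 ^ 3 + 161/8 * B0 *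
      B2 * A1 * A3 ^ 2 - 389/4 * a * A2 * A1 * A3 ^ 2 - 31/4 * A2 * B0 * A1 * B1 ^ 2 + 69/8 * b *
      A2 * B1 * B3 ^ 2 + 69/8 * B0 * B2 * A1 ^ 2 * B1) * h.r4 + (-109/8 * a * b * A2 * B0 * B1 +
      243/4 * b * A2 ^ 3 * A3 - 65/4 * a * A2 ^ 3 * A3 + 16 * a ^ 2 * b * B2 * B1 - 185/8 * a ^ 3
      * A2 * A1 - 161/8 * a ^ 2 * B0 * B2 * A1 + 69/4 * a * b * B0 * B2 * A1 - 69/8 * b * A2 * B0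
      ^ 2 * A1 - 471/8 * A2 * B0 ^ 3 * A1 - 433/2 * a * B2 ^ 3 * A3 - 535/8 * a * B0 ^ 2 * B2 * A1
      - 177/4 * A2 * B0 * B2 ^ 2 * A3) * h.r5 + (701/8 * a * b * B0 * B2 * A1 + 245/4 * a * B0 ^ 2
      * B2 * B1 + 19/4 * b * A2 * B0 ^ 2 * A1 - 161/8 * B0 * B2 ^ 3 * A3 - 45/8 * a * A2 ^ 3 * B3
      - 41/8 * a ^ 3 * A2 * B1 + 199/4 * a ^ 2 * b * A2 * B1 + 153/4 * a * b ^ 2 * A2 * B1 - 155/4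
      * a * b ^ 2 * B2 * A1) * h.r6 + (25/8 * a * b ^ 2 * A2 * A1 - 61/4 * b ^ 2 * A2 * B0 * A1 -
      45/4 * A2 * B0 * B2 ^ 2 * A3 - 45/4 * a * B2 ^ 3 * A3) * h.r7 + (149/2 * a * b ^ 2 * B2 * B1
      + 6 * b ^ 3 * A2 * A1 + 147/8 * a ^ 3 * A2 * A1 + 7/8 * a * b * A2 * B0 * A1 - 61/4 * b ^ 2
      * A2 * B0 * A1 + 143/4 * B0 ^ 3 * B2 * B1 - 45/4 * a * B0 ^ 2 * B2 * A1 + 155/4 * a ^ 3 * A2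
      * B1) * h.r8 + (87/4 * a * B2 ^ 3 * B3 - 31/2 * a * B0 ^ 2 * B2 * B1 + 61/4 * a * b * B0 *
      B2 * A1 - 61/4 * b * A2 ^ 3 * B3 - 31/2 * a * b * A2 * B0 * A1 + 31/2 * a ^ 2 * A2 * B0 * A1
      - 61/4 * b ^ 3 * A2 * B1 - 63/2 * b * A2 ^ 2 * B2 * A3 + 63/2 * a * A2 ^ 2 * B2 * A3 +
      363/16 * a * b ^ 2 * B2 * A1) * h.r9 + (1/4 * A2 * B0 * B2 ^ 2 * B3 - 69/8 * a ^ 3 * A2 * A1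
      + 69/8 * b ^ 3 * A2 * A1 - 69/8 * B0 * B2 ^ 3 * B3 - 69/8 * a ^ 2 * B0 * B2 * B1 + 363/16 *
      a * b ^ 2 * B2 * A1) * h.r10 + (-65/8 * b * A2 ^ 2 * B2 * B3 + 133/16 * a * b * A2 * B0 * B1
      - 31/2 * a ^ 2 * A2 * B0 * B1 + 133/16 * a ^ 2 * b * A2 * A1 + 61/4 * b * A2 ^ 3 * A3 +
      239/8 * a * B2 ^ 3 * A3 + 797/8 * b * B2 ^ 3 * A3 + 143/8 * b * B0 ^ 2 * B2 * A1) * h.r11 +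
      (-55/16 * a * b * A2 * B0 * B1 - 161/16 * a * b * B0 * B2 * A1 + 389/8 * b * A2 ^ 3 * A3 -
      69/8 * a * A2 * B0 ^ 2 * A1 + 69/4 * B0 * B2 ^ 3 * B3 + 63/2 * b * B2 ^ 3 * A3 - 63/8 * a *
      B0 ^ 2 * B2 * A1 - 753/16 * a * b * B0 * B2 * B1 - 69/8 * a * B2 ^ 3 * A3) * h.r12 + (-73/8
      * b * A2 * B0 ^ 2 * A1 + 389/4 * a * A2 * B2 ^ 2 * A3 + 611/8 * a * A2 ^ 3 * B3 + 69/8 * b ^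
      3 * A2 * B1 - 363/8 * a ^ 2 * b * B2 * A1 - 363/8 * b ^ 3 * B2 * A1 + 69/4 * a * b * B0 * B2
      * B1) * h.r13 + (-203/4 * a ^ 2 * A2 * B0 * B1 - 21 * a * A2 ^ 2 * B2 * B3 + 149/2 * b * A2
      ^ 3 * A3 - 353/8 * b ^ 3 * A2 * A1 - 219/8 * b ^ 2 * A2 * B0 * B1 - 115/4 * b * A2 * B0 ^ 2
      * A1 - 611/8 * b * B0 ^ 2 * B2 * A1) * h.r14 + (-665/8 * a * b * A2 * B2 * B3 - 19/4 * b *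
      A2 ^ 2 * B0 * B3 + 47/2 * b ^ 4 * A1 - 31/2 * a ^ 4 * A1 - 61/4 * a ^ 2 * b * B0 * B1 +
      155/8 * a * b ^ 3 * B1 - 45/8 * A2 * B2 ^ 3 * A1) * h.r15 + (69/8 * a ^ 2 * A2 * B2 * B3 -
      149/4 * a * b ^ 2 * B0 * B1 + 31/2 * a * b * A2 ^ 2 * A3 - 19/4 * b ^ 2 * A2 * B2 * B3 +
      69/8 * A2 * B0 ^ 2 * B2 * B3 + 69/4 * a * B0 * B2 ^ 2 * A3 - 373/8 * a * b ^ 2 * B0 * A1 +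
      45/8 * b * B0 * B2 ^ 2 * A3) * h.r16 + (45/8 * A2 * B0 ^ 2 * B2 * B3 - 447/8 * A2 * B2 ^ 3 *
      B1 - 389/8 * a * b * B2 ^ 2 * A3 - 111/8 * A2 ^ 2 * B2 ^ 2 * A1 + 69/8 * a ^ 2 * b ^ 2 * A1
      - 5/4 * a * b * A2 ^ 2 * B3 + 69/16 * a ^ 3 * b * B1 - 31/2 * a ^ 3 * B0 * A1 - 279/8 * a *
      b ^ 2 * B0 * A1 - 69/8 * B2 ^ 4 * B1 - 31/8 * a * b ^ 3 * B1 + 29/4 * a ^ 2 * A2 * B2 * A3)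
      * h.r17 + (-65/8 * A2 * B0 ^ 2 * B2 * B3 - 69/8 * B0 ^ 2 * B2 ^ 2 * A3 - 69/8 * a ^ 4 * A1 +
      69/8 * B0 ^ 4 * A1 + 69/8 * B0 ^ 2 * B2 ^ 2 * B3 - 753/16 * a ^ 3 * b * B1 + 31/2 * a * b ^
      2 * B0 * A1 + 279/8 * a ^ 2 * b * B0 * A1 + 69/8 * a ^ 2 * A2 * B2 * A3 + 183/8 * b ^ 2 * A2
      * B2 * A3) * h.r18 + (65/8 * b ^ 2 * A2 * B2 * B3 - 379/8 * a * A2 ^ 2 * B0 * B3 - 133/8 *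
      A2 ^ 4 * A1 + 701/16 * a ^ 2 * b ^ 2 * A1 - 121/8 * a * b ^ 2 * B0 * B1 - 143/4 * A2 * B0 ^
      2 * B2 * A3 - 217/4 * b * B0 * B2 ^ 2 * A3 - 177/8 * a * B0 * B2 ^ 2 * A3) * h.r19 + (63/8 *
      a ^ 3 * B0 * B1 + 139/16 * a * b ^ 2 * B0 * B1 - 69/8 * a ^ 2 * A2 ^ 2 * A3 + 255/8 * b * A2
      ^ 2 * B0 * B3 + 41/2 * b ^ 3 * B0 * B1 - 5 * a * b * A2 * B2 * B3 + 351/16 * a ^ 2 * b * B0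
      * B1 + 161/16 * a * b * B0 ^ 2 * A1 + 63/8 * a * B0 ^ 3 * A1) * h.r20 + (-253/8 * a * B2 *
      B3 ^ 3 - 39/2 * A2 * B0 * B1 ^ 2 * B3 + 255/8 * A2 * B0 * B3 ^ 3 - 389/8 * b * A2 * A3 * B3
      ^ 2 - 69/8 * B0 * B2 * A3 * B3 ^ 2 - 251/8 * A2 * B0 * A3 ^ 3 - 111/8 * b * B2 * A1 ^ 2 * A3
      + 159/4 * a * B2 * A3 ^ 3 - 69/8 * a * B2 * A1 ^ 2 * A3 + 301/8 * A2 * B0 * A1 ^ 2 * A3 +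
      69/8 * B0 * B2 * A1 ^ 2 * B3 + 307/4 * b * B2 * A3 ^ 3) * h.r21 + (21/2 * b * A2 * A1 ^ 2 *
      A3 + 273/8 * a * B2 * A1 * A3 * B1 - 115/4 * B0 * B2 * A1 ^ 2 * A3 - 69/8 * a * A2 * B3 ^ 3
      - 63/2 * b * B2 * A3 * B3 ^ 2 + 611/8 * b * B2 * A1 * B1 * B3 + 247/8 * b * A2 * B1 ^ 2 * B3
      - 69/8 * B0 * B2 * B1 ^ 2 * B3 + 69/8 * a * B2 * A3 * B3 ^ 2) * h.r22 + (447/8 * B0 * B2 ^ 3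
      * A1 + 207/4 * b * A2 ^ 2 * B2 * B1 + 10 * b * A2 ^ 3 * A1 - 16 * a ^ 2 * b * A2 * A3 + 63/4
      * a ^ 3 * A2 * A3 - 5/2 * b * A2 ^ 2 * B2 * A1 - 155/4 * b ^ 3 * A2 * B3 - 73/8 * a * b * A2
      * B0 * A3 + 31/4 * B0 * B2 ^ 3 * B1 - 69/8 * a * A2 ^ 2 * B2 * A1 - 45/8 * a * B2 ^ 3 * A1)
      * h.r24 + (-701/8 * a * b ^ 2 * B2 * B3 + 99/8 * B0 * B2 ^ 3 * A1 + 31/4 * B0 * B2 ^ 3 * B1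
      + 69/8 * a * A2 ^ 2 * B2 * A1 - 69/4 * a * B0 ^ 2 * B2 * A3 + 45/8 * a * B2 ^ 3 * A1 - 155/4
      * a ^ 2 * b * A2 * B3) * h.r25 + (-45/8 * A2 * B0 ^ 3 * B3 - 133/8 * A2 ^ 2 * B0 * B2 * A1 +
      315/8 * b * A2 * B2 ^ 2 * A1 + 389/8 * a * b * B0 * B2 * A3 + 61/4 * b * A2 * B0 ^ 2 * A3 +
      27/8 * b * A2 ^ 3 * B1 + 69/8 * a ^ 2 * B0 * B2 * B3 - 69/8 * b ^ 2 * B0 * B2 * B3 + 183/8 *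
      a ^ 2 * b * B2 * A3) * h.r26 + (63/8 * A2 * B0 ^ 3 * B3 - 73/8 * a * A2 ^ 3 * B1 - 183/8 * b
      ^ 3 * B2 * A3) * h.r27 + (-6 * b * A2 ^ 2 * B2 * B1 - 67/4 * b * A2 ^ 3 * A1 + 79/2 * a ^ 2
      * A2 * B0 * B3 - 161/16 * a * b * B0 * B2 * A3 - 69/8 * b * A2 * B0 ^ 2 * A3 - 69/8 * a * A2
      * B2 ^ 2 * B1 - 363/8 * b * B0 ^ 2 * B2 * A3 + 45/8 * B0 * B2 ^ 3 * B1) * h.r28 + (463/8 * a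
      * b ^ 2 * A2 * A3 - 69/8 * a ^ 3 * A2 * A3 + 255/8 * b ^ 2 * A2 * B0 * B3 + 5 * a * b * A2 *
      B0 * B3 - 63/8 * a ^ 2 * A2 * B0 * B3 - 389/8 * b ^ 3 * A2 * A3 + 161/16 * a * b * B0 * B2 *
      A3 - 69/8 * b ^ 2 * B0 * B2 * A3 - 69/8 * a ^ 2 * B0 * B2 * A3 - 69/8 * a ^ 2 * B0 * B2 * B3
      - 69/8 * B0 ^ 3 * B2 * B3) * h.r29 + (61/4 * b * A2 ^ 2 * B0 * A1) * h.r30 + (149/2 * a * b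
      * A2 * B2 * B1 + 149/8 * a * b * A2 ^ 2 * A1 - 8 * a ^ 3 * b * A3 - 61/4 * b ^ 3 * B0 * B3 -
      155/8 * a * b ^ 3 * B3 + 45/8 * a * B0 * B2 ^ 2 * A1) * h.r31 + (-133/8 * b * A2 * B0 * B2 *
      A1 - 47/2 * b * B0 ^ 3 * B3 - 69/8 * a ^ 4 * B3 + 373/8 * a ^ 2 * b ^ 2 * B3 - 611/8 * a * b
      * A2 * B2 * A1 + 301/8 * b ^ 2 * A2 * B2 * A1 + 75/2 * b ^ 2 * A2 ^ 2 * B1) * h.r32 + (3 * b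
      ^ 3 * B0 * B3 + 61/8 * a * b ^ 2 * B0 * B3 - 61/4 * b ^ 4 * A3 + 109/16 * a * b ^ 3 * A3 -
      291/8 * A2 ^ 4 * A3 + 291/16 * a ^ 3 * b * A3 - 349/16 * a ^ 2 * b ^ 2 * A3 + 299/8 * b * A2
      * B0 * B2 * A1 + 161/16 * a * b * B0 ^ 2 * A3 - 31/4 * A2 * B2 ^ 3 * A3 - 69/8 * b ^ 2 * B2
      ^ 2 * B1 - 89/4 * b * A2 * B0 * B2 * B1 + 143/8 * b * B0 ^ 3 * A3 + 753/16 * a * b * B0 ^ 2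
      * B3 - 45/8 * B2 ^ 4 * B3 - 45/8 * B0 ^ 2 * B2 ^ 2 * B1) * h.r33

/-! ### The product of the Jacobi theta constants under translation and inversion -/

section

open UpperHalfPlane Filter Topology

/-- The product `ϑ₂ϑ₃ϑ₄ / 2` of the Jacobi theta constants. -/
def thetaProd (τ : ℂ) : ℂ :=
  th 1 (1 / 2) (τ / 2) * th 1 0 (τ / 2) * th (-1) 0 (τ / 2) / 2

theorem th_one_zero_half {τ : ℂ} (hτ : 0 < τ.im) : th 1 0 (τ / 2) = thA 1 0 τ + thA 1 4 τ := by
  rw [th_split 1 0 (by simpa using hτ), thA, thA, show 4 * (τ / 2) = 2 * τ by ring]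
  norm_num

theorem th_neg_one_zero_half {τ : ℂ} (hτ : 0 < τ.im) :
    th (-1) 0 (τ / 2) = thA 1 0 τ - thA 1 4 τ := by
  rw [th_split (-1) 0 (by simpa using hτ), thA, thA, show 4 * (τ / 2) = 2 * τ by ring]
  norm_num
  ring

theorem th_one_half_half {τ : ℂ} (hτ : 0 < τ.im) : th 1 (1 / 2) (τ / 2) = 2 * thA 1 2 τ := by
  have h := thA_congr 1 6 (-2) 1 (by norm_num) τ
  rw [thA_neg] at h
  rw [th_split 1 (1 / 2) (by simpa using hτ), show 4 * (τ / 2) = 2 * τ by ring]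
  have h1 : th 1 (1 / 2 / 2) (2 * τ) = thA 1 2 τ := by rw [thA]; norm_num
  have h2 : th 1 ((1 / 2 + 1) / 2) (2 * τ) = thA 1 6 τ := by rw [thA]; norm_num
  rw [h1, h2, h]
  simp
  ring

/-- Parity splitting gives ϑ₃ = a + b, ϑ₄ = a - b and ϑ₂ = 2 A2. -/
theorem thetaProd_eq {τ : ℂ} (hτ : 0 < τ.im) :
    thetaProd τ = thA 1 2 τ * (thA 1 0 τ ^ 2 - thA 1 4 τ ^ 2) := by
  rw [thetaProd, th_one_zero_half hτ, th_neg_one_zero_half hτ, th_one_half_half hτ]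
  ring

theorem thA_add_one (s : ℤˣ) (j : ℤ) (τ : ℂ) :
    thA s j (τ + 1) = zeta 32 ^ (j ^ 2) * thA (s * (-1) ^ j) j τ := by
  rw [thA, thA, zeta_zpow, show 2 * (τ + 1) = 2 * τ + (2 : ℤ) by push_cast; ring,
    th_shift s _ _ 2 j (by push_cast; ring)]
  congr 2
  push_cast
  ring

theorem thetaProd_add_one {τ : ℂ} (hτ : 0 < τ.im) :
    thetaProd (τ + 1) = zeta 8 * thetaProd τ := by
  have hτ' : 0 < (τ + 1).im := by simpa using hτ
  have h4 : zeta 32 ^ (4 ^ 2 : ℤ) = -1 := by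
    rw [zeta_zpow, ← Complex.exp_pi_mul_I]
    congr 1
    push_cast
    ring
  have h2 : zeta 32 ^ (2 ^ 2 : ℤ) = zeta 8 := by
    rw [zeta_zpow, zeta]
    congr 1
    push_cast
    ring
  have e4 : (-1 : ℤˣ) ^ (4 : ℤ) = 1 := by decide
  have e2 : (-1 : ℤˣ) ^ (2 : ℤ) = 1 := by decide
  rw [thetaProd_eq hτ, thetaProd_eq hτ', thA_add_one, thA_add_one, thA_add_one, h4, h2, e4, e2]
  simp
  ring

theorem th_one_zero_eq (t : ℂ) : th 1 0 t = jacobiTheta (2 * t) := by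
  rw [jacobiTheta_eq_jacobiTheta₂, jacobiTheta₂, th]
  refine tsum_congr fun n => ?_
  rw [exp_sq_eq_jacobiTheta₂_term]
  simp

theorem th_neg_one_zero_eq (t : ℂ) : th (-1) 0 t = jacobiTheta₂ (1 / 2) (2 * t) := by
  rw [jacobiTheta₂, th]
  refine tsum_congr fun n => ?_
  rw [exp_sq_eq_jacobiTheta₂_term, jacobiTheta₂_term, jacobiTheta₂_term]
  have h : Complex.exp (2 * Real.pi * Complex.I * n * (1 / 2)) = (((-1) ^ n : ℤˣ) : ℂ) := by
    rw [show (2 * Real.pi * Complex.I * n * (1 / 2) : ℂ) = n * (Real.pi * Complex.I) by ring,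
      Complex.exp_int_mul, Complex.exp_pi_mul_I]
    rcases Int.even_or_odd n with h | h <;> simp [h.neg_one_zpow]
  rw [Complex.exp_add (2 * Real.pi * Complex.I * n * (1 / 2)), h]
  simp

theorem th_one_half_eq (t : ℂ) :
    th 1 (1 / 2) t = Complex.exp (2 * Real.pi * Complex.I * t / 4) * jacobiTheta₂ t (2 * t) := by
  rw [jacobiTheta₂, th, ← tsum_mul_left]
  refine tsum_congr fun n => ?_
  rw [exp_sq_eq_jacobiTheta₂_term, _root_.one_zpow, Units.val_one, Int.cast_one, one_mul]
  ring_nf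

theorem neg_I_mul_ne_zero {τ : ℂ} (hτ : 0 < τ.im) : -Complex.I * τ ≠ 0 := by
  have : τ ≠ 0 := by
    rintro rfl
    simp at hτ
  simp [this]

theorem im_neg_one_div_pos {τ : ℂ} (hτ : 0 < τ.im) : 0 < (-1 / τ).im := by
  have := UpperHalfPlane.im_inv_neg_coe_pos ⟨τ, hτ⟩
  rwa [neg_div, one_div, ← inv_neg]

/-- Inversion fixes ϑ₃ and exchanges ϑ₂ with ϑ₄, each with the factor (-iτ)^{1/2}; these are the
functional equation of `jacobiTheta₂` at z = 0, 1/2 and τ/2. -/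
theorem thetaProd_neg_one_div {τ : ℂ} (hτ : 0 < τ.im) :
    thetaProd (-1 / τ) = ((-Complex.I * τ) ^ (1 / 2 : ℂ)) ^ 3 * thetaProd τ := by
  have hτ0 : τ ≠ 0 := by
    rintro rfl
    simp at hτ
  have hu : (-Complex.I * τ) ^ (1 / 2 : ℂ) ≠ 0 := by
    simp [Complex.cpow_eq_zero_iff, hτ0]
  have e0 : th 1 0 (-1 / τ / 2) = (-Complex.I * τ) ^ (1 / 2 : ℂ) * th 1 0 (τ / 2) := by
    have h := jacobiTheta₂_functional_equation 0 τ
    rw [th_one_zero_eq, th_one_zero_eq, jacobiTheta_eq_jacobiTheta₂, jacobiTheta_eq_jacobiTheta₂,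
      mul_div_cancel₀ _ two_ne_zero, mul_div_cancel₀ _ two_ne_zero, h]
    field_simp
    simp
  have e1 : th 1 (1 / 2) (-1 / τ / 2) = (-Complex.I * τ) ^ (1 / 2 : ℂ) * th (-1) 0 (τ / 2) := by
    have h := jacobiTheta₂_functional_equation (1 / 2) τ
    rw [th_one_half_eq, th_neg_one_zero_eq, mul_div_cancel₀ _ two_ne_zero,
      mul_div_cancel₀ _ two_ne_zero, h, show -1 / τ / 2 = -(1 / 2 / τ) by ring, jacobiTheta₂_neg_left]
    have h3 : 2 * Real.pi * Complex.I * (-(1 / 2 / τ)) / 4 = -Real.pi * Complex.I * (1 / 2) ^ 2 / τ := by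
      ring
    rw [h3, ← mul_assoc, ← mul_assoc, mul_one_div_cancel hu, one_mul]
  have e2 : th (-1) 0 (-1 / τ / 2) = (-Complex.I * τ) ^ (1 / 2 : ℂ) * th 1 (1 / 2) (τ / 2) := by
    have h := jacobiTheta₂_functional_equation (τ / 2) τ
    rw [th_one_half_eq, th_neg_one_zero_eq, mul_div_cancel₀ _ two_ne_zero,
      mul_div_cancel₀ _ two_ne_zero, h, show τ / 2 / τ = 1 / 2 by field_simp]
    have h3 : Complex.exp (2 * Real.pi * Complex.I * (τ / 2) / 4) *
        Complex.exp (-Real.pi * Complex.I * (τ / 2) ^ 2 / τ) = 1 := by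
      rw [← Complex.exp_add, ← Complex.exp_zero]
      congr 1
      field_simp
      ring
    have h5 := mul_one_div_cancel hu
    generalize Complex.exp _ = e₁ at h3 ⊢
    generalize Complex.exp _ = e₂ at h3 ⊢
    linear_combination (-jacobiTheta₂ (1 / 2) (-1 / τ) * e₁ * e₂) * h5 -
      jacobiTheta₂ (1 / 2) (-1 / τ) * h3
  rw [thetaProd, thetaProd, e0, e1, e2]
  ring

end

/-! ### The identity between η³ and the product of theta constants -/

section

open UpperHalfPlane Filter Topology
open scoped ModularForm MatrixGroups

theorem eta_add_one (τ : ℂ) : ModularForm.eta (τ + 1) = zeta 24 * ModularForm.eta τ := by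
  have h1 : Function.Periodic.qParam 24 (τ + 1) = zeta 24 * Function.Periodic.qParam 24 τ := by
    rw [Function.Periodic.qParam, Function.Periodic.qParam, zeta, ← Complex.exp_add]
    congr 1
    push_cast
    ring
  have h2 (n : ℕ) : ModularForm.eta_q n (τ + 1) = ModularForm.eta_q n τ := by
    rw [ModularForm.eta_q_eq_pow, ModularForm.eta_q_eq_pow, mul_add, mul_one, Complex.exp_add,
      Complex.exp_two_pi_mul_I, mul_one]
  rw [ModularForm.eta, ModularForm.eta, h1]
  simp only [h2]
  ring

/-- The argument of τ lies in [0, π], so subtracting π/2 does not cross the branch cut. This merges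
separate square roots of τ and i into one power of -iτ. -/
theorem log_neg_I_mul {τ : ℂ} (hτ : 0 < τ.im) :
    Complex.log (-Complex.I * τ) = Complex.log τ - Complex.log Complex.I := by
  have hτ0 : τ ≠ 0 := by
    rintro rfl
    simp at hτ
  have h1 := Complex.arg_nonneg_iff.2 hτ.le
  have h2 := Complex.arg_le_pi τ
  rw [mul_comm, Complex.log_mul hτ0 (by simp), Complex.log_neg_I, Complex.log_I]
  · ring
  · rw [Complex.arg_neg_I]
    constructor <;> linarith [Real.pi_pos]

theorem eta_neg_one_div {τ : ℂ} (hτ : 0 < τ.im) :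
    ModularForm.eta (-1 / τ) = (-Complex.I * τ) ^ (1 / 2 : ℂ) * ModularForm.eta τ := by
  have hτ0 : τ ≠ 0 := by
    rintro rfl
    simp at hτ
  have h := ModularForm.eta_comp_eq_csqrt_I_inv (show τ ∈ upperHalfPlaneSet from hτ)
  simp only [Function.comp_apply, Pi.smul_apply, Pi.mul_apply, smul_eq_mul] at h
  rw [h, ← mul_assoc, Complex.cpow_def_of_ne_zero (neg_I_mul_ne_zero hτ), log_neg_I_mul hτ,
    sqrt_eq_exp Complex.I_ne_zero, sqrt_eq_exp hτ0, ← Complex.exp_neg,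
    ← Complex.exp_add]
  congr 2
  ring

theorem tendsto_tprod_eta :
    Tendsto (fun τ : ℍ => ∏' n, (1 - ModularForm.eta_q n τ)) atImInfty (𝓝 1) := by
  have h1 : ContinuousAt (fun q : ℂ => ∏' n : ℕ, (1 - q ^ (n + 1))) 0 :=
    (ModularForm.differentiableOn_tprod_one_sub_pow.differentiableAt
      (Metric.ball_mem_nhds 0 one_pos)).continuousAt
  have h2 := h1.tendsto.comp (UpperHalfPlane.qParam_tendsto_atImInfty zero_lt_one)
  simpa [Function.comp_def] using h2

/-- Dominated convergence: for Im τ ≥ 1 the terms are bounded by exp(-πn²), and in the limit only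
the exponents equal to zero survive. -/
theorem tendsto_tsum_exp {e : ℤ → ℝ} (he : ∀ n : ℤ, (n : ℝ) ^ 2 / 2 ≤ e n) :
    Tendsto (fun τ : ℍ => ∑' n : ℤ, Complex.exp (2 * Real.pi * Complex.I * τ * e n)) atImInfty
      (𝓝 (∑' n : ℤ, if e n = 0 then 1 else 0)) := by
  have hnorm (τ : ℍ) (n : ℤ) : ‖Complex.exp (2 * Real.pi * Complex.I * τ * e n)‖
      = Real.exp (-(2 * Real.pi * e n) * τ.im) := by
    rw [Complex.norm_exp]
    congr 1
    simp
    ring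
  have hnonneg (n : ℤ) : 0 ≤ e n := (by positivity : (0 : ℝ) ≤ (n : ℝ) ^ 2 / 2).trans (he n)
  refine tendsto_tsum_of_dominated_convergence (bound := fun n : ℤ => Real.exp (-Real.pi * n ^ 2))
    ?_ ?_ ?_
  · have := ((summable_jacobiTheta₂_term_iff 0 Complex.I).2 (by simp)).norm
    refine this.congr fun n => ?_
    rw [norm_jacobiTheta₂_term]
    simp
  · intro n
    split_ifs with h
    · simp [h]
    · rw [tendsto_zero_iff_norm_tendsto_zero]
      simp only [hnorm]
      have hpos : 0 < 2 * Real.pi * e n := by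
        have := (hnonneg n).lt_of_ne' h
        positivity
      refine Real.tendsto_exp_atBot.comp ?_
      exact (tendsto_comap (f := UpperHalfPlane.im)).const_mul_atTop_of_neg (neg_lt_zero.2 hpos)
  · rw [atImInfty, eventually_comap]
    filter_upwards [eventually_ge_atTop 1] with y hy τ hτ n
    rw [hnorm, Real.exp_le_exp, hτ]
    have h1 := he n
    have h2 := hnonneg n
    nlinarith [Real.pi_pos, mul_nonneg Real.pi_pos.le h2,
      mul_nonneg (mul_nonneg Real.pi_pos.le h2) (sub_nonneg.2 hy),
      mul_nonneg Real.pi_pos.le (sub_nonneg.2 h1)]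

theorem tendsto_thA_zero : Tendsto (fun τ : ℍ => thA 1 0 τ) atImInfty (𝓝 1) := by
  have h := tendsto_tsum_exp (e := fun n => 2 * n ^ 2) fun n : ℤ => by
    nlinarith [sq_nonneg (n : ℝ)]
  have h1 : ∑' n : ℤ, (if 2 * (n : ℝ) ^ 2 = 0 then (1 : ℂ) else 0) = 1 := by
    rw [tsum_eq_single 0 (fun n hn => by simp [hn])]
    simp
  rw [h1] at h
  refine h.congr fun τ => ?_
  rw [thA, th]
  refine tsum_congr fun n => ?_
  simp
  ring_nf

theorem tendsto_thA_four : Tendsto (fun τ : ℍ => thA 1 4 τ) atImInfty (𝓝 0) := by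
  have h := tendsto_tsum_exp (e := fun n => 2 * (n + 1 / 2) ^ 2) fun n : ℤ => by
    have h1 : (0 : ℤ) ≤ (n + 1) * (3 * n + 1) := by
      rcases le_or_gt 0 n with h | h
      · positivity
      · exact mul_nonneg_of_nonpos_of_nonpos (by omega) (by omega)
    have h2 : (0 : ℝ) ≤ (n + 1) * (3 * n + 1) := by exact_mod_cast h1
    nlinarith
  have h1 : ∑' n : ℤ, (if 2 * ((n : ℝ) + 1 / 2) ^ 2 = 0 then (1 : ℂ) else 0) = 0 := by
    refine (tsum_congr fun n => if_neg ?_).trans tsum_zero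
    have h2 : (n : ℝ) + 1 / 2 ≠ 0 := by
      intro h
      have h3 : (2 * n + 1 : ℤ) = 0 := by exact_mod_cast (by linarith : (2 * n + 1 : ℝ) = 0)
      omega
    positivity
  rw [h1] at h
  refine h.congr fun τ => ?_
  rw [thA, th]
  refine tsum_congr fun n => ?_
  simp
  ring_nf

theorem tendsto_thA_two :
    Tendsto (fun τ : ℍ => thA 1 2 τ * Complex.exp (-(2 * Real.pi * Complex.I * τ / 8))) atImInfty
      (𝓝 1) := by
  -- The exponent is 2(n + 1/4)² with its leading value 1/8 removed.
  have h := tendsto_tsum_exp (e := fun n => 2 * n ^ 2 + n) fun n : ℤ => by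
    have h1 : (0 : ℤ) ≤ n ^ 2 + n := by nlinarith [Int.le_self_sq n, Int.le_self_sq (-n)]
    have h2 : (0 : ℝ) ≤ (n : ℝ) ^ 2 + n := by exact_mod_cast h1
    nlinarith [sq_nonneg (n : ℝ)]
  have h1 : ∑' n : ℤ, (if 2 * (n : ℝ) ^ 2 + n = 0 then (1 : ℂ) else 0) = 1 := by
    rw [tsum_eq_single 0]
    · simp
    · intro n hn
      refine if_neg fun h => ?_
      have h2 : n * (2 * n + 1) = 0 := by
        have h3 : (2 * n ^ 2 + n : ℤ) = 0 := by exact_mod_cast h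
        linarith [h3, (by ring : n * (2 * n + 1) = 2 * n ^ 2 + n)]
      rcases mul_eq_zero.1 h2 with h | h <;> omega
  rw [h1] at h
  refine h.congr fun τ => ?_
  rw [thA, th, ← tsum_mul_right]
  refine tsum_congr fun n => ?_
  rw [_root_.one_zpow, Units.val_one, Int.cast_one, one_mul, ← Complex.exp_add]
  congr 1
  push_cast
  ring


/-- Both functions have leading term q^{1/8} with coefficient 1. -/
theorem tendsto_thetaProd_div_eta :
    Tendsto (fun τ : ℍ => thetaProd τ / ModularForm.eta τ ^ 3) atImInfty (𝓝 1) := by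
  have h := (tendsto_thA_two.mul ((tendsto_thA_zero.pow 2).sub (tendsto_thA_four.pow 2))).div
    (tendsto_tprod_eta.pow 3) (by norm_num)
  norm_num at h
  refine h.congr fun τ => ?_
  have hq : Function.Periodic.qParam 24 (τ : ℂ) ^ 3 *
      Complex.exp (-(2 * Real.pi * Complex.I * τ / 8)) = 1 := by
    rw [Function.Periodic.qParam, ← Complex.exp_nat_mul, ← Complex.exp_add, ← Complex.exp_zero]
    congr 1
    push_cast
    ring
  have hq0 : Function.Periodic.qParam 24 (τ : ℂ) ≠ 0 := Function.Periodic.qParam_ne_zero _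
  have hp := ModularForm.eta_tprod_ne_zero τ.2
  rw [thetaProd_eq τ.2, ModularForm.eta, mul_pow, Pi.div_apply]
  rw [div_eq_div_iff (pow_ne_zero 3 hp) (mul_ne_zero (pow_ne_zero 3 hq0) (pow_ne_zero 3 hp))]
  linear_combination (thA 1 2 τ * (thA 1 0 τ ^ 2 - thA 1 4 τ ^ 2) *
    (∏' n, (1 - ModularForm.eta_q n τ)) ^ 3) * hq

/-- All three factors are values of one holomorphic function θ = `jacobiTheta`: ϑ₃ = θ(τ), ϑ₂ =
θ(τ/4) - θ(τ), ϑ₄ = θ(τ + 1). -/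
theorem differentiableAt_thetaProd {τ : ℂ} (hτ : 0 < τ.im) : DifferentiableAt ℂ thetaProd τ := by
  have h (c d : ℂ) (hc : 0 < (c * τ + d).im) :
      DifferentiableAt ℂ (fun τ => jacobiTheta (c * τ + d)) τ :=
    DifferentiableAt.comp (g := jacobiTheta) (f := fun τ => c * τ + d) τ
      (differentiableAt_jacobiTheta hc) (by fun_prop : DifferentiableAt ℂ (fun τ => c * τ + d) τ)
  have hd : DifferentiableAt ℂ (fun τ => (jacobiTheta (1 / 4 * τ + 0) - jacobiTheta (1 * τ + 0)) *
      jacobiTheta (1 * τ + 0) * jacobiTheta (1 * τ + 1) / 2) τ := by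
    have h1 := h (1 / 4) 0 (by simpa [Complex.div_im] using hτ)
    have h2 := h 1 0 (by simpa using hτ)
    have h3 := h 1 1 (by simpa using hτ)
    exact (((h1.sub h2).mul h2).mul h3).div_const 2
  refine hd.congr_of_eventuallyEq ?_
  filter_upwards [UpperHalfPlane.isOpen_upperHalfPlaneSet.mem_nhds hτ] with z hz
  have hz : 0 < z.im := hz
  have e1 : jacobiTheta (1 * z + 0) = th 1 0 (z / 2) := by
    rw [th_one_zero_eq]
    ring_nf
  have e2 : jacobiTheta (1 / 4 * z + 0) = th 1 0 (z / 2) + th 1 (1 / 2) (z / 2) := by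
    have h1 := th_split 1 0 (t := z / 8) (by simpa using hz)
    rw [th_one_zero_eq] at h1
    rw [show 1 / 4 * z + 0 = 2 * (z / 8) by ring, h1]
    ring_nf
    simp
  have e3 : jacobiTheta (1 * z + 1) = th (-1) 0 (z / 2) := by
    rw [show 1 * z + 1 = 2 * (z / 2 + 1 / 2) by ring, ← th_one_zero_eq, th, th]
    refine tsum_congr fun n => ?_
    have h2 : Complex.exp (Real.pi * Complex.I * n ^ 2) = (((-1) ^ n : ℤˣ) : ℂ) := by
      rw [show (Real.pi * Complex.I * n ^ 2 : ℂ) = (n ^ 2 : ℤ) * (Real.pi * Complex.I) by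
        push_cast; ring, Complex.exp_int_mul, Complex.exp_pi_mul_I]
      rcases Int.even_or_odd n with h | h
      · simp [h.neg_one_zpow, (h.pow_of_ne_zero two_ne_zero : Even (n ^ 2)).neg_one_zpow]
      · simp [h.neg_one_zpow, (h.pow : Odd (n ^ 2)).neg_one_zpow]
    rw [← h2, _root_.one_zpow, Units.val_one, Int.cast_one, one_mul, ← Complex.exp_add]
    congr 1
    ring
  rw [e1, e2, e3, thetaProd]
  ring

/-- The Jacobi derivative formula: `2η³ = ϑ₂ϑ₃ϑ₄`. -/
theorem eta_cube {τ : ℂ} (hτ : 0 < τ.im) : ModularForm.eta τ ^ 3 = thetaProd τ := by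
  -- Numerator and denominator have the same automorphy factors, (-iτ)^{3/2} under inversion and ζ₈
  -- under translation, so the quotient is invariant; η has no zeros, so it is holomorphic.
  let g : ℍ → ℂ := fun τ => thetaProd τ / ModularForm.eta τ ^ 3
  have hη (z : ℍ) : ModularForm.eta z ≠ 0 := ModularForm.eta_ne_zero z.2
  have hS : g ∣[(0 : ℤ)] ModularGroup.S = g := by
    ext z
    have hz : 0 < (z : ℂ).im := z.2
    have hu : (-Complex.I * (z : ℂ)) ^ (1 / 2 : ℂ) ≠ 0 := by
      simp [Complex.cpow_eq_zero_iff, z.ne_zero]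
    rw [ModularForm.SL_slash_apply, UpperHalfPlane.modular_S_smul]
    have hm : (-(z : ℂ))⁻¹ = -1 / (z : ℂ) := by rw [neg_div, one_div, inv_neg]
    simp only [g, hm, neg_zero, zpow_zero, mul_one]
    rw [thetaProd_neg_one_div hz, eta_neg_one_div hz, mul_pow]
    exact mul_div_mul_left _ _ (pow_ne_zero 3 hu)
  have hT : g ∣[(0 : ℤ)] ModularGroup.T = g := by
    ext z
    have hz : 0 < (z : ℂ).im := z.2
    rw [ModularForm.SL_slash_apply, UpperHalfPlane.modular_T_smul]
    have hm : (((1 : ℝ) +ᵥ z : ℍ) : ℂ) = z + 1 := by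
      simp [add_comm]
    have h3 : zeta 24 ^ 3 = zeta 8 := by
      rw [zeta, zeta, ← Complex.exp_nat_mul]
      congr 1
      push_cast
      ring
    simp only [g, hm, neg_zero, zpow_zero, mul_one]
    rw [thetaProd_add_one hz, eta_add_one, mul_pow, h3]
    exact mul_div_mul_left _ _ (zeta_ne_zero 8)
  have hinv := SlashInvariantForm.slash_action_generators_SL2Z hS hT
  let f : ModularForm 𝒮ℒ 0 :=
    { toFun := g
      slash_action_eq' := by
        rintro A ⟨A, rfl⟩
        exact hinv A
      holo' := by
        rw [UpperHalfPlane.mdifferentiable_iff]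
        refine .congr (f := fun z => thetaProd z / ModularForm.eta z ^ 3) (fun z hz => ?_)
          fun z hz => ?_
        · exact ((differentiableAt_thetaProd hz).div
            ((ModularForm.differentiableAt_eta_of_mem_upperHalfPlaneSet hz).pow 3)
            (pow_ne_zero 3 (ModularForm.eta_ne_zero hz))).differentiableWithinAt
        · simp [g, ofComplex_apply_of_im_pos hz]
      -- Invariance carries every cusp to infinity, where the quotient has a limit.
      bdd_at_cusps' := fun hc => by
        rw [Subgroup.IsArithmetic.isCusp_iff_isCusp_SL2Z] at hc
        rw [OnePoint.isBoundedAt_iff_forall_SL2Z hc]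
        intro γ _
        rw [hinv]
        exact tendsto_thetaProd_div_eta.isBigO_one ℝ }
  obtain ⟨c, hc⟩ := ModularFormClass.levelOne_weight_zero_const f
  have hg : g = Function.const _ c := hc
  have hc1 : c = 1 := by
    have h := tendsto_thetaProd_div_eta
    change Tendsto g _ _ at h
    rw [hg] at h
    exact tendsto_nhds_unique tendsto_const_nhds h
  have h := congrFun hg ⟨τ, hτ⟩
  rw [hc1] at h
  exact ((div_eq_one_iff_eq (pow_ne_zero 3 (hη ⟨τ, hτ⟩))).1 h).symm

end

/-! ### Eta quotients cubed as quotients of theta products -/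

theorem thetaProd_ne_zero {τ : ℂ} (hτ : 0 < τ.im) : thetaProd τ ≠ 0 := by
  rw [← eta_cube hτ]
  exact pow_ne_zero 3 (ModularForm.eta_ne_zero hτ)

theorem Theta_cube (a d b : ℕ) {τ : ℂ} (hτ : 0 < τ.im) (h : 0 < ((a * τ + b) / d).im) :
    Theta a d b τ ^ 3 = thetaProd τ ^ 4 / thetaProd ((a * τ + b) / d) := by
  rw [Theta, div_pow, eta_cube h, ← eta_cube hτ]
  ring

theorem thetaProd_four_mul (τ : ℂ) :
    thetaProd (4 * τ) = thA 1 4 τ * thA 1 0 τ * thA (-1) 0 τ / 2 := by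
  rw [thetaProd, thA, thA, thA, show 4 * τ / 2 = 2 * τ by ring]
  norm_num

theorem th_one_half_eighth {τ : ℂ} (hτ : 0 < τ.im) :
    th 1 (1 / 2) (τ / 8) = 2 * (thA 1 1 τ + thA 1 3 τ) := by
  have h5 := thA_congr 1 5 (-3) 1 (by norm_num) τ
  have h7 := thA_congr 1 7 (-1) 1 (by norm_num) τ
  rw [thA_neg] at h5 h7
  have h2 : 0 < (τ / 2).im := by simpa using hτ
  rw [th_split 1 (1 / 2) (by simpa using hτ), show 4 * (τ / 8) = τ / 2 by ring,
    th_split 1 (1 / 2 / 2) h2, th_split 1 ((1 / 2 + 1) / 2) h2, show 4 * (τ / 2) = 2 * τ by ring]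
  have e1 : th 1 (1 / 2 / 2 / 2) (2 * τ) = thA 1 1 τ := by rw [thA]; norm_num
  have e5 : th 1 ((1 / 2 / 2 + 1) / 2) (2 * τ) = thA 1 5 τ := by rw [thA]; norm_num
  have e3 : th 1 ((1 / 2 + 1) / 2 / 2) (2 * τ) = thA 1 3 τ := by rw [thA]; norm_num
  have e7 : th 1 (((1 / 2 + 1) / 2 + 1) / 2) (2 * τ) = thA 1 7 τ := by rw [thA]; norm_num
  rw [e1, e5, e3, e7, h5, h7]
  simp
  ring

theorem th_zero_eighth (s : ℤˣ) {τ : ℂ} (hτ : 0 < τ.im) :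
    th s 0 (τ / 8) = thA 1 0 τ + thA 1 4 τ + s * (2 * thA 1 2 τ) := by
  rw [th_split s 0 (by simpa using hτ), show 4 * (τ / 8) = τ / 2 by ring, zero_div,
    th_one_zero_half hτ, zero_add, th_one_half_half hτ]

theorem thetaProd_div_four {τ : ℂ} (hτ : 0 < τ.im) :
    thetaProd (τ / 4) = (thA 1 1 τ + thA 1 3 τ) *
      ((thA 1 0 τ + thA 1 4 τ) ^ 2 - 4 * thA 1 2 τ ^ 2) := by
  rw [thetaProd, show τ / 4 / 2 = τ / 8 by ring, th_one_half_eighth hτ, th_zero_eighth _ hτ,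
    th_zero_eighth _ hτ]
  push_cast
  ring

theorem thetaProd_add_half {τ : ℂ} (hτ : 0 < τ.im) :
    thetaProd (τ + 1 / 2) = zeta 16 * thA (-1) 2 τ * (thA 1 0 τ ^ 2 + thA 1 4 τ ^ 2) := by
  have hτ' : 0 < (τ + 1 / 2).im := by simpa using hτ
  have ht : 2 * (τ + 1 / 2) = 2 * τ + (1 : ℤ) := by push_cast; ring
  have e0 := th_shift 1 ((0 : ℤ) / 8) (2 * τ) 1 0 (by norm_num)
  have e2 := th_shift 1 ((2 : ℤ) / 8) (2 * τ) 1 1 (by norm_num)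
  have e4 := th_shift 1 ((4 : ℤ) / 8) (2 * τ) 1 2 (by norm_num)
  have c2 : Complex.exp (2 * Real.pi * Complex.I * ((1 : ℤ) * (((2 : ℤ) : ℂ) / 8) ^ 2))
      = zeta 16 := by
    rw [zeta]
    congr 1
    push_cast
    ring
  have c4 : Complex.exp (2 * Real.pi * Complex.I * ((1 : ℤ) * (((4 : ℤ) : ℂ) / 8) ^ 2))
      = Complex.I := by
    refine Eq.trans (congrArg Complex.exp ?_) Complex.exp_pi_div_two_mul_I
    push_cast
    ring
  have c0 : Complex.exp (2 * Real.pi * Complex.I * ((1 : ℤ) * (((0 : ℤ) : ℂ) / 8) ^ 2)) = 1 := by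
    simp
  have u0 : 1 * (-1 : ℤˣ) ^ (0 : ℤ) = 1 := by decide
  have u1 : 1 * (-1 : ℤˣ) ^ (1 : ℤ) = -1 := by decide
  have u2 : 1 * (-1 : ℤˣ) ^ (2 : ℤ) = 1 := by decide
  rw [c0, u0] at e0
  rw [c2, u1] at e2
  rw [c4, u2] at e4
  rw [thetaProd_eq hτ', thA, thA, thA, thA, thA, thA, ht, e0, e2, e4]
  linear_combination (-(zeta 16 * th (-1) ((2 : ℤ) / 8) (2 * τ) *
    th 1 ((4 : ℤ) / 8) (2 * τ) ^ 2)) * Complex.I_sq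

/-- The theta constant identity `ϑ₂⁴ = ϑ₃⁴ - ϑ₄⁴` at `τ / 4`. -/
theorem thA_one_add_thA_three_pow_four {τ : ℂ} (hτ : 0 < τ.im) :
    (thA 1 1 τ + thA 1 3 τ) ^ 4 = (thA 1 0 τ + thA 1 4 τ) * thA 1 2 τ *
      ((thA 1 0 τ + thA 1 4 τ) ^ 2 + 4 * thA 1 2 τ ^ 2) := by
  -- At τ/16 the constants a, B0, b become ϑ₃, ϑ₄, ϑ₂ at τ/4, which split again into constants at τ.
  have h := (thetaRelations (τ := τ / 16) (by simpa using hτ)).r3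
  have e0 : thA 1 0 (τ / 16) = th 1 0 (τ / 8) := by
    rw [thA, show 2 * (τ / 16) = τ / 8 by ring]; norm_num
  have e1 : thA (-1) 0 (τ / 16) = th (-1) 0 (τ / 8) := by
    rw [thA, show 2 * (τ / 16) = τ / 8 by ring]; norm_num
  have e4 : thA 1 4 (τ / 16) = th 1 (1 / 2) (τ / 8) := by
    rw [thA, show 2 * (τ / 16) = τ / 8 by ring]; norm_num
  rw [e0, e1, e4, th_one_half_eighth hτ, th_zero_eighth _ hτ, th_zero_eighth _ hτ] at h
  push_cast at h
  linear_combination h / 16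

theorem tildeThetaCube_one {τ : ℂ} (hτ : 0 < τ.im) :
    tildeThetaCube 1 0 τ = thetaProd τ ^ 4 / thetaProd (4 * τ) := by
  have h4 : 0 < (4 * τ).im := by simpa using hτ
  have hr := thetaRelations hτ
  rw [eq_div_iff (thetaProd_ne_zero h4), thetaProd_eq hτ, thetaProd_four_mul]
  change poly10 (fun j k => theta (lam j k) τ) * _ = _
  rw [poly_10_eq (thetaTable hτ)]
  generalize thA 1 0 τ = a at *
  generalize thA 1 4 τ = b at *
  -- Both sides equal (a² - b²)⁴ ab(a² + b²)/2, by B0⁴ = a⁴ - b⁴ on the left and A2⁴ = ab(a² + b²)/2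
  -- on the right.
  linear_combination (a ^ 2 - b ^ 2) ^ 3 * a * b / 2 * hr.r3 - (a ^ 2 - b ^ 2) ^ 4 * hr.r1

theorem tildeThetaCube_two_zero {τ : ℂ} (hτ : 0 < τ.im) :
    tildeThetaCube 2 0 τ = thetaProd τ ^ 3 := by
  change poly20 (fun j k => theta (lam j k) τ) = _
  rw [poly_20_eq (thetaRelations hτ) (thetaTable hτ), thetaProd_eq hτ]
  ring

theorem tildeThetaCube_two_one {τ : ℂ} (hτ : 0 < τ.im) :
    tildeThetaCube 2 1 τ = thetaProd τ ^ 4 / thetaProd (τ + 1 / 2) := by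
  have h2 : 0 < (τ + 1 / 2).im := by simpa using hτ
  have hr := thetaRelations hτ
  rw [eq_div_iff (thetaProd_ne_zero h2), thetaProd_eq hτ, thetaProd_add_half hτ]
  change (zeta 16)⁻¹ * poly21 (fun j k => theta (lam j k) τ) * _ = _
  rw [poly_21_eq hr (thetaTable hτ)]
  have hz : (zeta 16)⁻¹ * zeta 16 = 1 := inv_mul_cancel₀ (zeta_ne_zero 16)
  generalize (zeta 16)⁻¹ = z at *
  generalize zeta 16 = z' at *
  generalize thA 1 0 τ = a at *
  generalize thA 1 4 τ = b at *
  generalize thA 1 2 τ = A2 at *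
  generalize thA (-1) 2 τ = B2 at *
  linear_combination (a ^ 2 - b ^ 2) ^ 3 * B2 ^ 4 * (a ^ 2 + b ^ 2) * hz +
    (a ^ 2 - b ^ 2) ^ 3 * (a ^ 2 + b ^ 2) * hr.r4 - (a ^ 2 - b ^ 2) ^ 4 * hr.r1

theorem tildeThetaCube_four_zero {τ : ℂ} (hτ : 0 < τ.im) :
    tildeThetaCube 4 0 τ = thetaProd τ ^ 4 / thetaProd (τ / 4) := by
  have h4 : 0 < (τ / 4).im := by simpa using hτ
  have hr := thetaRelations hτ
  have ht := thetaTable hτ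
  have hs := thA_one_add_thA_three_pow_four hτ
  rw [eq_div_iff (thetaProd_ne_zero h4), thetaProd_eq hτ, thetaProd_div_four hτ]
  have h : tildeThetaCube 4 0 τ =
      (poly40 (fun j k => theta (lam j k) τ) + poly42 (fun j k => theta (lam j k) τ)) +
      (poly41 (fun j k => theta (lam j k) τ) + poly43 (fun j k => theta (lam j k) τ)) := by
    simp only [tildeThetaCube, pow_zero, mul_zero, one_mul]
    ring
  rw [h, poly_40_42_eq hr ht, poly_41_43_eq hr ht]
  generalize thA 1 0 τ = a at *
  generalize thA 1 4 τ = b at *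
  generalize thA 1 2 τ = A2 at *
  generalize thA 1 1 τ = A1 at *
  generalize thA 1 3 τ = A3 at *
  -- By `hs` the left side becomes (a + b)⁴ A2⁴ ((a + b)⁴ - 16 A2⁴), and 16 A2⁴ = 8ab(a² + b²) turns
  -- the last factor into (a - b)⁴.
  linear_combination (a + b) ^ 3 * A2 ^ 3 * ((a + b) ^ 2 - 4 * A2 ^ 2) * hs -
    16 * (a + b) ^ 4 * A2 ^ 4 * hr.r1

/-! ### Translation eigenvalues and the case d = 4 -/

/-- The function `F` is an eigenfunction of `τ ↦ τ + 1` with eigenvalue `ζ₃₂ ^ w`. -/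
def IsShiftEigen (w : ℤ) (F : ℂ → ℂ) : Prop := ∀ τ, F (τ + 1) = zeta 32 ^ w * F τ

namespace IsShiftEigen

variable {w : ℤ} {F G : ℂ → ℂ}

theorem add (hF : IsShiftEigen w F) (hG : IsShiftEigen w G) :
    IsShiftEigen w (fun τ => F τ + G τ) := fun τ => by
  simp only [hF τ, hG τ, mul_add]

theorem sub (hF : IsShiftEigen w F) (hG : IsShiftEigen w G) :
    IsShiftEigen w (fun τ => F τ - G τ) := fun τ => by
  simp only [hF τ, hG τ, mul_sub]

theorem neg (hF : IsShiftEigen w F) : IsShiftEigen w (fun τ => -F τ) := fun τ => by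
  simp only [hF τ, mul_neg]

theorem const_mul (c : ℂ) (hF : IsShiftEigen w F) : IsShiftEigen w (fun τ => c * F τ) := fun τ => by
  simp only [hF τ]
  ring

theorem theta_mul (α β γ : Weight) (h : wt α + wt β + wt γ ≡ w [ZMOD 32]) :
    IsShiftEigen w (fun τ => theta α τ * (theta β τ * theta γ τ)) := fun τ => by
  have hz : zeta 32 ^ w = zeta 32 ^ wt α * zeta 32 ^ wt β * zeta 32 ^ wt γ := by
    rw [← zpow_add₀ (zeta_ne_zero 32), ← zpow_add₀ (zeta_ne_zero 32)]
    exact (zeta_zpow_congr (by norm_num) h).symm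
  simp only [theta_add_one_right]
  rw [hz]
  ring

end IsShiftEigen

/-- Within each of the four polynomials all monomials have the same total weight mod 32. The weights
are taken as 15, 23, 31, 39, the last rather than 7, so that consecutive eigenvalues differ by ζ₃₂⁸
= ζ₄. -/
theorem isShiftEigen_poly40 :
    IsShiftEigen 15 (fun τ => poly40 fun j k => theta (lam j k) τ) := by
  simp only [poly40, mul_assoc, neg_mul]
  repeat' first
    | apply IsShiftEigen.theta_mul
    | apply IsShiftEigen.add
    | apply IsShiftEigen.sub
    | apply IsShiftEigen.neg
    | apply IsShiftEigen.const_mul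
  all_goals decide

theorem isShiftEigen_poly41 :
    IsShiftEigen 23 (fun τ => poly41 fun j k => theta (lam j k) τ) := by
  simp only [poly41, mul_assoc]
  repeat' first
    | apply IsShiftEigen.theta_mul
    | apply IsShiftEigen.add
    | apply IsShiftEigen.sub
    | apply IsShiftEigen.neg
    | apply IsShiftEigen.const_mul
  all_goals decide

theorem isShiftEigen_poly42 :
    IsShiftEigen 31 (fun τ => poly42 fun j k => theta (lam j k) τ) := by
  simp only [poly42, mul_assoc, neg_mul]
  repeat' first
    | apply IsShiftEigen.theta_mul
    | apply IsShiftEigen.add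
    | apply IsShiftEigen.sub
    | apply IsShiftEigen.neg
    | apply IsShiftEigen.const_mul
  all_goals decide

theorem isShiftEigen_poly43 :
    IsShiftEigen 39 (fun τ => poly43 fun j k => theta (lam j k) τ) := by
  simp only [poly43, mul_assoc, neg_mul]
  repeat' first
    | apply IsShiftEigen.theta_mul
    | apply IsShiftEigen.add
    | apply IsShiftEigen.sub
    | apply IsShiftEigen.neg
    | apply IsShiftEigen.const_mul
  all_goals decide

theorem IsShiftEigen.add_nat {w : ℤ} {F : ℂ → ℂ} (hF : IsShiftEigen w F) (τ : ℂ) (b : ℕ) :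
    F (τ + b) = zeta 32 ^ (w * b) * F τ := by
  induction b with
  | zero => simp
  | succ b ih =>
    rw [Nat.cast_succ, ← add_assoc, hF, ih, ← mul_assoc, ← zpow_add₀ (zeta_ne_zero 32)]
    congr 2
    push_cast
    ring

/-- The factors ζ₃₂^{15b} ζ₄^{ib} are the eigenvalues of the four summands under translation by b,
so every b reduces to b = 0. -/
theorem tildeThetaCube_four (τ : ℂ) (b : ℕ) :
    tildeThetaCube 4 b τ = (-1) ^ b * tildeThetaCube 4 0 (τ + b) := by
  have hz (i : ℕ) : zeta 4 ^ i = zeta 32 ^ (8 * i) := by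
    rw [zeta, zeta, ← Complex.exp_nat_mul, ← Complex.exp_nat_mul]
    congr 1
    push_cast
    ring
  have h0 := isShiftEigen_poly40.add_nat τ b
  have h1 := isShiftEigen_poly41.add_nat τ b
  have h2 := isShiftEigen_poly42.add_nat τ b
  have h3 := isShiftEigen_poly43.add_nat τ b
  have e (n : ℕ) : zeta 32 ^ ((n : ℤ) * (b : ℤ)) = (zeta 32 ^ n) ^ b := by
    rw [← Nat.cast_mul, zpow_natCast, pow_mul]
  have e0 := e 15
  have e1 := e 23
  have e2 := e 31
  have e3 := e 39
  push_cast at e0 e1 e2 e3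
  rw [e0] at h0
  rw [e1] at h1
  rw [e2] at h2
  rw [e3] at h3
  simp only [tildeThetaCube, h0, h1, h2, h3, hz, mul_zero, pow_zero, one_mul, mul_one]
  rw [show 8 * (2 * b) = 16 * b by ring, show 8 * (3 * b) = 24 * b by ring, pow_mul, pow_mul,
    pow_mul, pow_mul]
  rw [show zeta 32 ^ 23 = zeta 32 ^ 15 * zeta 32 ^ 8 by ring,
    show zeta 32 ^ 31 = zeta 32 ^ 15 * zeta 32 ^ 16 by ring,
    show zeta 32 ^ 39 = zeta 32 ^ 15 * zeta 32 ^ 24 by ring, mul_pow, mul_pow, mul_pow]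
  ring

theorem zeta_eight_pow_four : zeta 8 ^ 4 = -1 := by
  rw [zeta, ← Complex.exp_nat_mul, ← Complex.exp_pi_mul_I]
  congr 1
  push_cast
  ring

theorem thetaProd_add_nat {τ : ℂ} (hτ : 0 < τ.im) (b : ℕ) :
    thetaProd (τ + b) = zeta 8 ^ b * thetaProd τ := by
  induction b with
  | zero => simp
  | succ b ih =>
    rw [Nat.cast_succ, ← add_assoc, thetaProd_add_one (by simpa using hτ), ih]
    ring

theorem im_div_natCast_pos {τ : ℂ} {a d : ℕ} (ha : 0 < a) (hd : 0 < d) (b : ℕ) (hτ : 0 < τ.im) :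
    0 < ((a * τ + b) / d).im := by
  rw [← Complex.ofReal_natCast d, Complex.div_ofReal_im]
  have : ((a : ℂ) * τ + b).im = a * τ.im := by simp
  rw [this]
  positivity

theorem Theta_cube_eq_tildeThetaCube (a d b : ℕ) (had : a * d = 4) (hb : b < d) (τ : ℂ)
    (hτ : 0 < τ.im) : Theta a d b τ ^ 3 = tildeThetaCube d b τ := by
  have hd : d ∣ 4 := Dvd.intro_left a had
  have hd4 : d ≤ 4 := Nat.le_of_dvd (by norm_num) hd
  have hd0 : 0 < d := by omega
  have ha : 0 < a := Nat.pos_of_ne_zero (by rintro rfl; omega)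
  rw [Theta_cube a d b hτ (im_div_natCast_pos ha hd0 b hτ)]
  interval_cases d
  · obtain rfl : a = 4 := by omega
    obtain rfl : b = 0 := by omega
    rw [tildeThetaCube_one hτ]
    norm_num
  · obtain rfl : a = 2 := by omega
    interval_cases b
    · have : (((2 : ℕ) : ℂ) * τ + (0 : ℕ)) / (2 : ℕ) = τ := by
        push_cast
        ring
      rw [tildeThetaCube_two_zero hτ, this]
      have := thetaProd_ne_zero hτ
      field_simp
    · have : (((2 : ℕ) : ℂ) * τ + (1 : ℕ)) / (2 : ℕ) = τ + 1 / 2 := by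
        push_cast
        ring
      rw [tildeThetaCube_two_one hτ, this]
  · omega
  · obtain rfl : a = 1 := by omega
    have h : (((1 : ℕ) : ℂ) * τ + b) / (4 : ℕ) = (τ + b) / 4 := by
      push_cast
      ring
    -- Translating the fourth power of `thetaProd` by b costs (ζ₈⁴)^b = (-1)^b, which the sign
    -- prefix cancels.
    rw [tildeThetaCube_four, tildeThetaCube_four_zero (by simpa using hτ), thetaProd_add_nat hτ, h,
      mul_pow, ← pow_mul, mul_comm b, pow_mul, zeta_eight_pow_four, mul_div_assoc, ← mul_assoc,
      ← mul_pow]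
    norm_num

/-! ### The S-transformation -/

/-- The arguments are at most π/2 in absolute value, one of them strictly, so their sum stays in the
principal range. -/
theorem mul_cpow_of_re {x y : ℂ} (hx : x ≠ 0) (hx' : 0 ≤ x.re) (hy : 0 < y.re) (s : ℂ) :
    (x * y) ^ s = x ^ s * y ^ s := by
  have hy0 : y ≠ 0 := by
    rintro rfl
    simp at hy
  have h1 := abs_le.1 (Complex.abs_arg_le_pi_div_two_iff.2 hx')
  have h2 := abs_lt.1 (Complex.abs_arg_lt_pi_div_two_iff.2 (Or.inl hy))
  rw [Complex.cpow_def_of_ne_zero (mul_ne_zero hx hy0), Complex.cpow_def_of_ne_zero hx,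
    Complex.cpow_def_of_ne_zero hy0, ← Complex.exp_add,
    Complex.log_mul hx hy0 ⟨by linarith, by linarith⟩, add_mul]

theorem neg_I_mul_re (τ : ℂ) : (-Complex.I * τ).re = τ.im := by simp

/-- The transformation of `thetaProd` under `y ↦ y / (k * y + 1)`. -/
theorem thetaProd_div_mul_add_one {y : ℂ} (hy : 0 < y.im) (k : ℕ) :
    zeta 8 ^ k * thetaProd (y / (k * y + 1)) = ((k * y + 1) ^ (1 / 2 : ℂ)) ^ 3 * thetaProd y := by
  have hy0 : y ≠ 0 := by
    rintro rfl
    simp at hy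
  -- The map y ↦ y/(ky + 1) is an inversion, a translation by -k and another inversion, with w =
  -- -1/y - k as intermediate point.
  have hw : 0 < (-1 / y - k).im := by simpa using im_neg_one_div_pos hy
  -- The factor ky + 1 is the product of -iw and -iy, both in the right half-plane, so its square
  -- root splits.
  have h0 : (k : ℂ) * y + 1 = -Complex.I * (-1 / y - k) * (-Complex.I * y) := by
    field_simp
    ring_nf
    simp
    ring
  have h1 : y / (k * y + 1) = -1 / (-1 / y - k) := by
    rw [show -1 / y - k = -((k * y + 1) / y) by field_simp; ring]
    rw [neg_div_neg_eq, one_div_div]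
  have h2 := thetaProd_add_nat hw k
  rw [sub_add_cancel, thetaProd_neg_one_div hy] at h2
  rw [h1, thetaProd_neg_one_div hw, h0, mul_cpow_of_re (neg_I_mul_ne_zero hw)
    (by rw [neg_I_mul_re]; exact hw.le) (by rw [neg_I_mul_re]; exact hy), mul_pow]
  linear_combination (-((-Complex.I * (-1 / y - k)) ^ (1 / 2 : ℂ)) ^ 3) * h2

theorem I_cpow_half : Complex.I ^ (1 / 2 : ℂ) = zeta 8 := by
  rw [Complex.cpow_def_of_ne_zero Complex.I_ne_zero, Complex.log_I, zeta]
  congr 1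
  push_cast
  ring

theorem half_cpow_half : (1 / 2 : ℂ) ^ (1 / 2 : ℂ) = (Real.sqrt 2 : ℂ)⁻¹ := by
  rw [← Complex.ofReal_inv, ← Real.sqrt_inv, Real.sqrt_eq_rpow, Complex.ofReal_cpow (by norm_num)]
  norm_num

theorem cpow_half_pow_nine (z : ℂ) : (z ^ (1 / 2 : ℂ)) ^ 9 = z ^ (9 / 2 : ℂ) := by
  rw [← Complex.cpow_nat_mul]
  norm_num

section

variable {τ : ℂ}

theorem thetaProd_neg_four_div (hτ : 0 < τ.im) :
    8 * thetaProd (4 * (-1 / τ)) = ((-Complex.I * τ) ^ (1 / 2 : ℂ)) ^ 3 * thetaProd (τ / 4) := by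
  have h4 : 0 < (τ / 4).im := by simpa using hτ
  have h : (1 / 4 : ℂ) ^ (1 / 2 : ℂ) = 1 / 2 := by
    rw [show (1 / 4 : ℂ) = 1 / 2 * (1 / 2) by norm_num,
      mul_cpow_of_re (by norm_num) (by norm_num) (by norm_num), ← Complex.cpow_add _ _ (by norm_num)]
    norm_num
  -- The constant 8 is the inverse cube of (1/4)^{1/2} = 1/2.
  rw [show 4 * (-1 / τ) = -1 / (τ / 4) by field_simp, thetaProd_neg_one_div h4,
    show -Complex.I * (τ / 4) = 1 / 4 * (-Complex.I * τ) by ring,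
    mul_cpow_of_re (by norm_num) (by norm_num) (by rw [neg_I_mul_re]; exact hτ), h]
  ring

theorem cpow_half_eq (hτ : 0 < τ.im) :
    τ ^ (1 / 2 : ℂ) = zeta 8 * (-Complex.I * τ) ^ (1 / 2 : ℂ) := by
  rw [← I_cpow_half, ← mul_cpow_of_re Complex.I_ne_zero (by simp)
    (by rw [neg_I_mul_re]; exact hτ), ← mul_assoc, mul_neg, Complex.I_mul_I, neg_neg, one_mul]

theorem thetaProd_neg_one_div_add_half (hτ : 0 < τ.im) :
    2 * (Real.sqrt 2 : ℂ) * thetaProd (-1 / τ + 1 / 2) =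
      ((-Complex.I * τ) ^ (1 / 2 : ℂ)) ^ 3 * thetaProd ((τ + 2) / 4) := by
  have hτ0 : τ ≠ 0 := by
    rintro rfl
    simp at hτ
  -- For y = (τ - 2)/4 and k = 2 one has 2y + 1 = τ/2 and y/(2y + 1) = -1/τ + 1/2; translation by
  -- one then leads to (τ + 2)/4.
  have hy : 0 < ((τ - 2) / 4).im := by simpa using hτ
  have h := thetaProd_div_mul_add_one hy 2
  have h1 := thetaProd_add_one hy
  have e1 : (2 : ℕ) * ((τ - 2) / 4) + 1 = 1 / 2 * τ := by push_cast; ring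
  have e2 : (τ - 2) / 4 / (1 / 2 * τ) = -1 / τ + 1 / 2 := by field_simp; ring
  have h2 : (Real.sqrt 2 : ℂ) ^ 2 = 2 := by
    rw [← Complex.ofReal_pow, Real.sq_sqrt (by norm_num)]
    norm_num
  have hs : (Real.sqrt 2 : ℂ) ≠ 0 := by
    intro h0
    simp [h0] at h2
  have h3 : (1 / 2 * τ) ^ (1 / 2 : ℂ) =
      (Real.sqrt 2 : ℂ)⁻¹ * (zeta 8 * (-Complex.I * τ) ^ (1 / 2 : ℂ)) := by
    rw [← half_cpow_half, show 1 / 2 * τ = 1 / 2 * Complex.I * (-Complex.I * τ) by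
      linear_combination (τ / 2) * Complex.I_mul_I, mul_cpow_of_re (by simp) (by simp)
      (by rw [neg_I_mul_re]; exact hτ), ← I_cpow_half, ← mul_assoc]
    congr 1
    rw [mul_comm, mul_cpow_of_re Complex.I_ne_zero (by simp) (by norm_num), mul_comm]
  rw [e1, e2, h3] at h
  rw [show (τ - 2) / 4 + 1 = (τ + 2) / 4 by ring] at h1
  rw [h1]
  have h8 := zeta_ne_zero 8
  apply mul_left_cancel₀ (pow_ne_zero 2 h8)
  have h4 : (Real.sqrt 2 : ℂ)⁻¹ ^ 3 * (2 * (Real.sqrt 2 : ℂ)) = 1 := by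
    field_simp
    exact h2.symm
  linear_combination (2 * (Real.sqrt 2 : ℂ)) * h + (zeta 8 ^ 3 *
    ((-Complex.I * τ) ^ (1 / 2 : ℂ)) ^ 3 * thetaProd ((τ - 2) / 4)) * h4

theorem thetaProd_neg_one_div_add_one_div_four (hτ : 0 < τ.im) :
    zeta 4 * thetaProd ((-1 / τ + 1) / 4) =
      ((-Complex.I * τ) ^ (1 / 2 : ℂ)) ^ 3 * thetaProd ((τ + 3) / 4) := by
  have hτ0 : τ ≠ 0 := by
    rintro rfl
    simp at hτ
  -- For y = (τ - 1)/4 and k = 4 one has 4y + 1 = τ and y/τ = (-1/τ + 1)/4.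
  have hy : 0 < ((τ - 1) / 4).im := by simpa using hτ
  have h := thetaProd_div_mul_add_one hy 4
  have h1 := thetaProd_add_one hy
  have e1 : (4 : ℕ) * ((τ - 1) / 4) + 1 = τ := by push_cast; ring
  have e2 : (τ - 1) / 4 / τ = (-1 / τ + 1) / 4 := by field_simp; ring
  have e3 : zeta 4 = zeta 8 ^ 2 := by
    rw [zeta, zeta, ← Complex.exp_nat_mul]
    congr 1
    push_cast
    ring
  rw [e1, e2, cpow_half_eq hτ] at h
  rw [show (τ - 1) / 4 + 1 = (τ + 3) / 4 by ring] at h1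
  rw [h1, e3]
  apply mul_left_cancel₀ (pow_ne_zero 2 (zeta_ne_zero 8))
  linear_combination h

/-- With u = (-iτ)^{1/2} the numerator `thetaProd ^ 4` contributes u¹² and the denominator u³/c,
leaving c u⁹. -/
theorem Theta_cube_neg_one_div {a d b a' d' b' : ℕ} (hτ : 0 < τ.im)
    (h : 0 < ((a * (-1 / τ) + b) / d).im) (h' : 0 < ((a' * τ + b') / d').im) {c : ℂ}
    (hc : c * thetaProd ((a * (-1 / τ) + b) / d) =
      ((-Complex.I * τ) ^ (1 / 2 : ℂ)) ^ 3 * thetaProd ((a' * τ + b') / d')) :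
    Theta a d b (-1 / τ) ^ 3 = (-Complex.I * τ) ^ (9 / 2 : ℂ) * c * Theta a' d' b' τ ^ 3 := by
  rw [Theta_cube _ _ _ (im_neg_one_div_pos hτ) h, Theta_cube _ _ _ hτ h', ← cpow_half_pow_nine,
    thetaProd_neg_one_div hτ, ← mul_div_assoc _ (thetaProd τ ^ 4),
    div_eq_div_iff (thetaProd_ne_zero h) (thetaProd_ne_zero h')]
  linear_combination (-((-Complex.I * τ) ^ (1 / 2 : ℂ)) ^ 9 * thetaProd τ ^ 4) * hc

theorem Theta_four_one_zero_S (hτ : 0 < τ.im) : Theta 4 1 0 (-1 / τ) ^ 3 =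
    (-Complex.I * τ) ^ (9 / 2 : ℂ) * 2 ^ 3 * Theta 1 4 0 τ ^ 3 := by
  refine Theta_cube_neg_one_div hτ
    (im_div_natCast_pos (by norm_num) (by norm_num) _ (im_neg_one_div_pos hτ))
    (im_div_natCast_pos (by norm_num) (by norm_num) _ hτ) ?_
  have h := thetaProd_neg_four_div hτ
  norm_num at h ⊢
  exact h

theorem Theta_two_two_zero_S (hτ : 0 < τ.im) : Theta 2 2 0 (-1 / τ) ^ 3 =
    (-Complex.I * τ) ^ (9 / 2 : ℂ) * Theta 2 2 0 τ ^ 3 := by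
  rw [← mul_one ((-Complex.I * τ) ^ (9 / 2 : ℂ))]
  refine Theta_cube_neg_one_div hτ
    (im_div_natCast_pos (by norm_num) (by norm_num) _ (im_neg_one_div_pos hτ))
    (im_div_natCast_pos (by norm_num) (by norm_num) _ hτ) ?_
  have h (z : ℂ) : ((2 : ℕ) * z + (0 : ℕ)) / (2 : ℕ) = z := by push_cast; ring
  rw [h, h, one_mul]
  exact thetaProd_neg_one_div hτ

theorem Theta_two_two_one_S (hτ : 0 < τ.im) : Theta 2 2 1 (-1 / τ) ^ 3 =
    (-Complex.I * τ) ^ (9 / 2 : ℂ) * (2 * (Real.sqrt 2 : ℂ)) * Theta 1 4 2 τ ^ 3 := by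
  refine Theta_cube_neg_one_div hτ
    (im_div_natCast_pos (by norm_num) (by norm_num) _ (im_neg_one_div_pos hτ))
    (im_div_natCast_pos (by norm_num) (by norm_num) _ hτ) ?_
  rw [show ((2 : ℕ) * (-1 / τ) + (1 : ℕ)) / (2 : ℕ) = -1 / τ + 1 / 2 by push_cast; ring,
    show ((1 : ℕ) * τ + (2 : ℕ)) / (4 : ℕ) = (τ + 2) / 4 by push_cast; ring]
  exact thetaProd_neg_one_div_add_half hτ

theorem Theta_one_four_one_S (hτ : 0 < τ.im) : Theta 1 4 1 (-1 / τ) ^ 3 =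
    (-Complex.I * τ) ^ (9 / 2 : ℂ) * zeta 4 * Theta 1 4 3 τ ^ 3 := by
  refine Theta_cube_neg_one_div hτ
    (im_div_natCast_pos (by norm_num) (by norm_num) _ (im_neg_one_div_pos hτ))
    (im_div_natCast_pos (by norm_num) (by norm_num) _ hτ) ?_
  rw [show ((1 : ℕ) * (-1 / τ) + (1 : ℕ)) / (4 : ℕ) = (-1 / τ + 1) / 4 by push_cast; ring,
    show ((1 : ℕ) * τ + (3 : ℕ)) / (4 : ℕ) = (τ + 3) / 4 by push_cast; ring]
  exact thetaProd_neg_one_div_add_one_div_four hτ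

end

/-! ### Orbits on M*/4M -/

theorem exists_of_mem_fourM {β : Weight} (h : β ∈ fourM) :
    ∃ n₁ n₂ n₃ : ℤ, coordX β = 8 * n₁ ∧ coordY β = 8 * n₂ ∧ coordZ β = 8 * n₃ ∧
      Even (n₁ + n₂ + n₃) := by
  obtain ⟨k, rfl⟩ := h
  refine ⟨k 1, k 0 + k 2 - k 1, k 2 - k 0, ?_, ?_, ?_, k 2, by ring⟩ <;>
  · simp [coordX, coordY, coordZ, C, CartanMatrix.A, Matrix.mulVec, dotProduct, Fin.sum_univ_three]
    ring

/-- The vectors (16, 0, 0), (-8, 4, 0), (-12, 0, 4) form a triangular basis of 4M, which shows the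
index 256. -/
theorem mem_fourM_of_eq {β : Weight} {l m n : ℤ} (h0 : β 0 = 16 * l - 8 * m - 12 * n)
    (h1 : β 1 = 4 * m) (h2 : β 2 = 4 * n) : β ∈ fourM := by
  refine ⟨![3 * l - m - 2 * n, 2 * l - n, l], ?_⟩
  ext i
  fin_cases i <;>
    simp [h0, h1, h2, C, CartanMatrix.A, Matrix.mulVec, dotProduct, Fin.sum_univ_three] <;> ring

/-- An even function on `ℤ` of period `8`. -/
def keyEven (j : ℤ) : ℤ := (j % 8) * (8 - j % 8) + 1

/-- An even function on `ℤ` which changes sign under translation by `8`. -/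
def keyOdd (j : ℤ) : ℤ := if j % 16 ≤ 8 then 4 - j % 16 else j % 16 - 12

theorem keyEven_neg (j : ℤ) : keyEven (-j) = keyEven j := by
  unfold keyEven
  rcases eq_or_ne (j % 8) 0 with h | h
  · rw [h, show -j % 8 = 0 by omega]
  · rw [show -j % 8 = 8 - j % 8 by omega]
    ring

theorem keyOdd_neg (j : ℤ) : keyOdd (-j) = keyOdd j := by
  unfold keyOdd
  split_ifs <;> omega

theorem keyEven_add (j n : ℤ) : keyEven (j + 8 * n) = keyEven j := by
  rw [keyEven, keyEven, Int.add_mul_emod_self_left]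

theorem keyOdd_add (j n : ℤ) : keyOdd (j + 8 * n) = ((-1) ^ n : ℤˣ) * keyOdd j := by
  rcases Int.even_or_odd n with h | h
  · obtain ⟨k, rfl⟩ := id h
    rw [h.neg_one_zpow, keyOdd, keyOdd, show (j + 8 * (k + k)) % 16 = j % 16 by omega]
    simp
  · obtain ⟨k, rfl⟩ := id h
    rw [h.neg_one_zpow, keyOdd, keyOdd]
    push_cast
    split_ifs <;> omega

/-- A function on the weight lattice which separates the orbits. -/
def key (β : Weight) : ℤ :=
  keyEven (coordX β) * keyEven (coordY β) * keyEven (coordZ β) +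
    keyOdd (coordX β) * keyOdd (coordY β) * keyOdd (coordZ β)

theorem key_neg (β : Weight) : key (-β) = key β := by
  obtain ⟨h1, h2, h3⟩ := coord_neg β
  simp only [key, h1, h2, h3, keyEven_neg, keyOdd_neg]

/-- Elements of 4M move the coordinates by 8n₁, 8n₂, 8n₃ with even sum, so the three signs picked up
by `keyOdd` cancel, as they do for the theta functions. -/
theorem key_congr {β γ : Weight} (h : β - γ ∈ fourM) : key β = key γ := by
  obtain ⟨n₁, n₂, n₃, h1, h2, h3, h⟩ := exists_of_mem_fourM h
  have e1 : coordX β = coordX γ + 8 * n₁ := by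
    rw [← h1]
    simp only [coordX, Pi.sub_apply]
    ring
  have e2 : coordY β = coordY γ + 8 * n₂ := by
    rw [← h2]
    simp only [coordY, Pi.sub_apply]
    ring
  have e3 : coordZ β = coordZ γ + 8 * n₃ := by
    rw [← h3]
    simp only [coordZ, Pi.sub_apply]
    ring
  have e : (((-1) ^ n₁ : ℤˣ) : ℤ) * ((-1) ^ n₂ : ℤˣ) * ((-1) ^ n₃ : ℤˣ) = 1 := by
    rw [← Units.val_mul, ← Units.val_mul, ← _root_.zpow_add, ← _root_.zpow_add, h.neg_one_zpow,
      Units.val_one]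
  rw [key, key, e1, e2, e3]
  simp only [keyEven_add, keyOdd_add]
  linear_combination (keyOdd (coordX γ) * keyOdd (coordY γ) * keyOdd (coordZ γ)) * e

theorem key_eq_of_mem_orbit {β γ : Weight} (h : fourM.mkQ β ∈ orbit γ) : key β = key γ := by
  obtain ⟨w, hw, h⟩ := h
  have hk : key (w γ) = key γ := weylGroup_invariant
    (even_prod_simpleReflection keyEven_neg keyOdd_neg) hw γ
  rcases h with h | h
  · rw [key_congr ((Submodule.Quotient.eq fourM).1 h), hk]
  · rw [key_congr ((Submodule.Quotient.eq fourM).1 h), key_neg, hk]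

/-- Evaluating the invariant on the 22 vectors gives distinct values, so no two share an orbit. -/
theorem key_lam_injOn : ∀ p ∈ lamIndex, ∀ q ∈ lamIndex,
    key (lam p.1 p.2) = key (lam q.1 q.2) → p = q := by
  decide +kernel

/-- The coordinates of a simple reflection of a weight vector. -/
def reflectTriple (i : Fin 3) (v : ℤ × ℤ × ℤ) : ℤ × ℤ × ℤ :=
  match i with
  | 0 => (-v.1, v.1 + v.2.1, v.2.2)
  | 1 => (v.1 + v.2.1, -v.2.1, v.2.1 + v.2.2)
  | 2 => (v.1, v.2.1 + v.2.2, -v.2.2)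

/-- The weight vector with given coordinates. -/
def ofTriple (v : ℤ × ℤ × ℤ) : Weight := ![v.1, v.2.1, v.2.2]

theorem ofTriple_reflectTriple (i : Fin 3) (v : ℤ × ℤ × ℤ) :
    ofTriple (reflectTriple i v) = simpleReflection i (ofTriple v) := by
  ext j
  rw [simpleReflection_apply]
  fin_cases i <;> fin_cases j <;> simp [ofTriple, reflectTriple, C, CartanMatrix.A] <;> ring

theorem exists_weylGroup_foldr (l : List (Fin 3)) (v : ℤ × ℤ × ℤ) :
    ∃ w ∈ weylGroup, w (ofTriple v) = ofTriple (l.foldr reflectTriple v) := by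
  induction l with
  | nil => exact ⟨1, one_mem _, rfl⟩
  | cons i l ih =>
    obtain ⟨w, hw, h⟩ := ih
    refine ⟨simpleReflection i * w, mul_mem (Subgroup.subset_closure ⟨i, rfl⟩) hw, ?_⟩
    rw [LinearEquiv.mul_apply, h, List.foldr_cons, ofTriple_reflectTriple]

/-- A complete invariant of the class of a weight vector in `M* / 4M`. -/
def classCode (v : ℤ × ℤ × ℤ) : ℕ :=
  (16 * ((v.1 + 8 * (v.2.1 / 4) + 12 * (v.2.2 / 4)) % 16) + 4 * (v.2.1 % 4) + v.2.2 % 4).toNat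

theorem classCode_lt (v : ℤ × ℤ × ℤ) : classCode v < 256 := by
  unfold classCode
  omega

/-- The code records the remainder of reduction by the triangular basis of 4M: the last two entries
mod 4, then the corrected first entry mod 16. -/
theorem sub_mem_fourM_of_classCode_eq {u v : ℤ × ℤ × ℤ} (h : classCode u = classCode v) :
    ofTriple u - ofTriple v ∈ fourM := by
  obtain ⟨a, b, c⟩ := u
  obtain ⟨a', b', c'⟩ := v
  simp only [classCode] at h
  refine mem_fourM_of_eq (l := (a - a' + 8 * (b / 4 - b' / 4) + 12 * (c / 4 - c' / 4)) / 16)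
    (m := b / 4 - b' / 4) (n := c / 4 - c' / 4) ?_ ?_ ?_ <;>
    simp only [ofTriple, Pi.sub_apply, cons_val] <;> omega

/-- Reduced words for the elements of the Weyl group. -/
def reducedWords : List (List (Fin 3)) :=
  [[], [0]].flatMap fun u => [[], [1], [1, 0]].flatMap fun v =>
    [[], [2], [2, 1], [2, 1, 0]].map fun w => u ++ v ++ w

/-- The coordinates of `lam j k`. -/
def lamTriple (p : ℕ × ℕ) : ℤ × ℤ × ℤ := (lam p.1 p.2 0, lam p.1 p.2 1, lam p.1 p.2 2)

/-- The indices `(j, k)`, as a list. -/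
def lamList : List (ℕ × ℕ) :=
  [(0, 1), (1, 1), (1, 2), (1, 3), (1, 4), (1, 5), (1, 6), (1, 7), (1, 8), (2, 1), (2, 2), (2, 3),
    (3, 1), (3, 3), (3, 5), (3, 7), (4, 1), (4, 2), (5, 1), (6, 1), (7, 1), (8, 1)]

/-- The codes of the members of the orbits of the chosen weight vectors. -/
def orbitCodes : List ℕ :=
  lamList.flatMap fun p => reducedWords.flatMap fun l =>
    let v := l.foldr reflectTriple (lamTriple p)
    [classCode v, classCode (-v)]

/-- Collecting the codes as bits of one integer replaces 256 membership checks by the single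
equality with 2²⁵⁶ - 1. -/
theorem mem_of_testBit_foldr (L : List ℕ) {n : ℕ}
    (h : (L.foldr (fun c s => 2 ^ c ||| s) 0).testBit n = true) : n ∈ L := by
  induction L with
  | nil => simp at h
  | cons c L ih =>
    rw [List.foldr_cons, Nat.testBit_or, Bool.or_eq_true, Nat.testBit_two_pow] at h
    rcases h with h | h
    · simp only [decide_eq_true_eq] at h
      simp [h]
    · exact List.mem_cons_of_mem _ (ih h)

theorem foldr_orbitCodes : orbitCodes.foldr (fun c s => 2 ^ c ||| s) 0 = 2 ^ 256 - 1 := by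
  decide +kernel

theorem mem_orbitCodes {n : ℕ} (hn : n < 256) : n ∈ orbitCodes := by
  apply mem_of_testBit_foldr
  rw [foldr_orbitCodes, Nat.testBit_two_pow_sub_one]
  simpa using hn

theorem exists_mem_orbit (x : WeightMod) : ∃ p ∈ lamIndex, x ∈ orbit (lam p.1 p.2) := by
  obtain ⟨β, rfl⟩ := fourM.mkQ_surjective x
  have hβ : β = ofTriple (β 0, β 1, β 2) := by
    ext i
    fin_cases i <;> rfl
  have h := mem_orbitCodes (classCode_lt (β 0, β 1, β 2))
  simp only [orbitCodes, List.mem_flatMap] at h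
  obtain ⟨p, hp, l, -, h⟩ := h
  obtain ⟨w, hw, h1⟩ := exists_weylGroup_foldr l (lamTriple p)
  have h2 : ofTriple (lamTriple p) = lam p.1 p.2 := by
    ext i
    fin_cases i <;> rfl
  have h3 (v : ℤ × ℤ × ℤ) : ofTriple (-v) = -ofTriple v := by
    ext i
    fin_cases i <;> rfl
  have h4 : ∀ q ∈ lamList, q ∈ lamIndex := by decide
  refine ⟨p, h4 p hp, w, hw, ?_⟩
  rw [← h2, h1, ← h3, hβ]
  simp only [List.mem_cons, List.not_mem_nil, or_false] at h
  refine h.imp (fun h => ?_) fun h => ?_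
  · exact (Submodule.Quotient.eq fourM).2 (sub_mem_fourM_of_classCode_eq h)
  · exact (Submodule.Quotient.eq fourM).2 (sub_mem_fourM_of_classCode_eq h)

theorem existsUnique_mem_orbit (x : WeightMod) :
    ∃! p : ℕ × ℕ, p ∈ lamIndex ∧ x ∈ orbit (lam p.1 p.2) := by
  obtain ⟨p, hp, h⟩ := exists_mem_orbit x
  refine ⟨p, ⟨hp, h⟩, fun q ⟨hq, h'⟩ => ?_⟩
  obtain ⟨β, rfl⟩ := fourM.mkQ_surjective x
  exact key_lam_injOn q hq p hp ((key_eq_of_mem_orbit h').symm.trans (key_eq_of_mem_orbit h))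

/-! ### Expressibility of the cubes -/

/-- `F` is an integral linear combination of products of three theta functions. -/
def IsIntegralCubic (F : ℂ → ℂ) : Prop :=
  ∃ n : (Fin 3 → WeightMod) →₀ ℤ, ∀ τ, F τ = n.sum fun β c => (c : ℂ) * ∏ i, thetaMod (β i) τ

namespace IsIntegralCubic

variable {F G : ℂ → ℂ}

theorem add (hF : IsIntegralCubic F) (hG : IsIntegralCubic G) :
    IsIntegralCubic (fun τ => F τ + G τ) := by
  obtain ⟨n, hn⟩ := hF
  obtain ⟨m, hm⟩ := hG
  refine ⟨n + m, fun τ => ?_⟩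
  change F τ + G τ = _
  rw [hn, hm, Finsupp.sum_add_index' (by simp) fun a b c => by push_cast; ring]

theorem intCast_mul (k : ℤ) (hF : IsIntegralCubic F) :
    IsIntegralCubic (fun τ => (k : ℂ) * F τ) := by
  obtain ⟨n, hn⟩ := hF
  refine ⟨k • n, fun τ => ?_⟩
  change k * F τ = _
  rw [hn, Finsupp.sum_smul_index (by simp), Finsupp.mul_sum]
  simp only [Int.cast_mul, mul_assoc]

theorem neg (hF : IsIntegralCubic F) : IsIntegralCubic (fun τ => -F τ) := by
  simpa using hF.intCast_mul (-1)

theorem sub (hF : IsIntegralCubic F) (hG : IsIntegralCubic G) :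
    IsIntegralCubic (fun τ => F τ - G τ) := by
  simpa only [sub_eq_add_neg] using hF.add hG.neg

theorem ofNat_mul (k : ℕ) [k.AtLeastTwo] (hF : IsIntegralCubic F) :
    IsIntegralCubic (fun τ => (OfNat.ofNat k : ℂ) * F τ) := by
  simpa only [Int.cast_ofNat] using hF.intCast_mul (OfNat.ofNat k)

theorem theta_mul (α β γ : Weight) :
    IsIntegralCubic (fun τ => theta α τ * (theta β τ * theta γ τ)) := by
  refine ⟨Finsupp.single ![fourM.mkQ α, fourM.mkQ β, fourM.mkQ γ] 1, fun τ => ?_⟩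
  rw [Finsupp.sum_single_index (by simp), Fin.prod_univ_three]
  simp only [Int.cast_one, one_mul, cons_val, thetaMod_mkQ, mul_assoc]

end IsIntegralCubic

theorem isIntegralCubic_poly10 : IsIntegralCubic (fun τ => poly10 fun j k => theta (lam j k) τ) := by
  simp only [poly10, mul_assoc, pow_succ, pow_zero, one_mul]
  repeat' first
    | apply IsIntegralCubic.theta_mul
    | apply IsIntegralCubic.add
    | apply IsIntegralCubic.sub
    | apply IsIntegralCubic.ofNat_mul

theorem isIntegralCubic_poly20 : IsIntegralCubic (fun τ => poly20 fun j k => theta (lam j k) τ) := by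
  simp only [poly20, mul_assoc, pow_succ, pow_zero, one_mul]
  repeat' first
    | apply IsIntegralCubic.theta_mul
    | apply IsIntegralCubic.add
    | apply IsIntegralCubic.sub
    | apply IsIntegralCubic.ofNat_mul

theorem isIntegralCubic_poly21 : IsIntegralCubic (fun τ => poly21 fun j k => theta (lam j k) τ) := by
  simp only [poly21, mul_assoc, pow_succ, pow_zero, one_mul, neg_mul]
  repeat' first
    | apply IsIntegralCubic.theta_mul
    | apply IsIntegralCubic.add
    | apply IsIntegralCubic.sub
    | apply IsIntegralCubic.neg
    | apply IsIntegralCubic.ofNat_mul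

theorem isIntegralCubic_tildeThetaCube_four_zero : IsIntegralCubic (tildeThetaCube 4 0) := by
  have h : tildeThetaCube 4 0 = fun τ => (poly40 fun j k => theta (lam j k) τ) +
      (poly41 fun j k => theta (lam j k) τ) + (poly42 fun j k => theta (lam j k) τ) +
      (poly43 fun j k => theta (lam j k) τ) := by
    funext τ
    simp [tildeThetaCube]
  rw [h]
  simp only [poly40, poly41, poly42, poly43, mul_assoc, neg_mul]
  repeat' first
    | apply IsIntegralCubic.theta_mul
    | apply IsIntegralCubic.add
    | apply IsIntegralCubic.sub
    | apply IsIntegralCubic.neg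
    | apply IsIntegralCubic.ofNat_mul

theorem zeta_32_pow_sixteen : zeta 32 ^ (16 : ℤ) = -1 := by
  rw [zeta_zpow, ← Complex.exp_pi_mul_I]
  congr 1
  push_cast
  ring

theorem thetaMod_add_nat (x : WeightMod) (τ : ℂ) (b : ℕ) :
    thetaMod x (τ + b) = zeta 32 ^ (b * wt x.out) * thetaMod x τ := by
  have h (σ : ℂ) : thetaMod x σ = theta x.out σ := by
    conv_lhs => rw [← Quotient.out_eq' x]
    rfl
  rw [h, h]
  induction b with
  | zero => simp
  | succ b ih =>
    rw [Nat.cast_add_one, ← add_assoc, theta_add_one_right, ih, ← mul_assoc,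
      ← zpow_add₀ (zeta_ne_zero 32)]
    congr 2
    push_cast
    ring

theorem prod_thetaMod_add_nat {m : ℕ} (β : Fin m → WeightMod) (τ : ℂ) (b : ℕ) :
    ∏ i, thetaMod (β i) (τ + b) =
      zeta 32 ^ (b * ∑ i, wt (β i).out) * ∏ i, thetaMod (β i) τ := by
  simp only [thetaMod_add_nat, Finset.prod_mul_distrib, Finset.mul_sum]
  congr 1
  induction (Finset.univ : Finset (Fin m)) using Finset.cons_induction with
  | empty => simp
  | cons i s hi ih => rw [Finset.prod_cons, ih, Finset.sum_cons, zpow_add₀ (zeta_ne_zero 32)]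

theorem powerExpressible_three : PowerExpressible 3 := by
  intro a d b had hb
  have hd : d ∣ 4 := Dvd.intro_left a had
  have hd4 : d ≤ 4 := Nat.le_of_dvd (by norm_num) hd
  have hd0 : 0 < d := by omega
  have key {F : ℂ → ℂ} (hF : IsIntegralCubic F) (c : ℤ)
      (h : ∀ τ : ℂ, 0 < τ.im → tildeThetaCube d b τ = zeta 32 ^ c * F τ) :
      ∃ (n : (Fin 3 → WeightMod) →₀ ℤ) (k₁ k₂ : (Fin 3 → WeightMod) → ℤ),
        ∀ τ : ℂ, 0 < τ.im → Theta a d b τ ^ 3 =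
          n.sum fun β c => (c : ℂ) * zeta 24 ^ k₁ β * zeta 32 ^ k₂ β * ∏ i, thetaMod (β i) τ := by
    obtain ⟨n, hn⟩ := hF
    refine ⟨n, fun _ => 0, fun _ => c, fun τ hτ => ?_⟩
    rw [Theta_cube_eq_tildeThetaCube a d b had hb τ hτ, h τ hτ, hn, Finsupp.mul_sum]
    refine Finsupp.sum_congr fun β _ => ?_
    rw [zpow_zero]
    ring
  interval_cases d
  · exact key isIntegralCubic_poly10 0 fun τ _ => by simp [tildeThetaCube]
  · interval_cases b
    · exact key isIntegralCubic_poly20 0 fun τ _ => by simp [tildeThetaCube]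
    -- The prefactor ζ₁₆⁻¹ is ζ₃₂⁻².
    · refine key isIntegralCubic_poly21 (-2) fun τ _ => ?_
      have h : (zeta 16)⁻¹ = zeta 32 ^ (-2 : ℤ) := by
        rw [zeta_zpow, zeta, ← Complex.exp_neg]
        congr 1
        push_cast
        ring
      rw [← h]
      rfl
  · omega
  · obtain ⟨n, hn⟩ := isIntegralCubic_tildeThetaCube_four_zero
    -- Translation by b multiplies each monomial by its own power of ζ₃₂, absorbed in k₂; the term
    -- 16b encodes (-1)^b.
    refine ⟨n, fun _ => 0, fun β => 16 * b + b * ∑ i, wt (β i).out, fun τ hτ => ?_⟩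
    rw [Theta_cube_eq_tildeThetaCube a 4 b had hb τ hτ, tildeThetaCube_four, hn, Finsupp.mul_sum]
    refine Finsupp.sum_congr fun β _ => ?_
    rw [zpow_zero, prod_thetaMod_add_nat, zpow_add₀ (zeta_ne_zero 32), _root_.zpow_mul _ 16,
      zeta_32_pow_sixteen, zpow_natCast]
    ring

/-! ### Minimality of the exponent 3 -/

/-- The doubled coordinates have a common parity: if even, the sum of squares is a multiple of 4; if
odd, each square is 1 mod 8. -/
theorem wt_emod_eight (β : Weight) : wt β % 8 = 0 ∨ wt β % 8 = 3 ∨ wt β % 8 = 4 := by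
  have hodd (s : ℤ) : ∃ q, (2 * s + 1) ^ 2 = 8 * q + 1 := by
    obtain ⟨q, hq⟩ := Int.even_mul_succ_self s
    exact ⟨q, by linear_combination 4 * hq⟩
  rcases Int.even_or_odd' (β 0 + β 2) with ⟨s, h | h⟩
  · have : wt β = 4 * ((s + β 1) ^ 2 + s ^ 2 + (β 2 - s) ^ 2) := by
      rw [wt, coordX, coordY, coordZ, show β 0 = 2 * s - β 2 by omega]
      ring
    omega
  · obtain ⟨p, hp⟩ := hodd (s + β 1)
    obtain ⟨q, hq⟩ := hodd s
    obtain ⟨r, hr⟩ := hodd (β 2 - s - 1)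
    have : wt β = 8 * (p + q + r) + 3 := by
      rw [wt, coordX, coordY, coordZ, show β 0 = 2 * s + 1 - β 2 by omega]
      linear_combination hp + hq + hr
    omega

theorem eta_add_nat (τ : ℂ) (b : ℕ) :
    ModularForm.eta (τ + b) = zeta 24 ^ b * ModularForm.eta τ := by
  induction b with
  | zero => simp
  | succ b ih =>
    rw [Nat.cast_add_one, ← add_assoc, eta_add_one, ih]
    ring

/-- The numerator contributes ζ₂₄^{16k} and the denominator ζ₂₄^k, leaving ζ₂₄^{15k} = ζ₈^{5k}. -/
theorem Theta_one_four_zero_add (τ : ℂ) (k : ℕ) :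
    Theta 1 4 0 (τ + (4 * k : ℕ)) = zeta 8 ^ (5 * k) * Theta 1 4 0 τ := by
  have h1 : (((1 : ℕ) : ℂ) * (τ + (4 * k : ℕ)) + (0 : ℕ)) / (4 : ℕ) =
      (((1 : ℕ) : ℂ) * τ + (0 : ℕ)) / (4 : ℕ) + k := by
    push_cast
    ring
  have h2 : zeta 8 = zeta 24 ^ 3 := by
    rw [zeta, zeta, ← Complex.exp_nat_mul]
    congr 1
    push_cast
    ring
  rw [Theta, Theta, h1, eta_add_nat, eta_add_nat, h2]
  have := pow_ne_zero k (zeta_ne_zero 24)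
  field_simp
  ring

theorem sum_zeta_eight_zpow {j : ℤ} (hj : ¬ 8 ∣ j) :
    ∑ k ∈ Finset.range 8, zeta 8 ^ (j * k) = 0 := by
  have hz : IsPrimitiveRoot (zeta 8) 8 := by
    simpa [zeta] using Complex.isPrimitiveRoot_exp 8 (by norm_num)
  have h1 : zeta 8 ^ j ≠ 1 := fun h => hj (by simpa using (hz.zpow_eq_one_iff_dvd j).1 h)
  have h2 : (zeta 8 ^ j) ^ 8 = 1 := by
    rw [← zpow_natCast, ← _root_.zpow_mul]
    exact (hz.zpow_eq_one_iff_dvd _).2 (by simp)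
  simp only [_root_.zpow_mul, zpow_natCast]
  rw [geom_sum_eq h1, h2, sub_self, zero_div]

theorem not_powerExpressible {m : ℕ}
    (hm : ∀ β : Fin m → WeightMod, ¬ 8 ∣ ∑ i, wt (β i).out - 5 * m) : ¬ PowerExpressible m := by
  intro h
  obtain ⟨n, k₁, k₂, h⟩ := h 1 4 0 (by norm_num) (by norm_num)
  have hτ (k : ℕ) : 0 < (Complex.I + (4 * k : ℕ)).im := by simp
  have hz4 : zeta 32 ^ 4 = zeta 8 := by
    rw [zeta, zeta, ← Complex.exp_nat_mul]
    congr 1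
    push_cast
    ring
  -- This twisted average projects onto the eigenvalue ζ₈^{5m} of τ ↦ τ + 4. It multiplies the power
  -- of the eta quotient by 8 but kills every product of theta functions by `hm`.
  have h1 : ∑ k ∈ Finset.range 8, zeta 8 ^ (-(5 * m * k) : ℤ) *
      Theta 1 4 0 (Complex.I + (4 * k : ℕ)) ^ m = 8 * Theta 1 4 0 Complex.I ^ m := by
    rw [Finset.sum_congr rfl (g := fun _ => Theta 1 4 0 Complex.I ^ m)]
    · simp
    · intro k _
      rw [Theta_one_four_zero_add, mul_pow, ← mul_assoc, ← pow_mul, ← zpow_natCast,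
        ← zpow_add₀ (zeta_ne_zero 8)]
      convert one_mul _
      convert zpow_zero _
      push_cast
      ring
  have h2 : ∑ k ∈ Finset.range 8, zeta 8 ^ (-(5 * m * k) : ℤ) *
      Theta 1 4 0 (Complex.I + (4 * k : ℕ)) ^ m = 0 := by
    simp only [h _ (hτ _), prod_thetaMod_add_nat, Finsupp.sum]
    rw [Finset.sum_congr rfl fun k _ => Finset.mul_sum _ _ _, Finset.sum_comm]
    refine Finset.sum_eq_zero fun β _ => ?_
    have h3 := sum_zeta_eight_zpow (hm β)
    calc _ = ∑ k ∈ Finset.range 8, zeta 8 ^ ((∑ i, wt (β i).out - 5 * m) * k) *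
          (n β * zeta 24 ^ k₁ β * zeta 32 ^ k₂ β * ∏ i, thetaMod (β i) Complex.I) := by
          refine Finset.sum_congr rfl fun k _ => ?_
          have h4 : zeta 32 ^ ((4 * k : ℕ) * ∑ i, wt (β i).out) =
              zeta 8 ^ (k * ∑ i, wt (β i).out) := by
            rw [← hz4, ← zpow_natCast _ 4, ← _root_.zpow_mul]
            congr 1
            push_cast
            ring
          rw [h4, sub_mul, zpow_sub₀ (zeta_ne_zero 8), _root_.zpow_neg, div_eq_mul_inv,
            mul_comm (k : ℤ)]
          ring
      _ = 0 := by rw [← Finset.sum_mul, h3, zero_mul]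
  have h0 : Theta 1 4 0 Complex.I ≠ 0 :=
    div_ne_zero (pow_ne_zero 4 (ModularForm.eta_ne_zero (by simp)))
      (ModularForm.eta_ne_zero (im_div_natCast_pos (by norm_num) (by norm_num) _ (by simp)))
  rw [h1] at h2
  exact mul_ne_zero (by norm_num) (pow_ne_zero m h0) h2

/-- The residue 5m mod 8 is 5 for m = 1 and 2 for m = 2; the first is not in {0, 3, 4} and the
second is not a sum of two of its elements mod 8. -/
theorem isLeast_powerExpressible : IsLeast {m : ℕ | 0 < m ∧ PowerExpressible m} 3 := by
  refine ⟨⟨by norm_num, powerExpressible_three⟩, fun m ⟨h0, hm⟩ => ?_⟩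
  by_contra! h3
  refine not_powerExpressible (fun β => ?_) hm
  interval_cases m
  · have h1 := wt_emod_eight (β 0).out
    rw [Fin.sum_univ_one]
    omega
  · have h1 := wt_emod_eight (β 0).out
    have h2 := wt_emod_eight (β 1).out
    rw [Fin.sum_univ_two]
    omega

theorem tildeThetaCube_S {τ : ℂ} (hτ : 0 < τ.im) :
    tildeThetaCube 1 0 (-1 / τ) =
        (-Complex.I * τ) ^ (9 / 2 : ℂ) * 2 ^ 3 * tildeThetaCube 4 0 τ ∧
      tildeThetaCube 2 0 (-1 / τ) =
        (-Complex.I * τ) ^ (9 / 2 : ℂ) * tildeThetaCube 2 0 τ ∧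
      tildeThetaCube 2 1 (-1 / τ) =
        (-Complex.I * τ) ^ (9 / 2 : ℂ) * (2 * (Real.sqrt 2 : ℂ)) * tildeThetaCube 4 2 τ ∧
      tildeThetaCube 4 1 (-1 / τ) =
        (-Complex.I * τ) ^ (9 / 2 : ℂ) * zeta 4 * tildeThetaCube 4 3 τ := by
  have h := im_neg_one_div_pos hτ
  rw [← Theta_cube_eq_tildeThetaCube 4 1 0 rfl (by norm_num) _ h,
    ← Theta_cube_eq_tildeThetaCube 2 2 0 rfl (by norm_num) _ h,
    ← Theta_cube_eq_tildeThetaCube 2 2 1 rfl (by norm_num) _ h,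
    ← Theta_cube_eq_tildeThetaCube 1 4 1 rfl (by norm_num) _ h,
    ← Theta_cube_eq_tildeThetaCube 2 2 0 rfl (by norm_num) _ hτ,
    ← Theta_cube_eq_tildeThetaCube 1 4 0 rfl (by norm_num) _ hτ,
    ← Theta_cube_eq_tildeThetaCube 1 4 2 rfl (by norm_num) _ hτ,
    ← Theta_cube_eq_tildeThetaCube 1 4 3 rfl (by norm_num) _ hτ]
  exact ⟨Theta_four_one_zero_S hτ, Theta_two_two_zero_S hτ, Theta_two_two_one_S hτ,
    Theta_one_four_one_S hτ⟩

end BlowUp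

end

theorem mainTheorem3 :
    -- the orbit decomposition of the weight vectors, with 22 representatives
    (BlowUp.lamIndex.card = 22 ∧
      (∀ x : BlowUp.WeightMod,
        ∃! p : ℕ × ℕ, p ∈ BlowUp.lamIndex ∧ x ∈ BlowUp.orbit (BlowUp.lam p.1 p.2)) ∧
      (∀ (β : BlowUp.Weight) (x : BlowUp.WeightMod), x ∈ BlowUp.orbit β →
        ∀ τ : ℂ, 0 < τ.im → BlowUp.thetaMod x τ = BlowUp.theta β τ)) ∧
    -- the cubes of the eta quotients are the explicit cubic polynomials
    (∀ a d b : ℕ, a * d = 4 → b < d → ∀ τ : ℂ, 0 < τ.im →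
      BlowUp.Theta a d b τ ^ 3 = BlowUp.tildeThetaCube d b τ) ∧
    -- the S-transformation of the cubic polynomials
    (∀ τ : ℂ, 0 < τ.im →
      BlowUp.tildeThetaCube 1 0 (-1 / τ) =
        (-Complex.I * τ) ^ (9 / 2 : ℂ) * 2 ^ 3 * BlowUp.tildeThetaCube 4 0 τ ∧
      BlowUp.tildeThetaCube 2 0 (-1 / τ) =
        (-Complex.I * τ) ^ (9 / 2 : ℂ) * BlowUp.tildeThetaCube 2 0 τ ∧
      BlowUp.tildeThetaCube 2 1 (-1 / τ) =
        (-Complex.I * τ) ^ (9 / 2 : ℂ) * (2 * (Real.sqrt 2 : ℂ)) *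
          BlowUp.tildeThetaCube 4 2 τ ∧
      BlowUp.tildeThetaCube 4 1 (-1 / τ) =
        (-Complex.I * τ) ^ (9 / 2 : ℂ) * BlowUp.zeta 4 * BlowUp.tildeThetaCube 4 3 τ) ∧
    -- the same S-transformation for the cubes of the eta quotients
    (∀ τ : ℂ, 0 < τ.im →
      BlowUp.Theta 4 1 0 (-1 / τ) ^ 3 =
        (-Complex.I * τ) ^ (9 / 2 : ℂ) * 2 ^ 3 * BlowUp.Theta 1 4 0 τ ^ 3 ∧
      BlowUp.Theta 2 2 0 (-1 / τ) ^ 3 =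
        (-Complex.I * τ) ^ (9 / 2 : ℂ) * BlowUp.Theta 2 2 0 τ ^ 3 ∧
      BlowUp.Theta 2 2 1 (-1 / τ) ^ 3 =
        (-Complex.I * τ) ^ (9 / 2 : ℂ) * (2 * (Real.sqrt 2 : ℂ)) *
          BlowUp.Theta 1 4 2 τ ^ 3 ∧
      BlowUp.Theta 1 4 1 (-1 / τ) ^ 3 =
        (-Complex.I * τ) ^ (9 / 2 : ℂ) * BlowUp.zeta 4 * BlowUp.Theta 1 4 3 τ ^ 3) ∧
    -- `3` is the least positive power that is expressible at all
    IsLeast {m : ℕ | 0 < m ∧ BlowUp.PowerExpressible m} 3 :=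
  ⟨⟨rfl, BlowUp.existsUnique_mem_orbit, BlowUp.thetaMod_eq_of_mem_orbit⟩,
    BlowUp.Theta_cube_eq_tildeThetaCube, fun _ hτ => BlowUp.tildeThetaCube_S hτ,
    fun _ hτ => ⟨BlowUp.Theta_four_one_zero_S hτ, BlowUp.Theta_two_two_zero_S hτ,
      BlowUp.Theta_two_two_one_S hτ, BlowUp.Theta_one_four_one_S hτ⟩,
    BlowUp.isLeast_powerExpressible⟩
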